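/- Let $n\ge 4$ and let $S_n$ act on $\mathfrak h=\{w\in\mathbb C^n:\sum_i w_i=0\}$ by permuting coordinates, on $\mathfrak h^*$ by the dual action, and put $V=\mathfrak h^*\oplus\mathfrak h$. Let $y_1,\dots,y_n$ be the standard basis of $\mathbb C^n$ and $x_1,\dots,x_n$ the coordinate functions, and let $\bar y_i=y_i-\frac1n\sum_j y_j\in\mathfrak h$ and $\bar x_i=x_i-\frac1n\sum_j x_j\in\mathfrak h^*$; these vectors span $V$. A parameter map is $\kappa=\kappa^L+\kappa^C$ with $\kappa^L=\sum_{g\in S_n}\kappa^L_g\,g$ and $\kappa^C=\sum_{g\in S_n}\kappa^C_g\,g$, where $\kappa^L_g:V\times V\to V$ and $\kappa^C_g:V\times V\to\mathbb C$ are alternating bilinear maps. Put $$\mathcal H_{\kappa,t}=T(V)\#S_n[t]\big/\big\langle vw-wv-\kappa^L(v,w)t-\kappa^C(v,w)t^2 \mid v,w\in V\big\rangle ,$$ and let $\mathcal H_{\kappa}=\mathcal H_{\kappa,1}$ be the quotient of $T(V)\#S_n$ by the relations $vw-wv=\kappa^L(v,w)+\kappa^C(v,w)$, filtered by giving vectors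 degree one and group elements degree zero. $\mathcal H_\kappa$ is a Drinfeld orbifold algebra if $\operatorname{gr}\mathcal H_\kappa\cong S(V)\#S_n$ as graded algebras. $\mathcal H_{\kappa,t}$ is a Drinfeld orbifold algebra over $\mathbb C[t]$ if $\mathcal H_\kappa$ is a Drinfeld orbifold algebra and $\mathcal H_{\kappa,t}$ is a deformation of $S(V)\#S_n$ over $\mathbb C[t]$, i.e. there is a $\mathbb C[t]$-module isomorphism $(S(V)\#S_n)[t]\to\mathcal H_{\kappa,t}$ fixing the elements of $V$ and of $S_n$ and through which the product of $\mathcal H_{\kappa,t}$ reduces modulo $t$ to that of $S(V)\#S_n$. **Theorem.** (1) For all $a^\perp,b^\perp,c\in\mathbb C$ there is exactly one parameter map $\kappa=\kappa_{a^\perp,b^\perp,c}$ such that for all $1\le i\ne j\le n$ $$\begin{aligned} \kappa^L(\bar x_i,\bar x_j)&=0, & \kappa^C(\bar x_i,\bar x_j)&=\tfrac{n^2}{4}(b^\perp)^2\sum_{k\ne i,j}\big((ijk)-(kji)\big),\\ \kappa^L(\bar y_i,\bar y_j)&=0, & \kappa^C(\bar y_i,\bar y_j)&=\tfrac{n^2}{4}(a^\perp)^2\sum_{k\ne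 i,j}\big((ijk)-(kji)\big),\\ \kappa^L(\bar x_i,\bar y_i)&=-\tfrac n2\sum_{k\ne i}\big(a^\perp(\bar x_i+\bar x_k)+b^\perp(\bar y_i+\bar y_k)\big)\otimes(ik), & \kappa^C(\bar x_i,\bar y_i)&=c\sum_{k\ne i}(ik),\\ \kappa^L(\bar x_i,\bar y_j)&=\tfrac n2\big(a^\perp(\bar x_i+\bar x_j)+b^\perp(\bar y_i+\bar y_j)\big)\otimes(ij), & \kappa^C(\bar x_i,\bar y_j)&=-c\,(ij)-\tfrac{n^2}{4}a^\perp b^\perp\sum_{k\ne i,j}\big((ijk)-(kji)\big). \end{aligned}$$ (2) For all $a^\perp,b^\perp,c$ and $\kappa=\kappa_{a^\perp,b^\perp,c}$, the algebra $\mathcal H_{\kappa,t}$ is a Drinfeld orbifold algebra over $\mathbb C[t]$. (3) The maps $\kappa_{a^\perp,b^\perp,c}$ are precisely the parameter maps $\kappa$ for which $\mathcal H_{\kappa}$ is a Drinfeld orbifold algebra, $\operatorname{im}\kappa^L_g\subseteq V^g$ for every $g\in S_n$, $\kappa^L$ is supported only off the identity (that is, $\kappa^L_1=0$), and either $\kappa^L\neq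 0$ or $\kappa^C_1=0$. (4) If $a^\perp=b^\perp=0$, then the identity on generators induces an isomorphism from $\mathcal H_{\kappa,1}$ to the rational Cherednik algebra $H_{0,c}$, where $H_{\tau,c}$ is the quotient of $T(V)\#S_n$ by the relations $[x,x']=0$, $[y,y']=0$ and $$[y,x]=\tau\langle x,y\rangle-c\sum_{i<j}\langle x_i-x_j,y\rangle\langle x,y_i-y_j\rangle\,(ij)\qquad(x,x'\in\mathfrak h^*,\ y,y'\in\mathfrak h).$$ -/

import Mathlib

open scoped Polynomial

noncomputable section

namespace DrinfeldOrbifold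

/-! ### Skew group algebras of the tensor and the symmetric algebra -/

section General

variable {G V : Type*} [Group G] [AddCommGroup V] [Module ℂ V] [DistribMulAction G V]
  [SMulCommClass G ℂ V]

/-- The algebra endomorphism of `T(V)` induced by the action of `g` on `V`. -/
def tensorMap (g : G) : TensorAlgebra ℂ V →ₐ[ℂ] TensorAlgebra ℂ V :=
  TensorAlgebra.lift ℂ (TensorAlgebra.ι ℂ ∘ₗ DistribSMul.toLinearMap ℂ V g)

/-- A linear action of `G` on `V`, extended to `T(V)` by algebra automorphisms. -/
instance tensorAction : MulSemiringAction G (TensorAlgebra ℂ V) where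
  smul g a := tensorMap g a
  one_smul a := by
    have h : tensorMap (1 : G)
        = AlgHom.id ℂ (TensorAlgebra ℂ V) := by
      ext v; simp [tensorMap]
    exact congrArg (fun f => f a) h
  mul_smul g h a := by
    have e : (tensorMap (g * h) : TensorAlgebra ℂ V →ₐ[ℂ] TensorAlgebra ℂ V)
        = (tensorMap g).comp
          (tensorMap h) := by
      ext v; simp [tensorMap, mul_smul]
    exact congrArg (fun f => f a) e
  smul_zero g := map_zero _
  smul_add g := map_add _
  smul_one g := map_one _
  smul_mul g := map_mul _

theorem tensorAction_def (g : G) (a : TensorAlgebra ℂ V) :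
    g • a = tensorMap g a := rfl

theorem tensorAction_ι (g : G) (v : V) :
    g • TensorAlgebra.ι ℂ v = TensorAlgebra.ι ℂ (g • v) := by
  simp [tensorAction_def, tensorMap]

theorem smul_mem_pow (g : G) (j : ℕ) (a : TensorAlgebra ℂ V)
    (ha : a ∈ LinearMap.range (TensorAlgebra.ι ℂ : V →ₗ[ℂ] TensorAlgebra ℂ V) ^ j) :
    g • a ∈ LinearMap.range (TensorAlgebra.ι ℂ : V →ₗ[ℂ] TensorAlgebra ℂ V) ^ j := by
  have h : (LinearMap.range (TensorAlgebra.ι ℂ : V →ₗ[ℂ] TensorAlgebra ℂ V)).map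
      (tensorMap g).toLinearMap
      ≤ LinearMap.range (TensorAlgebra.ι ℂ : V →ₗ[ℂ] TensorAlgebra ℂ V) := by
    rintro _ ⟨_, ⟨v, rfl⟩, rfl⟩
    exact ⟨g • v, by simp [tensorMap]⟩
  have h2 := pow_le_pow_left' h j
  rw [← Submodule.map_pow] at h2
  exact h2 ⟨a, ha, rfl⟩

instance tensorAction_comm : SMulCommClass G ℂ (TensorAlgebra ℂ V) where
  smul_comm g c a := map_smul (tensorMap g) c a

/-- The algebra endomorphism of `S(V)` induced by the action of `g` on `V`. -/
def symMap (g : G) : SymmetricAlgebra ℂ V →ₐ[ℂ] SymmetricAlgebra ℂ V :=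
  SymmetricAlgebra.lift (SymmetricAlgebra.ι ℂ V ∘ₗ DistribSMul.toLinearMap ℂ V g)

/-- A linear action of `G` on `V`, extended to `S(V)` by algebra automorphisms. -/
instance symAction : MulSemiringAction G (SymmetricAlgebra ℂ V) where
  smul g a := symMap g a
  one_smul a := by
    have h : symMap (1 : G) = AlgHom.id ℂ (SymmetricAlgebra ℂ V) := by
      apply SymmetricAlgebra.algHom_ext
      ext v; simp [symMap]
    exact congrArg (fun f => f a) h
  mul_smul g h a := by
    have e : (symMap (g * h) : SymmetricAlgebra ℂ V →ₐ[ℂ] SymmetricAlgebra ℂ V)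
        = (symMap g).comp (symMap h) := by
      apply SymmetricAlgebra.algHom_ext
      ext v; simp [symMap, mul_smul]
    exact congrArg (fun f => f a) e
  smul_zero g := map_zero _
  smul_add g := map_add _
  smul_one g := map_one _
  smul_mul g := map_mul _

theorem symAction_def (g : G) (a : SymmetricAlgebra ℂ V) : g • a = symMap g a := rfl

theorem symAction_ι (g : G) (v : V) :
    g • SymmetricAlgebra.ι ℂ V v = SymmetricAlgebra.ι ℂ V (g • v) := by
  simp [symAction_def, symMap]

instance symAction_comm : SMulCommClass G ℂ (SymmetricAlgebra ℂ V) where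
  smul_comm g c a := map_smul (symMap g) c a

variable (G V)

/-- The skew group algebra `T(V) # G`; `SkewMonoidAlgebra.single g a` is `a ⊗ g`, and
`(a ⊗ g) (b ⊗ h) = a (g • b) ⊗ g h`. -/
abbrev TensorSkew := SkewMonoidAlgebra (TensorAlgebra ℂ V) G

/-- The skew group algebra `S(V) # G`. -/
abbrev SymSkew := SkewMonoidAlgebra (SymmetricAlgebra ℂ V) G

/-- The component of `S(V) # G` of polynomial degree `i`. -/
def symDegree (i : ℕ) : Submodule ℂ (SymSkew G V) :=
  Submodule.span ℂ {z | ∃ g : G, ∃ a ∈ LinearMap.range (SymmetricAlgebra.ι ℂ V) ^ i,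
    z = SkewMonoidAlgebra.single g a}

variable {G V} in
/-- A vector, as an element of `T(V) # G`. -/
def vec (v : V) : TensorSkew G V := SkewMonoidAlgebra.single 1 (TensorAlgebra.ι ℂ v)

/-! ### Parameter maps and the algebras they define -/

/-- A parameter map `κ = κ^L + κ^C`: a linear 2-cochain `∑ κ^L_g g` with alternating components
`κ^L_g : V × V → V`, and a constant 2-cochain `∑ κ^C_g g` with alternating components
`κ^C_g : V × V → ℂ`. -/
@[ext]
structure ParameterMap where
  lin : G → V [⋀^Fin 2]→ₗ[ℂ] V
  const : G → V [⋀^Fin 2]→ₗ[ℂ] ℂ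

variable {G V}
variable [Fintype G]

namespace ParameterMap

variable (κ : ParameterMap G V)

/-- `κ^L(v, w) = ∑ κ^L_g(v, w) ⊗ g`, as an element of `T(V) # G`. -/
def linValue (v w : V) : TensorSkew G V :=
  ∑ g, SkewMonoidAlgebra.single g (TensorAlgebra.ι ℂ (κ.lin g ![v, w]))

/-- `κ^C(v, w) = ∑ κ^C_g(v, w) g`, as an element of `T(V) # G`. -/
def constValue (v w : V) : TensorSkew G V :=
  ∑ g, SkewMonoidAlgebra.single g (algebraMap ℂ (TensorAlgebra ℂ V) (κ.const g ![v, w]))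

/-- The relations `v w - w v = κ^L(v, w) + κ^C(v, w)`. -/
inductive Rel : TensorSkew G V → TensorSkew G V → Prop
  | comm (v w : V) : Rel (vec v * vec w - vec w * vec v) (κ.linValue v w + κ.constValue v w)

/-- The algebra `H_κ = H_{κ,1}`. -/
def Alg := RingQuot κ.Rel

instance : Ring κ.Alg := inferInstanceAs (Ring (RingQuot _))

instance : Algebra ℂ κ.Alg := inferInstanceAs (Algebra ℂ (RingQuot _))

/-- The quotient map `T(V) # G → H_κ`. -/
def proj : TensorSkew G V →ₐ[ℂ] κ.Alg := RingQuot.mkAlgHom ℂ κ.Rel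

/-- The relations `v w - w v = κ^L(v, w) t + κ^C(v, w) t²` in `T(V) # G [t]`. -/
inductive PolyRel : (TensorSkew G V)[X] → (TensorSkew G V)[X] → Prop
  | comm (v w : V) : PolyRel
      (Polynomial.C (vec v) * Polynomial.C (vec w) - Polynomial.C (vec w) * Polynomial.C (vec v))
      (Polynomial.C (κ.linValue v w) * Polynomial.X
        + Polynomial.C (κ.constValue v w) * Polynomial.X ^ 2)

/-- The algebra `H_{κ,t}` over `ℂ[t]`. -/
def PolyAlg := RingQuot κ.PolyRel

instance : Ring κ.PolyAlg := RingQuot.instRing κ.PolyRel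

instance : Algebra ℂ κ.PolyAlg := RingQuot.instAlgebra κ.PolyRel

/-- The quotient map `T(V) # G [t] → H_{κ,t}`. -/
def polyProj : (TensorSkew G V)[X] →ₐ[ℂ] κ.PolyAlg := RingQuot.mkAlgHom ℂ κ.PolyRel

/-- The central element `t` of `H_{κ,t}`. -/
def t : κ.PolyAlg := κ.polyProj Polynomial.X

/-! ### The filtration of `H_κ` and its associated graded algebra -/

/-- The filtration of `H_κ` in which vectors have degree one and group elements degree zero. -/
def filtration (i : ℕ) : Submodule ℂ κ.Alg :=
  Submodule.span ℂ {z | ∃ g : G, ∃ j ≤ i,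
    ∃ a ∈ LinearMap.range (TensorAlgebra.ι ℂ : V →ₗ[ℂ] TensorAlgebra ℂ V) ^ j,
      z = κ.proj (SkewMonoidAlgebra.single g a)}

/-- The part of degree less than `i`, inside the part of degree at most `i`. -/
def lower (i : ℕ) : Submodule ℂ (κ.filtration i) :=
  (⨆ j < i, κ.filtration j).comap (κ.filtration i).subtype

/-- The component of degree `i` of the associated graded algebra of `H_κ`. -/
abbrev Gr (i : ℕ) := κ.filtration i ⧸ κ.lower i

theorem filtration_mul {i j : ℕ} {x y : κ.Alg} (hx : x ∈ κ.filtration i)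
    (hy : y ∈ κ.filtration j) : x * y ∈ κ.filtration (i + j) := by
  have h : κ.filtration i * κ.filtration j ≤ κ.filtration (i + j) := by
    rw [filtration, filtration, Submodule.span_mul_span, Submodule.span_le]
    rintro _ ⟨_, ⟨g, p, hp, a, ha, rfl⟩, _, ⟨h, q, hq, b, hb, rfl⟩, rfl⟩
    refine Submodule.subset_span ⟨g * h, p + q, by omega, a * g • b, ?_, ?_⟩
    · rw [pow_add]
      exact Submodule.mul_mem_mul ha (smul_mem_pow g q b hb)
    · change κ.proj _ * κ.proj _ = _
      rw [← map_mul, SkewMonoidAlgebra.single_mul_single]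
  exact h (Submodule.mul_mem_mul hx hy)

/-- `H_κ` is a Drinfeld orbifold algebra (the PBW condition): its associated graded algebra, with
components `Gr i` and product `[x] [y] = [x y]`, is isomorphic to the graded algebra `S(V) # G`. -/
def IsDrinfeldOrbifold : Prop :=
  ∃ e : ∀ i, κ.Gr i ≃ₗ[ℂ] symDegree G V i,
    ∀ (i j : ℕ) (x : κ.filtration i) (y : κ.filtration j),
      (e (i + j) (Submodule.Quotient.mk ⟨x * y, κ.filtration_mul x.2 y.2⟩) : SymSkew G V)
        = e i (Submodule.Quotient.mk x) * e j (Submodule.Quotient.mk y)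

/-- `H_{κ,t}` is a deformation of `S(V) # G` over `ℂ[t]`: there is an isomorphism of
`ℂ[t]`-modules from `(S(V) # G)[t]` to `H_{κ,t}` that fixes vectors and group elements and through
which the product of `H_{κ,t}` reduces modulo `t` to the product of `S(V) # G`. -/
def IsDeformation : Prop :=
  ∃ e : (SymSkew G V)[X] ≃ₗ[ℂ] κ.PolyAlg,
    (∀ p, e (Polynomial.X * p) = κ.t * e p) ∧
    (∀ v : V, e (Polynomial.C (SkewMonoidAlgebra.single 1 (SymmetricAlgebra.ι ℂ V v)))
      = κ.polyProj (Polynomial.C (vec v))) ∧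
    (∀ g : G, e (Polynomial.C (SkewMonoidAlgebra.single g 1))
      = κ.polyProj (Polynomial.C (SkewMonoidAlgebra.single g 1))) ∧
    ∀ a b : SymSkew G V, ∃ h : κ.PolyAlg,
      e (Polynomial.C a) * e (Polynomial.C b) = e (Polynomial.C (a * b)) + κ.t * h

/-- `H_{κ,t}` is a Drinfeld orbifold algebra over `ℂ[t]`: `H_κ` satisfies the PBW condition, and
`H_{κ,t}` is a deformation of `S(V) # G` over `ℂ[t]`. -/
structure IsDrinfeldOrbifoldOverPoly : Prop where
  pbw : κ.IsDrinfeldOrbifold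
  deformation : κ.IsDeformation

end ParameterMap

end General

/-! ### The doubled standard representation of `S_n` -/

section Standard

open Equiv

/-- The standard representation `𝔥 = {w ∈ ℂⁿ | ∑ w_i = 0}`. -/
abbrev Std (n : ℕ) : Submodule ℂ (Fin n → ℂ) :=
  LinearMap.ker (∑ i : Fin n, LinearMap.proj (R := ℂ) (φ := fun _ : Fin n => ℂ) i)

/-- `S_n` permutes coordinates: `(σ w)_i = w_{σ⁻¹ i}`, so `σ y_i = y_{σ i}`. -/
def stdRep (n : ℕ) : Representation ℂ (Perm (Fin n)) (Std n) where
  toFun σ := (LinearMap.funLeft ℂ ℂ (σ⁻¹ : Perm (Fin n))).restrict (by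
    intro w hw
    simp only [LinearMap.mem_ker, LinearMap.sum_apply, LinearMap.proj_apply,
      LinearMap.funLeft_apply] at hw ⊢
    rw [← hw]
    exact Equiv.sum_comp (σ⁻¹ : Perm (Fin n)) w)
  map_one' := by ext w i; simp [LinearMap.restrict_apply]
  map_mul' σ τ := by
    ext w i
    simp [LinearMap.restrict_apply]

/-- The space `𝔥* ⊕ 𝔥`. -/
def DoubledStd (n : ℕ) : Type := Module.Dual ℂ (Std n) × Std n

variable {n : ℕ}

instance : AddCommGroup (DoubledStd n) :=
  inferInstanceAs (AddCommGroup (Module.Dual ℂ (Std n) × Std n))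

instance : Module ℂ (DoubledStd n) :=
  inferInstanceAs (Module ℂ (Module.Dual ℂ (Std n) × Std n))

/-- `S_n` acts on `𝔥* ⊕ 𝔥` by the dual of the standard representation and by the standard
representation. -/
instance : DistribMulAction (Perm (Fin n)) (DoubledStd n) where
  smul σ v := ((stdRep n).dual σ v.1, stdRep n σ v.2)
  one_smul v := Prod.ext (congrArg (fun f => f v.1) (map_one (stdRep n).dual))
    (congrArg (fun f => f v.2) (map_one (stdRep n)))
  mul_smul σ τ v := Prod.ext (congrArg (fun f => f v.1) (map_mul (stdRep n).dual σ τ))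
    (congrArg (fun f => f v.2) (map_mul (stdRep n) σ τ))
  smul_zero _ := Prod.ext (map_zero _) (map_zero _)
  smul_add _ _ _ := Prod.ext (map_add _ _ _) (map_add _ _ _)

instance : SMulCommClass (Perm (Fin n)) ℂ (DoubledStd n) where
  smul_comm σ c v := Prod.ext (map_smul ((stdRep n).dual σ) c v.1) (map_smul (stdRep n σ) c v.2)

/-- A covector in `𝔥*`, as an element of `𝔥* ⊕ 𝔥`. -/
def inDual (f : Module.Dual ℂ (Std n)) : DoubledStd n := (f, 0)

/-- A vector in `𝔥`, as an element of `𝔥* ⊕ 𝔥`. -/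
def inStd (w : Std n) : DoubledStd n := (0, w)

/-- The vector `y_i - (1/n) ∑ y_j` of `𝔥`. -/
def yStd (i : Fin n) : Std n :=
  ⟨Pi.single i 1 - (n : ℂ)⁻¹ • ∑ j, Pi.single j 1, by
    have hn : (n : ℂ) ≠ 0 := by
      have := i.pos
      exact_mod_cast this.ne'
    simp [LinearMap.mem_ker, LinearMap.sum_apply, Finset.sum_apply, Pi.single_apply, hn]⟩

/-- The covector `x_i - (1/n) ∑ x_j` of `𝔥*`, where `x_i` is the `i`-th coordinate. -/
def xStd (i : Fin n) : Module.Dual ℂ (Std n) :=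
  (LinearMap.proj i - (n : ℂ)⁻¹ • ∑ j, LinearMap.proj j : Module.Dual ℂ (Fin n → ℂ)).comp
    (Std n).subtype

/-- The spanning vector `x̄_i` of `𝔥* ⊆ 𝔥* ⊕ 𝔥`. -/
def xbar (i : Fin n) : DoubledStd n := inDual (xStd i)

/-- The spanning vector `ȳ_i` of `𝔥 ⊆ 𝔥* ⊕ 𝔥`. -/
def ybar (i : Fin n) : DoubledStd n := inStd (yStd i)

/-- The cycle `(i j k)`, for distinct `i`, `j`, `k`: it sends `i ↦ j ↦ k ↦ i`. -/
def cycle3 (i j k : Fin n) : Perm (Fin n) := swap i j * swap j k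

/-- The element `z g` of `ℂ S_n`, or `v ⊗ g` of `(𝔥* ⊕ 𝔥) ⊗ ℂ S_n`, as a function on `S_n`. -/
abbrev atElt {M : Type*} [Zero M] (g : Perm (Fin n)) (z : M) : Perm (Fin n) → M := Pi.single g z

/-- The element `∑_{k ≠ i, j} ((i j k) - (k j i))` of the group algebra, times the scalar `z`. -/
def triSum (z : ℂ) (i j : Fin n) : Perm (Fin n) → ℂ :=
  ∑ k ∈ Finset.univ.filter (fun k => k ≠ i ∧ k ≠ j),
    (atElt (cycle3 i j k) z - atElt (cycle3 k j i) z)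

/-- `κ` takes, on the spanning vectors `x̄_i`, `ȳ_i`, the values prescribed by the parameters
`a = a^⊥`, `b = b^⊥` and `c`. -/
structure HasValues (a b c : ℂ) (κ : ParameterMap (Perm (Fin n)) (DoubledStd n)) : Prop where
  lin_xx : ∀ i j, i ≠ j → (fun g => κ.lin g ![xbar i, xbar j]) = 0
  lin_yy : ∀ i j, i ≠ j → (fun g => κ.lin g ![ybar i, ybar j]) = 0
  lin_xy_same : ∀ i, (fun g => κ.lin g ![xbar i, ybar i]) =
    ∑ k ∈ Finset.univ.filter (fun k => k ≠ i),
      atElt (swap i k) (-((n : ℂ) / 2) • (a • (xbar i + xbar k) + b • (ybar i + ybar k)))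
  lin_xy : ∀ i j, i ≠ j → (fun g => κ.lin g ![xbar i, ybar j]) =
    atElt (swap i j) (((n : ℂ) / 2) • (a • (xbar i + xbar j) + b • (ybar i + ybar j)))
  const_xx : ∀ i j, i ≠ j → (fun g => κ.const g ![xbar i, xbar j]) =
    triSum ((n : ℂ) ^ 2 / 4 * b ^ 2) i j
  const_yy : ∀ i j, i ≠ j → (fun g => κ.const g ![ybar i, ybar j]) =
    triSum ((n : ℂ) ^ 2 / 4 * a ^ 2) i j
  const_xy_same : ∀ i, (fun g => κ.const g ![xbar i, ybar i]) =
    ∑ k ∈ Finset.univ.filter (fun k => k ≠ i), atElt (swap i k) c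
  const_xy : ∀ i j, i ≠ j → (fun g => κ.const g ![xbar i, ybar j]) =
    -atElt (swap i j) c - triSum ((n : ℂ) ^ 2 / 4 * (a * b)) i j

/-! ### The rational Cherednik algebra of `S_n` -/

/-- The defining relations of the rational Cherednik algebra `H_{t,c}`: for `x, x' ∈ 𝔥*` and
`y, y' ∈ 𝔥`, `[x, x'] = 0`, `[y, y'] = 0` and
`[y, x] = t ⟨x, y⟩ - c ∑_s ⟨α_s, y⟩ ⟨x, α_s^∨⟩ s`, where `s = (i j)` runs over the transpositions,
`α_s = x_i - x_j` and `α_s^∨ = y_i - y_j`. -/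
inductive CherednikRel (n : ℕ) (t c : ℂ) :
    TensorSkew (Perm (Fin n)) (DoubledStd n) → TensorSkew (Perm (Fin n)) (DoubledStd n) → Prop
  | xx (x x' : Module.Dual ℂ (Std n)) :
      CherednikRel n t c (vec (inDual x) * vec (inDual x') - vec (inDual x') * vec (inDual x)) 0
  | yy (y y' : Std n) :
      CherednikRel n t c (vec (inStd y) * vec (inStd y') - vec (inStd y') * vec (inStd y)) 0
  | yx (y : Std n) (x : Module.Dual ℂ (Std n)) :
      CherednikRel n t c (vec (inStd y) * vec (inDual x) - vec (inDual x) * vec (inStd y))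
        (algebraMap ℂ _ (t * x y) -
          ∑ p ∈ Finset.univ.filter (fun p : Fin n × Fin n => p.1 < p.2),
            (c * (xStd p.1 - xStd p.2) y * x (yStd p.1 - yStd p.2)) •
              SkewMonoidAlgebra.single (swap p.1 p.2) 1)

/-- The rational Cherednik algebra `H_{t,c}` of `S_n`. -/
def Cherednik (n : ℕ) (t c : ℂ) := RingQuot (CherednikRel n t c)

instance (n : ℕ) (t c : ℂ) : Ring (Cherednik n t c) := inferInstanceAs (Ring (RingQuot _))

instance (n : ℕ) (t c : ℂ) : Algebra ℂ (Cherednik n t c) := inferInstanceAs (Algebra ℂ (RingQuot _))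

/-- The quotient map `T(𝔥* ⊕ 𝔥) # S_n → H_{t,c}`. -/
def cherednikProj (n : ℕ) (t c : ℂ) :
    TensorSkew (Perm (Fin n)) (DoubledStd n) →ₐ[ℂ] Cherednik n t c :=
  RingQuot.mkAlgHom ℂ (CherednikRel n t c)

end Standard

end DrinfeldOrbifold

end

/-! Everything rests on comparing leading terms. Commutators have lower degree in `H_κ`, so each
component of `gr H_κ` is always a quotient of the component of `S(V) # G`. The PBW property says
that nothing more is killed: a homogeneous element of `T(V) # G` whose image in `H_κ` drops in
filtration degree already vanishes in `S(V) # G` (`LeadingInjective`).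

Sufficiency comes from representations. Write (a, b) = A (δ, -β) with (δ, β) ≠ 0. On functions of
those φ ∈ V* whose values χ_i at the vectors δ x̄_i - β ȳ_i are distinct, let v act as
multiplication by φ(v) plus the Dunkl operator ∑ η_i(v) f_ik (i k), where η_i = δ ζ_i + β ξ_i and
f_ik = (p (χ_i + χ_k) + q) / (χ_i - χ_k). The η_i kill the vectors δ x̄_j - β ȳ_j, which therefore
act by multiplication alone, and f_ij f_ik + f_ik f_jk - f_jk f_ij = p². So a commutator consists of
transpositions with coefficients affine in χ_i + χ_k and of three-cycles with constant coefficients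
(`dunkl_commutator_apply`); for p = -tnA/2 and q = t²c these are the relations of `H_{κ,t}`. At t =
0 only multiplications and permutations remain, which is faithful for `S(V) # S_n` because S_n
permutes the regular forms freely. For t ≠ 0, rescaling vectors by 1/t gives representations of
`H_κ`, and the limit t → 0 detects leading terms (`RepFamily.leadingInjective`). The whole family
shows that ordered words are independent over ℂ[t] (`polySection_injective`).

For necessity, PBW embeds V ⊗ ℂG ⊕ ℂG in `H_κ`, so equivariance and the Jacobi identity can be read
off degree by degree. If κ^L_g has values in V^g, the quadratic part says that the cyclic sum of
F(u, v)(g w - w) vanishes for every component F of κ^L_g. This forces F = 0 when g moves a space of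
dimension at least three, and leaves one form up to a factor when g is a transposition; equivariance
then leaves two parameters a, b. The same equation governs the difference of two constant parts over
the same linear part, so off the identity only c is free. At the identity, the degree-zero Jacobi
identity kills the remaining invariant form unless a = b = 0. -/

noncomputable section

namespace DrinfeldOrbifold

/-! ### Skew group algebras: grading, the map to `S(V) # G`, and a section by ordered words -/

section SkewTools

set_option linter.unusedSectionVars false

variable {G V : Type*} [Group G] [AddCommGroup V] [Module ℂ V] [DistribMulAction G V]
  [SMulCommClass G ℂ V]

/-- A linear map on coefficients, extended to skew monoid algebras. -/
def mapCoeff (G : Type*) {A B : Type*} [AddCommMonoid A] [AddCommMonoid B] [Module ℂ A]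
    [Module ℂ B] (f : A →ₗ[ℂ] B) : SkewMonoidAlgebra A G →ₗ[ℂ] SkewMonoidAlgebra B G :=
  (SkewMonoidAlgebra.coeffLinearEquiv (S := ℂ)).symm.toLinearMap ∘ₗ
    Finsupp.mapRange.linearMap f ∘ₗ
      (SkewMonoidAlgebra.coeffLinearEquiv (S := ℂ)).toLinearMap

theorem mapCoeff_coeff {A B : Type*} [AddCommMonoid A] [AddCommMonoid B] [Module ℂ A]
    [Module ℂ B] (f : A →ₗ[ℂ] B) (z : SkewMonoidAlgebra A G) (g : G) :
    (mapCoeff G f z).coeff g = f (z.coeff g) := rfl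

@[simp]
theorem mapCoeff_single {A B : Type*} [AddCommMonoid A] [AddCommMonoid B] [Module ℂ A]
    [Module ℂ B] (f : A →ₗ[ℂ] B) (g : G) (a : A) :
    mapCoeff G f (SkewMonoidAlgebra.single g a) = SkewMonoidAlgebra.single g (f a) := by
  apply SkewMonoidAlgebra.coeff_injective
  ext h
  rw [mapCoeff_coeff]
  by_cases e : g = h
  · subst e; simp
  · simp [e]

/-- The homomorphism on `T(V) # G` given by a linear map on `V` and a homomorphism on `G`. -/
def skewLift {A : Type*} [Ring A] [Algebra ℂ A] (f : V →ₗ[ℂ] A) (γ : G →* A)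
    (h : ∀ g v, f (g • v) * γ g = γ g * f v) : TensorSkew G V →ₐ[ℂ] A :=
  SkewMonoidAlgebra.liftNCAlgHom (TensorAlgebra.lift ℂ f) γ (by
    intro a g
    induction a using TensorAlgebra.induction with
    | algebraMap r =>
      rw [tensorAction_def, AlgHom.commutes, AlgHom.commutes, Algebra.commutes]
    | ι v => rw [tensorAction_ι, TensorAlgebra.lift_ι_apply, TensorAlgebra.lift_ι_apply, h]
    | mul a b ha hb => rw [smul_mul', map_mul, map_mul, mul_assoc, hb, ← mul_assoc, ha, mul_assoc]
    | add a b ha hb => rw [smul_add, map_add, map_add, add_mul, mul_add, ha, hb])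

theorem skewLift_single {A : Type*} [Ring A] [Algebra ℂ A] (f : V →ₗ[ℂ] A) (γ : G →* A)
    (h : ∀ g v, f (g • v) * γ g = γ g * f v) (g : G) (a : TensorAlgebra ℂ V) :
    skewLift f γ h (SkewMonoidAlgebra.single g a) = TensorAlgebra.lift ℂ f a * γ g :=
  SkewMonoidAlgebra.liftNC_single _ _ _ _

theorem skewLift_vec {A : Type*} [Ring A] [Algebra ℂ A] (f : V →ₗ[ℂ] A) (γ : G →* A)
    (h : ∀ g v, f (g • v) * γ g = γ g * f v) (v : V) :
    skewLift f γ h (vec v) = f v := by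
  rw [vec, skewLift_single]; simp

variable (G V) in
/-- The quotient map `T(V) # G → S(V) # G`. -/
def symProj : TensorSkew G V →ₗ[ℂ] SymSkew G V :=
  mapCoeff G (SymmetricAlgebra.algHom ℂ V).toLinearMap

theorem algHom_ι (v : V) : SymmetricAlgebra.algHom ℂ V (TensorAlgebra.ι ℂ v)
    = SymmetricAlgebra.ι ℂ V v := rfl

theorem symProj_single (g : G) (a : TensorAlgebra ℂ V) :
    symProj G V (SkewMonoidAlgebra.single g a)
      = SkewMonoidAlgebra.single g (SymmetricAlgebra.algHom ℂ V a) :=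
  mapCoeff_single _ _ _

theorem algHom_smul (g : G) (a : TensorAlgebra ℂ V) :
    SymmetricAlgebra.algHom ℂ V (g • a) = g • SymmetricAlgebra.algHom ℂ V a := by
  induction a using TensorAlgebra.induction with
  | algebraMap r => rw [tensorAction_def, symAction_def]; simp only [AlgHom.commutes]
  | ι v => rw [tensorAction_ι, algHom_ι, algHom_ι, symAction_ι]
  | mul a b ha hb => rw [smul_mul', map_mul, map_mul, ha, hb, smul_mul']
  | add a b ha hb => rw [smul_add, map_add, map_add, ha, hb, smul_add]

theorem symProj_mul (x y : TensorSkew G V) :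
    symProj G V (x * y) = symProj G V x * symProj G V y := by
  induction x using SkewMonoidAlgebra.induction_on with
  | zero => simp
  | add x x' hx hx' => rw [add_mul, map_add, map_add, hx, hx', add_mul]
  | single g a =>
    induction y using SkewMonoidAlgebra.induction_on with
    | zero => simp
    | add x x' hx hx' => rw [mul_add, map_add, map_add, hx, hx', mul_add]
    | single h b =>
      simp only [symProj_single, SkewMonoidAlgebra.single_mul_single, map_mul, algHom_smul]

variable (G V) in
/-- The component of `T(V) # G` of degree `i`. -/
def tensorDegree (i : ℕ) : Submodule ℂ (TensorSkew G V) :=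
  Submodule.span ℂ {z | ∃ g : G,
    ∃ a ∈ LinearMap.range (TensorAlgebra.ι ℂ : V →ₗ[ℂ] TensorAlgebra ℂ V) ^ i,
      z = SkewMonoidAlgebra.single g a}

theorem single_mem_tensorDegree {i : ℕ} (g : G) {a : TensorAlgebra ℂ V}
    (ha : a ∈ LinearMap.range (TensorAlgebra.ι ℂ : V →ₗ[ℂ] TensorAlgebra ℂ V) ^ i) :
    SkewMonoidAlgebra.single g a ∈ tensorDegree G V i :=
  Submodule.subset_span ⟨g, a, ha, rfl⟩

theorem single_algebraMap_mem_tensorDegree (g : G) (c : ℂ) :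
    SkewMonoidAlgebra.single g (algebraMap ℂ (TensorAlgebra ℂ V) c) ∈ tensorDegree G V 0 := by
  refine single_mem_tensorDegree g ?_
  rw [pow_zero]
  exact Submodule.algebraMap_mem c

theorem single_ι_mem_tensorDegree (g : G) (v : V) :
    SkewMonoidAlgebra.single g (TensorAlgebra.ι ℂ v) ∈ tensorDegree G V 1 := by
  refine single_mem_tensorDegree g ?_
  rw [pow_one]
  exact ⟨v, rfl⟩

theorem single_ι_mul_ι_mem_tensorDegree (g : G) (v w : V) :
    SkewMonoidAlgebra.single g (TensorAlgebra.ι ℂ v * TensorAlgebra.ι ℂ w)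
      ∈ tensorDegree G V 2 := by
  refine single_mem_tensorDegree g ?_
  rw [pow_two]
  exact Submodule.mul_mem_mul ⟨v, rfl⟩ ⟨w, rfl⟩

theorem tensorDegree_mul {i j : ℕ} {x y : TensorSkew G V} (hx : x ∈ tensorDegree G V i)
    (hy : y ∈ tensorDegree G V j) : x * y ∈ tensorDegree G V (i + j) := by
  have h : tensorDegree G V i * tensorDegree G V j ≤ tensorDegree G V (i + j) := by
    rw [tensorDegree, tensorDegree, Submodule.span_mul_span, Submodule.span_le]
    rintro _ ⟨_, ⟨g, a, ha, rfl⟩, _, ⟨h, b, hb, rfl⟩, rfl⟩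
    refine Submodule.subset_span ⟨g * h, a * g • b, ?_, ?_⟩
    · rw [pow_add]
      exact Submodule.mul_mem_mul ha (smul_mem_pow g _ b hb)
    · exact SkewMonoidAlgebra.single_mul_single
  exact h (Submodule.mul_mem_mul hx hy)

theorem map_symProj_tensorDegree (i : ℕ) :
    (tensorDegree G V i).map (symProj G V) = symDegree G V i := by
  have hp : LinearMap.range (SymmetricAlgebra.ι ℂ V) ^ i
      = (LinearMap.range (TensorAlgebra.ι ℂ : V →ₗ[ℂ] TensorAlgebra ℂ V) ^ i).map
        (SymmetricAlgebra.algHom ℂ V).toLinearMap := by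
    rw [Submodule.map_pow, ← LinearMap.range_comp]
    rfl
  rw [tensorDegree, symDegree, Submodule.map_span, hp]
  congr 1
  ext z
  constructor
  · rintro ⟨_, ⟨g, a, ha, rfl⟩, rfl⟩
    exact ⟨g, _, ⟨a, ha, rfl⟩, symProj_single g a⟩
  · rintro ⟨g, _, ⟨a, ha, rfl⟩, rfl⟩
    exact ⟨_, ⟨g, a, ha, rfl⟩, symProj_single g a⟩

theorem iSup_tensorDegree [Finite G] : ⨆ i, tensorDegree G V i = ⊤ := by
  rw [eq_top_iff]
  rintro z -
  induction z using SkewMonoidAlgebra.induction_on with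
  | zero => exact zero_mem _
  | add x y hx hy => exact add_mem hx hy
  | single g a =>
    have key : ∀ a : TensorAlgebra ℂ V,
        a ∈ ⨆ i, LinearMap.range (TensorAlgebra.ι ℂ : V →ₗ[ℂ] TensorAlgebra ℂ V) ^ i := by
      intro a
      have h := DirectSum.Decomposition.isInternal
        (fun i : ℕ => LinearMap.range (TensorAlgebra.ι ℂ : V →ₗ[ℂ] TensorAlgebra ℂ V) ^ i)
      rw [h.submodule_iSup_eq_top]
      trivial
    have h2 : (⨆ i, LinearMap.range (TensorAlgebra.ι ℂ : V →ₗ[ℂ] TensorAlgebra ℂ V) ^ i)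
        ≤ (⨆ i, tensorDegree G V i).comap (SkewMonoidAlgebra.lsingle (R := ℂ) g) :=
      iSup_le fun i a ha => le_iSup (tensorDegree G V) i (single_mem_tensorDegree g ha)
    exact h2 (key a)

/-! ### Words in a basis -/

variable {I : Type*} (b : Module.Basis I ℂ V)

/-- The product in `T(V)` of a list of vectors. -/
def word (l : List V) : TensorAlgebra ℂ V := (l.map (TensorAlgebra.ι ℂ)).prod

@[simp] theorem word_nil : word ([] : List V) = 1 := rfl

@[simp] theorem word_cons (v : V) (l : List V) :
    word (v :: l) = TensorAlgebra.ι ℂ v * word l := by simp [word]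

theorem word_mem_pow (l : List V) :
    word l ∈ LinearMap.range (TensorAlgebra.ι ℂ : V →ₗ[ℂ] TensorAlgebra ℂ V) ^ l.length := by
  induction l with
  | nil => simp [Submodule.one_le.1 le_rfl]
  | cons v l ih =>
    rw [word_cons, List.length_cons, pow_succ']
    exact Submodule.mul_mem_mul ⟨v, rfl⟩ ih

theorem tensor_pow_le_span_words (i : ℕ) :
    LinearMap.range (TensorAlgebra.ι ℂ : V →ₗ[ℂ] TensorAlgebra ℂ V) ^ i
      ≤ Submodule.span ℂ {a | ∃ l : List I, l.length = i ∧ a = word (l.map b)} := by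
  have hr : LinearMap.range (TensorAlgebra.ι ℂ : V →ₗ[ℂ] TensorAlgebra ℂ V)
      = Submodule.span ℂ (Set.range (TensorAlgebra.ι ℂ ∘ b)) := by
    rw [Set.range_comp, ← Submodule.map_span, b.span_eq, Submodule.map_top]
  induction i with
  | zero =>
    rw [pow_zero, Submodule.one_eq_span]
    refine Submodule.span_mono ?_
    rintro _ rfl
    exact ⟨[], rfl, rfl⟩
  | succ i ih =>
    rw [pow_succ']
    refine (mul_le_mul' hr.le ih).trans ?_
    rw [Submodule.span_mul_span]
    refine Submodule.span_mono ?_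
    rintro _ ⟨_, ⟨k, rfl⟩, _, ⟨l, hl, rfl⟩, rfl⟩
    exact ⟨k :: l, by simp [hl], by simp⟩

theorem tensorDegree_le_span_words (i : ℕ) :
    tensorDegree G V i ≤ Submodule.span ℂ {z | ∃ g : G, ∃ l : List I, l.length = i ∧
      z = SkewMonoidAlgebra.single g (word (l.map b))} := by
  rw [tensorDegree, Submodule.span_le]
  rintro _ ⟨g, a, ha, rfl⟩
  have h : Submodule.span ℂ {a | ∃ l : List I, l.length = i ∧ a = word (l.map b)}
      ≤ (Submodule.span ℂ {z | ∃ g : G, ∃ l : List I, l.length = i ∧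
        z = SkewMonoidAlgebra.single g (word (l.map b))}).comap
          (SkewMonoidAlgebra.lsingle (R := ℂ) g) := by
    rw [Submodule.span_le]
    rintro _ ⟨l, hl, rfl⟩
    exact Submodule.subset_span ⟨g, l, hl, rfl⟩
  exact h (tensor_pow_le_span_words b i ha)

/-- A linear section of `T(V) → S(V)`: it maps a monomial in the basis vectors to the product of
these vectors in some order. -/
def symSection : SymmetricAlgebra ℂ V →ₗ[ℂ] TensorAlgebra ℂ V :=
  b.symmetricAlgebra.constr ℂ fun m => word ((Finsupp.toMultiset m).toList.map b)

/-- In the polynomial ring on the basis both sides are the monomial that counts the letters. -/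
theorem algHom_word (l : List I) : SymmetricAlgebra.algHom ℂ V (word (l.map b))
    = b.symmetricAlgebra (l.map fun i => Finsupp.single i 1).sum := by
  apply (SymmetricAlgebra.equivMvPolynomial b).injective
  have h : SymmetricAlgebra.equivMvPolynomial b
      (b.symmetricAlgebra (l.map fun i => Finsupp.single i 1).sum)
      = MvPolynomial.monomial (l.map fun i => Finsupp.single i 1).sum 1 := by
    simp [Module.Basis.symmetricAlgebra]
  rw [h]
  induction l with
  | nil => simp
  | cons i l ih =>
    simp only [List.map_cons, word_cons, map_mul, algHom_ι, List.sum_cons]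
    rw [SymmetricAlgebra.equivMvPolynomial_ι_apply, ih (by simp [Module.Basis.symmetricAlgebra]),
      MvPolynomial.X, MvPolynomial.monomial_mul, one_mul]

theorem toMultiset_sum_single (l : List I) :
    Finsupp.toMultiset (l.map fun i => Finsupp.single i 1).sum = (l : Multiset I) := by
  induction l with
  | nil => simp
  | cons i l ih => simp [ih, Finsupp.toMultiset_single]

/-- The section sees only the multiset of letters, so it can do no more than reorder them. This
reduces the comparison of a word with its ordered form to permutations. -/
theorem exists_symSection_word (l : List I) : ∃ l' : List I, l'.Perm l ∧
    symSection b (SymmetricAlgebra.algHom ℂ V (word (l.map b))) = word (l'.map b) := by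
  refine ⟨(Finsupp.toMultiset (l.map fun i => Finsupp.single i 1).sum).toList, ?_, ?_⟩
  · rw [← Multiset.coe_eq_coe, Multiset.coe_toList, toMultiset_sum_single]
  · rw [algHom_word, symSection, Module.Basis.constr_basis]

theorem algHom_symSection (a : SymmetricAlgebra ℂ V) :
    SymmetricAlgebra.algHom ℂ V (symSection b a) = a := by
  have h : (SymmetricAlgebra.algHom ℂ V).toLinearMap ∘ₗ symSection b = LinearMap.id := by
    apply b.symmetricAlgebra.ext
    intro m
    rw [LinearMap.comp_apply, symSection, Module.Basis.constr_basis, AlgHom.toLinearMap_apply,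
      algHom_word, LinearMap.id_apply]
    congr 1
    classical
    apply Multiset.toFinsupp.symm.injective
    change Finsupp.toMultiset _ = Finsupp.toMultiset _
    rw [toMultiset_sum_single, Multiset.coe_toList]
  exact congrArg (fun f => f a) h

theorem symSection_ι (v : V) : symSection b (SymmetricAlgebra.ι ℂ V v) = TensorAlgebra.ι ℂ v := by
  have h : symSection b ∘ₗ SymmetricAlgebra.ι ℂ V = TensorAlgebra.ι ℂ := by
    apply b.ext
    intro i
    obtain ⟨l', hp, he⟩ := exists_symSection_word b [i]
    rw [List.perm_singleton.1 hp, List.map_singleton, word_cons, word_nil, mul_one,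
      algHom_ι] at he
    exact he
  exact congrArg (fun f => f v) h

theorem symSection_one : symSection b 1 = 1 := by
  obtain ⟨l', hp, he⟩ := exists_symSection_word b []
  rw [List.perm_nil.1 hp] at he
  simpa using he

end SkewTools

/-! ### Reordering words modulo lower degree -/

section Reordering

set_option linter.unusedSectionVars false

variable {G V : Type*} [Group G] [AddCommGroup V] [Module ℂ V] [DistribMulAction G V]
  [SMulCommClass G ℂ V] [Fintype G]

theorem linValue_mem_tensorDegree (κ : ParameterMap G V) (v w : V) :
    κ.linValue v w ∈ tensorDegree G V 1 :=
  sum_mem fun _ _ => single_ι_mem_tensorDegree _ _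

theorem constValue_mem_tensorDegree (κ : ParameterMap G V) (v w : V) :
    κ.constValue v w ∈ tensorDegree G V 0 :=
  sum_mem fun _ _ => single_algebraMap_mem_tensorDegree _ _

variable {A : Type*} [Ring A] [Algebra ℂ A] (Q : TensorSkew G V →ₐ[ℂ] A) (τ : A)

/-- The span of the elements `Q z τ ^ k` with `z` of degree less than `i`. -/
def lowSpan (i : ℕ) : Submodule ℂ A :=
  Submodule.span ℂ {x | ∃ j < i, ∃ k : ℕ, ∃ z ∈ tensorDegree G V j, x = Q z * τ ^ k}

variable {Q τ}

theorem mem_lowSpan {i j : ℕ} (h : j < i) (k : ℕ) {z : TensorSkew G V}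
    (hz : z ∈ tensorDegree G V j) : Q z * τ ^ k ∈ lowSpan Q τ i :=
  Submodule.subset_span ⟨j, h, k, z, hz, rfl⟩

theorem mul_mem_lowSpan {i j : ℕ} {z : TensorSkew G V} (hz : z ∈ tensorDegree G V j) {x : A}
    (hx : x ∈ lowSpan Q τ i) : Q z * x ∈ lowSpan Q τ (j + i) := by
  have h : lowSpan Q τ i ≤ (lowSpan Q τ (j + i)).comap (LinearMap.mulLeft ℂ (Q z)) := by
    rw [lowSpan, Submodule.span_le]
    rintro _ ⟨l, hl, k, y, hy, rfl⟩
    rw [SetLike.mem_coe, Submodule.mem_comap, LinearMap.mulLeft_apply, ← mul_assoc, ← map_mul]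
    exact mem_lowSpan (by omega) k (tensorDegree_mul hz hy)
  exact h hx

theorem single_one_word_cons (v : V) (l : List V) :
    (SkewMonoidAlgebra.single 1 (word (v :: l)) : TensorSkew G V)
      = vec v * SkewMonoidAlgebra.single 1 (word l) := by
  rw [vec, SkewMonoidAlgebra.single_mul_single, one_smul, one_mul, word_cons]

theorem vec_mem_tensorDegree (v : V) : (vec v : TensorSkew G V) ∈ tensorDegree G V 1 :=
  single_ι_mem_tensorDegree _ _

variable (κ : ParameterMap G V) (hτ : ∀ a, a * τ = τ * a)
  (hQ : ∀ v w, Q (vec v * vec w - vec w * vec v)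
    = Q (κ.linValue v w) * τ + Q (κ.constValue v w) * τ ^ 2)

-- Exchanging two neighbouring letters costs one commutator, which is divisible by τ and shortens
-- the word. Keeping `A` and τ abstract serves two cases at once: `H_κ` with τ = 1, and `H_{κ,t}`
-- with τ = t.
include hτ hQ in
theorem word_perm_sub_mem {l l' : List V} (h : l.Perm l') :
    ∃ y ∈ lowSpan Q τ l.length, Q (SkewMonoidAlgebra.single 1 (word l))
      - Q (SkewMonoidAlgebra.single 1 (word l')) = y * τ := by
  induction h with
  | nil => exact ⟨0, zero_mem _, by simp⟩
  | @cons v l l' _ ih =>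
    obtain ⟨y, hy, e⟩ := ih
    refine ⟨Q (vec v) * y, ?_, ?_⟩
    · rw [List.length_cons, add_comm]
      exact mul_mem_lowSpan (vec_mem_tensorDegree v) hy
    · rw [single_one_word_cons, single_one_word_cons, map_mul, map_mul, ← mul_sub, e, mul_assoc]
  | @trans l₁ l₂ l₃ h₁ _ ih₁ ih₂ =>
    obtain ⟨y, hy, e⟩ := ih₁
    obtain ⟨y', hy', e'⟩ := ih₂
    refine ⟨y + y', add_mem hy (h₁.length_eq ▸ hy'), ?_⟩
    rw [add_mul, ← e, ← e', sub_add_sub_cancel]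
  | swap v w l =>
    have hl : (SkewMonoidAlgebra.single 1 (word l) : TensorSkew G V)
        ∈ tensorDegree G V l.length := single_mem_tensorDegree _ (word_mem_pow l)
    -- One factor τ of the commutator τ κ^L + τ² κ^C has been split off, hence the exponents 0 and
    -- 1.
    refine ⟨Q (κ.linValue w v * SkewMonoidAlgebra.single 1 (word l)) * τ ^ 0
      + Q (κ.constValue w v * SkewMonoidAlgebra.single 1 (word l)) * τ ^ 1,
      add_mem (mem_lowSpan ?_ _ (tensorDegree_mul (linValue_mem_tensorDegree κ w v) hl))
        (mem_lowSpan ?_ _ (tensorDegree_mul (constValue_mem_tensorDegree κ w v) hl)), ?_⟩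
    · simp only [List.length_cons]; omega
    · simp only [List.length_cons]; omega
    · have hl2 : ∀ a c : A, a * (τ * c) = τ * (a * c) := fun a c => by
        rw [← mul_assoc, hτ, mul_assoc]
      simp only [single_one_word_cons, ← mul_assoc]
      rw [← map_sub, ← sub_mul, map_mul, hQ, map_mul, map_mul, add_mul, pow_zero, pow_one,
        pow_two, mul_one, add_mul]
      simp only [mul_assoc, hτ, hl2]

variable {I : Type*} (b : Module.Basis I ℂ V)

-- By linearity it suffices to treat a word times a group element; the group element is a right
-- factor of degree zero, and the word differs from its ordered form by a permutation.
include hτ hQ in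
theorem sub_symSection_mem {i : ℕ} {z : TensorSkew G V} (hz : z ∈ tensorDegree G V i) :
    ∃ y ∈ lowSpan Q τ i, Q z - Q (mapCoeff G (symSection b) (symProj G V z)) = y * τ := by
  let D : TensorSkew G V →ₗ[ℂ] A := Q.toLinearMap
    - Q.toLinearMap ∘ₗ mapCoeff G (symSection b) ∘ₗ symProj G V
  have h : tensorDegree G V i
      ≤ ((lowSpan Q τ i).map (LinearMap.mulRight ℂ τ)).comap D := by
    refine (tensorDegree_le_span_words b i).trans ?_
    rw [Submodule.span_le]
    rintro _ ⟨g, l, rfl, rfl⟩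
    obtain ⟨l', hp, he⟩ := exists_symSection_word b l
    obtain ⟨y, hy, e⟩ := word_perm_sub_mem κ hτ hQ (hp.symm.map b)
    have hg : ∀ a : TensorAlgebra ℂ V, (SkewMonoidAlgebra.single g a : TensorSkew G V)
        = SkewMonoidAlgebra.single 1 a * SkewMonoidAlgebra.single g 1 := by
      intro a
      rw [SkewMonoidAlgebra.single_mul_single, one_smul, one_mul, mul_one]
    refine ⟨y * Q (SkewMonoidAlgebra.single g 1), ?_, ?_⟩
    · rw [List.length_map] at hy
      have h2 : lowSpan Q τ l.length ≤ (lowSpan Q τ l.length).comap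
          (LinearMap.mulRight ℂ (Q (SkewMonoidAlgebra.single g 1))) := by
        conv_lhs => rw [lowSpan]
        rw [Submodule.span_le]
        rintro _ ⟨j, hj, k, z, hz, rfl⟩
        have hk : ∀ a, τ ^ k * a = a * τ ^ k := fun a =>
          ((show Commute a τ from hτ a).pow_right k).symm.eq
        rw [SetLike.mem_coe, Submodule.mem_comap, LinearMap.mulRight_apply, mul_assoc, hk, ← mul_assoc, ← map_mul]
        refine mem_lowSpan hj k ?_
        have := tensorDegree_mul hz (single_algebraMap_mem_tensorDegree (V := V) g 1)
        rwa [map_one] at this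
      exact h2 hy
    · change _ * τ = Q _ - Q (mapCoeff G (symSection b) (symProj G V _))
      rw [symProj_single, mapCoeff_single, he, hg (word (l.map b)), hg (word (l'.map b)), map_mul, map_mul,
        ← sub_mul, e, mul_assoc, mul_assoc, hτ]
  obtain ⟨y, hy, e⟩ := h hz
  exact ⟨y, hy, e.symm⟩

end Reordering

/-! ### The PBW property as injectivity on leading terms -/

section Criterion

set_option linter.unusedSectionVars false

variable {G V : Type*} [Group G] [AddCommGroup V] [Module ℂ V] [DistribMulAction G V]
  [SMulCommClass G ℂ V]

/-- The endomorphism of `T(V) # G` that fixes group elements and scales vectors by `c`. -/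
def tensorScale (c : ℂ) : TensorSkew G V →ₐ[ℂ] TensorSkew G V :=
  skewLift (c • (SkewMonoidAlgebra.lsingle (R := ℂ) (1 : G) ∘ₗ TensorAlgebra.ι ℂ))
    (SkewMonoidAlgebra.of (TensorAlgebra ℂ V) G) (by
      intro g v
      simp [SkewMonoidAlgebra.single_mul_single, tensorAction_ι, SkewMonoidAlgebra.lsingle])

theorem tensorScale_of_mem (c : ℂ) {i : ℕ} {z : TensorSkew G V} (hz : z ∈ tensorDegree G V i) :
    tensorScale c z = c ^ i • z := by
  have hword : ∀ l : List V, TensorAlgebra.lift ℂ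
      (c • (SkewMonoidAlgebra.lsingle (R := ℂ) (1 : G) ∘ₗ TensorAlgebra.ι ℂ)) (word l)
      = c ^ l.length • (SkewMonoidAlgebra.single 1 (word l) : TensorSkew G V) := by
    intro l
    induction l with
    | nil => rw [word_nil, map_one, List.length_nil, pow_zero, one_smul]; rfl
    | cons v l ih =>
      rw [word_cons, map_mul, ih, TensorAlgebra.lift_ι_apply, List.length_cons, pow_succ']
      rw [LinearMap.smul_apply, LinearMap.comp_apply, SkewMonoidAlgebra.lsingle_apply,
        smul_mul_assoc, mul_smul_comm, SkewMonoidAlgebra.single_mul_single, one_smul, one_mul,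
        mul_smul]
  have h : tensorDegree G V i ≤ LinearMap.eqLocus (tensorScale c).toLinearMap
      (c ^ i • LinearMap.id) := by
    obtain ⟨⟨I, b⟩⟩ := Module.Free.exists_basis (R := ℂ) (M := V)
    refine (tensorDegree_le_span_words b i).trans ?_
    rw [Submodule.span_le]
    rintro _ ⟨g, l, rfl, rfl⟩
    change tensorScale c (SkewMonoidAlgebra.single g (word (l.map b)))
      = c ^ l.length • SkewMonoidAlgebra.single g (word (l.map b))
    rw [tensorScale, skewLift_single, hword, List.length_map, smul_mul_assoc,
      SkewMonoidAlgebra.of_apply, SkewMonoidAlgebra.single_mul_single, one_mul, one_smul, mul_one]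
  exact h hz

variable [Fintype G] (κ : ParameterMap G V)

theorem proj_comm (v w : V) : κ.proj (vec v * vec w - vec w * vec v)
    = κ.proj (κ.linValue v w) + κ.proj (κ.constValue v w) := by
  rw [← map_add]
  exact RingQuot.mkAlgHom_rel ℂ (ParameterMap.Rel.comm v w)

theorem proj_mem_filtration {i j : ℕ} (h : j ≤ i) {z : TensorSkew G V}
    (hz : z ∈ tensorDegree G V j) : κ.proj z ∈ κ.filtration i := by
  have : tensorDegree G V j ≤ (κ.filtration i).comap κ.proj.toLinearMap := by
    rw [tensorDegree, Submodule.span_le]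
    rintro _ ⟨g, a, ha, rfl⟩
    exact Submodule.subset_span ⟨g, j, h, a, ha, rfl⟩
  exact this hz

/-- The part of `H_κ` of filtration degree less than `i`. -/
def lowerPart (i : ℕ) : Submodule ℂ κ.Alg := ⨆ j < i, κ.filtration j

variable {κ}

theorem proj_mem_lowerPart {i j : ℕ} (h : j < i) {z : TensorSkew G V}
    (hz : z ∈ tensorDegree G V j) : κ.proj z ∈ lowerPart κ i :=
  (le_iSup₂ (f := fun j (_ : j < i) => κ.filtration j) j h) (proj_mem_filtration κ le_rfl hz)

theorem lowerPart_le_iff {i : ℕ} {N : Submodule ℂ κ.Alg} :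
    lowerPart κ i ≤ N ↔ ∀ j < i, ∀ z ∈ tensorDegree G V j, κ.proj z ∈ N := by
  refine ⟨fun h j hj z hz => h (proj_mem_lowerPart hj hz), fun h => iSup₂_le fun j hj => ?_⟩
  rw [ParameterMap.filtration, Submodule.span_le]
  rintro _ ⟨g, k, hk, a, ha, rfl⟩
  exact h k (hk.trans_lt hj) _ (single_mem_tensorDegree g ha)

theorem exists_proj_sub_mem {i : ℕ} {x : κ.Alg} (hx : x ∈ κ.filtration i) :
    ∃ z ∈ tensorDegree G V i, x - κ.proj z ∈ lowerPart κ i := by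
  have h : κ.filtration i ≤ (tensorDegree G V i).map κ.proj.toLinearMap ⊔ lowerPart κ i := by
    rw [ParameterMap.filtration, Submodule.span_le]
    rintro _ ⟨g, j, hj, a, ha, rfl⟩
    rcases hj.lt_or_eq with h | rfl
    · exact Submodule.mem_sup_right (proj_mem_lowerPart h (single_mem_tensorDegree g ha))
    · exact Submodule.mem_sup_left ⟨_, single_mem_tensorDegree g ha, rfl⟩
  obtain ⟨_, ⟨z, hz, rfl⟩, y, hy, rfl⟩ := Submodule.mem_sup.1 (h hx)
  exact ⟨z, hz, by simpa using hy⟩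

/-- The unconditional half of PBW: with τ = 1, reordering changes an element only in lower degree,
and the ordered form of an element that dies in `S(V) # G` is zero. -/
theorem proj_mem_lowerPart_of_symProj_eq_zero {i : ℕ} {z : TensorSkew G V}
    (hz : z ∈ tensorDegree G V i) (h : symProj G V z = 0) : κ.proj z ∈ lowerPart κ i := by
  obtain ⟨y, hy, e⟩ := sub_symSection_mem (Q := κ.proj) (τ := 1) κ (by simp)
    (fun v w => by rw [proj_comm]; simp) (Module.Basis.ofVectorSpace ℂ V) hz
  rw [h, map_zero, map_zero, sub_zero, mul_one] at e
  rw [e]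
  have : lowSpan κ.proj 1 i ≤ lowerPart κ i := by
    rw [lowSpan, Submodule.span_le]
    rintro _ ⟨j, hj, k, z, hz, rfl⟩
    rw [one_pow, mul_one]
    exact proj_mem_lowerPart hj hz
  exact this hy

variable (κ) in
/-- An element of degree `i` that falls into lower filtration degree in `H_κ` vanishes in
`S(V) # G`. -/
def LeadingInjective : Prop :=
  ∀ i, ∀ z ∈ tensorDegree G V i, κ.proj z ∈ lowerPart κ i → symProj G V z = 0

variable (κ) in
/-- The map from the component of degree `i` of `T(V) # G` to the associated graded of `H_κ`. -/
def toGr (i : ℕ) : tensorDegree G V i →ₗ[ℂ] κ.Gr i :=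
  (κ.lower i).mkQ ∘ₗ (κ.proj.toLinearMap.restrict
    (p := tensorDegree G V i) (q := κ.filtration i) fun _ hz => proj_mem_filtration κ le_rfl hz)

theorem toGr_surjective (i : ℕ) : Function.Surjective (toGr κ i) := by
  intro q
  obtain ⟨⟨x, hx⟩, rfl⟩ := Submodule.mkQ_surjective _ q
  obtain ⟨z, hz, h⟩ := exists_proj_sub_mem hx
  refine ⟨⟨z, hz⟩, ?_⟩
  refine ((Submodule.Quotient.eq (κ.lower i)).2 ?_).symm
  exact h

theorem mem_ker_toGr {i : ℕ} (z : tensorDegree G V i) :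
    z ∈ LinearMap.ker (toGr κ i) ↔ κ.proj z ∈ lowerPart κ i := by
  rw [LinearMap.mem_ker]
  exact Submodule.Quotient.mk_eq_zero (κ.lower i)

variable (G V) in
/-- The map from the component of degree `i` of `T(V) # G` to that of `S(V) # G`. -/
def toSymDegree (i : ℕ) : tensorDegree G V i →ₗ[ℂ] symDegree G V i :=
  (symProj G V).restrict fun _ hz => map_symProj_tensorDegree (G := G) (V := V) i ▸ ⟨_, hz, rfl⟩

theorem toSymDegree_surjective (i : ℕ) : Function.Surjective (toSymDegree G V i) := by
  rintro ⟨x, hx⟩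
  rw [← map_symProj_tensorDegree] at hx
  obtain ⟨z, hz, rfl⟩ := hx
  exact ⟨⟨z, hz⟩, rfl⟩

theorem mem_ker_toSymDegree {i : ℕ} (z : tensorDegree G V i) :
    z ∈ LinearMap.ker (toSymDegree G V i) ↔ symProj G V z = 0 := by
  rw [LinearMap.mem_ker, ← Submodule.coe_eq_zero]
  rfl

theorem toSymDegree_eq_iff {i : ℕ} (z w : tensorDegree G V i) :
    toSymDegree G V i z = toSymDegree G V i w ↔ symProj G V (z - w : tensorDegree G V i) = 0 := by
  rw [Submodule.coe_sub, map_sub, sub_eq_zero]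
  exact Subtype.ext_iff

theorem LeadingInjective.ker_eq (h : LeadingInjective κ) (i : ℕ) :
    LinearMap.ker (toGr κ i) = LinearMap.ker (toSymDegree G V i) := by
  ext z
  rw [mem_ker_toGr, mem_ker_toSymDegree]
  exact ⟨h i z z.2, proj_mem_lowerPart_of_symProj_eq_zero z.2⟩

theorem exists_linearEquiv_of_surjective {M A B : Type*} [AddCommMonoid M] [AddCommMonoid A]
    [AddCommMonoid B] [Module ℂ M] [Module ℂ A] [Module ℂ B] (f : M →ₗ[ℂ] A) (g : M →ₗ[ℂ] B)
    (hf : Function.Surjective f) (hg : Function.Surjective g)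
    (h : ∀ z w, f z = f w ↔ g z = g w) : ∃ e : A ≃ₗ[ℂ] B, ∀ z, e (f z) = g z := by
  have hs : ∀ z, g (Function.surjInv hf (f z)) = g z := fun z =>
    (h _ _).1 (Function.surjInv_eq hf _)
  let k : A →ₗ[ℂ] B :=
    { toFun := fun a => g (Function.surjInv hf a)
      map_add' := fun a b => by
        obtain ⟨z, rfl⟩ := hf a
        obtain ⟨w, rfl⟩ := hf b
        rw [← map_add, hs, hs, hs, map_add]
      map_smul' := fun c a => by
        obtain ⟨z, rfl⟩ := hf a
        rw [← map_smul, hs, hs, map_smul, RingHom.id_apply] }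
  refine ⟨LinearEquiv.ofBijective k ⟨fun a b hab => ?_, fun b => ?_⟩, hs⟩
  · obtain ⟨z, rfl⟩ := hf a
    obtain ⟨w, rfl⟩ := hf b
    exact (h _ _).2 ((hs z).symm.trans (hab.trans (hs w)))
  · obtain ⟨z, rfl⟩ := hg b
    exact ⟨f z, hs z⟩

/-- Both graded components are quotients of the same component of `T(V) # G`, with the same kernel.
Products agree because altering a factor by lower terms alters the product by lower terms. -/
theorem LeadingInjective.isDrinfeldOrbifold (h : LeadingInjective κ) : κ.IsDrinfeldOrbifold := by
  choose e he using fun i => exists_linearEquiv_of_surjective (toGr κ i) (toSymDegree G V i)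
    (toGr_surjective i) (toSymDegree_surjective i) (fun z w => by
      rw [toSymDegree_eq_iff, ← mem_ker_toSymDegree, ← h.ker_eq, mem_ker_toGr,
        Submodule.coe_sub, map_sub]
      exact Submodule.Quotient.eq (κ.lower i))
  have hx : ∀ i (x : κ.filtration i), ∃ z : tensorDegree G V i,
      x.1 - κ.proj z ∈ lowerPart κ i ∧
        (Submodule.Quotient.mk x : κ.Gr i) = toGr κ i z := by
    intro i x
    obtain ⟨z, hz, hl⟩ := exists_proj_sub_mem x.2
    exact ⟨⟨z, hz⟩, hl, (Submodule.Quotient.eq (κ.lower i)).2 hl⟩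
  have hmul : ∀ i j (x : κ.Alg) (y : κ.Alg), x ∈ lowerPart κ i → y ∈ κ.filtration j →
      x * y ∈ lowerPart κ (i + j) ∧ y * x ∈ lowerPart κ (i + j) := by
    intro i j x y hx hy
    have : lowerPart κ i ≤ (lowerPart κ (i + j)).comap (LinearMap.mulRight ℂ y)
        ⊓ (lowerPart κ (i + j)).comap (LinearMap.mulLeft ℂ y) := by
      refine iSup₂_le fun k hk z hz => ⟨?_, ?_⟩
      · exact (le_iSup₂ (f := fun l (_ : l < i + j) => κ.filtration l) (k + j) (by omega))
          (κ.filtration_mul hz hy)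
      · exact (le_iSup₂ (f := fun l (_ : l < i + j) => κ.filtration l) (j + k) (by omega))
          (κ.filtration_mul hy hz)
    exact this hx
  refine ⟨e, fun i j x y => ?_⟩
  obtain ⟨z, hz, ez⟩ := hx i x
  obtain ⟨w, hw, ew⟩ := hx j y
  have exy : (Submodule.Quotient.mk ⟨x * y, κ.filtration_mul x.2 y.2⟩ : κ.Gr (i + j))
      = toGr κ (i + j) ⟨z * w, tensorDegree_mul z.2 w.2⟩ := by
    refine (Submodule.Quotient.eq (κ.lower (i + j))).2 ?_
    change (x : κ.Alg) * y - κ.proj (z * w) ∈ lowerPart κ (i + j)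
    have : (x : κ.Alg) * y - κ.proj (z * w)
        = (x - κ.proj z) * y + κ.proj z * (y - κ.proj w) := by
      rw [map_mul, sub_mul, mul_sub]; abel
    rw [this]
    refine add_mem (hmul _ _ _ _ hz y.2).1 ?_
    rw [add_comm i j]
    exact (hmul _ _ _ _ hw (proj_mem_filtration κ le_rfl z.2)).2
  rw [exy, ez, ew, he, he, he]
  exact symProj_mul _ _

instance tensorDegree_finite [FiniteDimensional ℂ V] (i : ℕ) :
    FiniteDimensional ℂ (tensorDegree G V i) := by
  let b := Module.finBasis ℂ V
  have hf : (Submodule.span ℂ {z : TensorSkew G V | ∃ g : G, ∃ l : List (Fin (Module.finrank ℂ V)),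
      l.length = i ∧ z = SkewMonoidAlgebra.single g (word (l.map b))}).FG := by
    refine Submodule.fg_span ?_
    have : {z : TensorSkew G V | ∃ g : G, ∃ l : List (Fin (Module.finrank ℂ V)),
        l.length = i ∧ z = SkewMonoidAlgebra.single g (word (l.map b))}
        = Set.range fun p : G × List.Vector (Fin (Module.finrank ℂ V)) i =>
          (SkewMonoidAlgebra.single p.1 (word (p.2.1.map b)) : TensorSkew G V) := by
      ext z
      constructor
      · rintro ⟨g, l, hl, rfl⟩
        exact ⟨(g, ⟨l, hl⟩), rfl⟩
      · rintro ⟨⟨g, l, hl⟩, rfl⟩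
        exact ⟨g, l, hl, rfl⟩
    rw [this]
    exact Set.finite_range _
  have := Module.Finite.iff_fg.2 hf
  exact Submodule.finiteDimensional_of_le (tensorDegree_le_span_words b i)

/-- Nested kernels of two surjections onto the same space have equal dimension, so they coincide. -/
theorem eq_zero_of_surjective_of_surjective {M N : Type*} [AddCommGroup M] [AddCommGroup N]
    [Module ℂ M] [Module ℂ N] [FiniteDimensional ℂ M] (f g : M →ₗ[ℂ] N)
    (hf : Function.Surjective f) (hg : Function.Surjective g) (h : ∀ z, f z = 0 → g z = 0)
    {z : M} (hz : g z = 0) : f z = 0 := by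
  have h1 := f.finrank_range_add_finrank_ker
  have h2 := g.finrank_range_add_finrank_ker
  rw [LinearMap.range_eq_top.2 hf] at h1
  rw [LinearMap.range_eq_top.2 hg] at h2
  have heq : LinearMap.ker f = LinearMap.ker g :=
    Submodule.eq_of_le_of_finrank_eq (fun z hz => h z hz) (by omega)
  rw [← LinearMap.mem_ker, heq]
  exact hz

/-- The given isomorphism need not be the canonical one, and its multiplicativity plays no role. It
supplies an equality of finite dimensions, which forces the canonical surjection from `S(V) # G`
onto `gr H_κ` to be injective in each degree. -/
theorem leadingInjective_of_isDrinfeldOrbifold [FiniteDimensional ℂ V]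
    (h : κ.IsDrinfeldOrbifold) : LeadingInjective κ := by
  obtain ⟨e, -⟩ := h
  intro i z hz hl
  rw [← mem_ker_toSymDegree ⟨z, hz⟩]
  refine eq_zero_of_surjective_of_surjective (M := tensorDegree G V i) (N := symDegree G V i)
    (toSymDegree G V i) ((e i).toLinearMap ∘ₗ toGr κ i) (toSymDegree_surjective i)
    ((e i).surjective.comp (toGr_surjective i)) (fun z hz => ?_) ?_
  · exact (e i).map_eq_zero_iff.2 ((mem_ker_toGr z).2
      (proj_mem_lowerPart_of_symProj_eq_zero z.2 ((mem_ker_toSymDegree z).1 hz)))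
  · exact (e i).map_eq_zero_iff.2 ((mem_ker_toGr _).2 hl)

end Criterion

/-! ### Leading terms from a degenerating family of representations -/

section Family

set_option linter.unusedSectionVars false

open Filter Topology

variable {G V : Type*} [Group G] [AddCommGroup V] [Module ℂ V] [DistribMulAction G V]
  [SMulCommClass G ℂ V] [Fintype G]

/-- A family, continuous in the parameter `t`, of representations on functions in which the
relations `v w - w v = t κ^L(v, w) + t² κ^C(v, w)` hold, and whose member at `t = 0` is faithful
for `S(V) # G`. -/
structure RepFamily (κ : ParameterMap G V) (U : Type*) where
  rep : ℂ → TensorSkew G V →ₐ[ℂ] Module.End ℂ (U → ℂ)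
  rel : ∀ t v w, rep t (vec v * vec w - vec w * vec v)
    = t • rep t (κ.linValue v w) + t ^ 2 • rep t (κ.constValue v w)
  cont : ∀ z F u, Continuous fun t => rep t z F u
  faithful : ∀ z, rep 0 z = 0 → symProj G V z = 0

variable {κ : ParameterMap G V} {U : Type*} (R : RepFamily κ U)

namespace RepFamily

/-- Dividing vectors by t turns t κ^L + t² κ^C into t⁻¹ κ^L + κ^C, which is the rescaled right side
of the relation of `H_κ`. -/
theorem rep_scale_comm {t : ℂ} (ht : t ≠ 0) (v w : V) :
    R.rep t (tensorScale t⁻¹ (vec v * vec w - vec w * vec v))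
      = R.rep t (tensorScale t⁻¹ (κ.linValue v w + κ.constValue v w)) := by
  have h2 : ∀ v w : V, (vec v * vec w : TensorSkew G V) ∈ tensorDegree G V 2 := fun v w => by
    have := tensorDegree_mul (G := G) (vec_mem_tensorDegree v) (vec_mem_tensorDegree w)
    rwa [one_add_one_eq_two] at this
  have e1 : t⁻¹ ^ 2 * t = t⁻¹ ^ 1 := by field_simp
  have e2 : t⁻¹ ^ 2 * t ^ 2 = t⁻¹ ^ 0 := by field_simp
  rw [tensorScale_of_mem _ (sub_mem (h2 v w) (h2 w v)),
    map_smul, R.rel, map_add, tensorScale_of_mem _ (linValue_mem_tensorDegree κ v w),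
    tensorScale_of_mem _ (constValue_mem_tensorDegree κ v w), map_add, map_smul, map_smul,
    smul_add, smul_smul, smul_smul, e1, e2]

theorem rep_scale_rel {t : ℂ} (ht : t ≠ 0) ⦃x y : TensorSkew G V⦄ (h : κ.Rel x y) :
    (R.rep t).comp (tensorScale t⁻¹) x = (R.rep t).comp (tensorScale t⁻¹) y := by
  cases h with
  | comm v w => exact R.rep_scale_comm ht v w

/-- The representation of `H_κ` obtained by rescaling the member of the family at `t ≠ 0`. -/
def algRep {t : ℂ} (ht : t ≠ 0) : κ.Alg →ₐ[ℂ] Module.End ℂ (U → ℂ) :=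
  RingQuot.liftAlgHom ℂ ⟨(R.rep t).comp (tensorScale t⁻¹), R.rep_scale_rel ht⟩

theorem algRep_proj {t : ℂ} (ht : t ≠ 0) {i : ℕ} {z : TensorSkew G V}
    (hz : z ∈ tensorDegree G V i) : R.rep t z = t ^ i • R.algRep ht (κ.proj z) := by
  have : R.algRep ht (κ.proj z) = R.rep t (tensorScale t⁻¹ z) :=
    RingQuot.liftAlgHom_mkAlgHom_apply ℂ _ _ z
  rw [this, tensorScale_of_mem _ hz, map_smul, smul_smul, ← mul_pow, mul_inv_cancel₀ ht, one_pow,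
    one_smul]

/-- The elements `x` of `H_κ` with `t ^ i x → 0` as `t → 0` in the rescaled representations. -/
def smallPart (i : ℕ) : Submodule ℂ κ.Alg where
  carrier := {x | ∀ F u, Tendsto
    (fun t : {t : ℂ // t ≠ 0} => (t : ℂ) ^ i * R.algRep t.2 x F u) (comap Subtype.val (𝓝 0)) (𝓝 0)}
  zero_mem' F u := by
    simp only [map_zero, LinearMap.zero_apply, Pi.zero_apply, mul_zero]
    exact tendsto_const_nhds
  add_mem' {x y} hx hy F u := by
    have := (hx F u).add (hy F u)
    rw [add_zero] at this
    refine this.congr fun t => ?_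
    rw [map_add, LinearMap.add_apply, Pi.add_apply, mul_add]
  smul_mem' c x hx F u := by
    have := (hx F u).const_mul c
    rw [mul_zero] at this
    refine this.congr fun t => ?_
    rw [map_smul, LinearMap.smul_apply, Pi.smul_apply, smul_eq_mul]
    ring

/-- For z of degree j < i, the rescaled action satisfies t ^ i ρ_t(z) = t ^ (i - j) R_t(z), and
R_t(z) stays bounded near t = 0 by continuity. -/
theorem lowerPart_le_smallPart (i : ℕ) : lowerPart κ i ≤ R.smallPart i := by
  refine lowerPart_le_iff.2 fun j hj z hz F u => ?_
  have h : Tendsto (fun t : ℂ => t ^ (i - j) * R.rep t z F u) (𝓝 0) (𝓝 0) := by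
    have hc : Continuous fun t : ℂ => t ^ (i - j) * R.rep t z F u :=
      (continuous_pow _).mul (R.cont z F u)
    have := hc.tendsto 0
    rwa [zero_pow (by omega), zero_mul] at this
  refine (h.comp tendsto_comap).congr fun t => ?_
  rw [Function.comp_apply, R.algRep_proj t.2 hz, LinearMap.smul_apply, Pi.smul_apply, smul_eq_mul,
    ← mul_assoc, ← pow_add]
  congr 2
  omega

theorem neBot_comap_ne_zero : (comap (Subtype.val : {t : ℂ // t ≠ 0} → ℂ) (𝓝 0)).NeBot := by
  have : (𝓝[≠] (0 : ℂ)).NeBot := inferInstance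
  rw [← Filter.map_neBot_iff (Subtype.val : {t : ℂ // t ≠ 0} → ℂ), Filter.map_comap]
  have hr : Set.range (Subtype.val : {t : ℂ // t ≠ 0} → ℂ) = {0}ᶜ := Subtype.range_val
  rw [hr]
  exact this

/-- For z of degree i, R_t(z) is t ^ i times the rescaled action of its image in `H_κ`. If that
image has lower degree, the product tends to zero; by continuity it also tends to R_0(z). So R_0(z)
= 0, and faithfulness at t = 0 applies. -/
theorem leadingInjective (R : RepFamily κ U) : LeadingInjective κ := by
  intro i z hz hl
  apply R.faithful
  ext F u
  have h1 := R.lowerPart_le_smallPart i hl F u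
  have h2 : Tendsto (fun t : {t : ℂ // t ≠ 0} => R.rep t z F u) (comap Subtype.val (𝓝 0))
      (𝓝 (R.rep 0 z F u)) := ((R.cont z F u).tendsto 0).comp tendsto_comap
  have := neBot_comap_ne_zero
  refine tendsto_nhds_unique h2 (h1.congr fun t => ?_)
  rw [R.algRep_proj t.2 hz]
  rfl

theorem commute_algebraMap {A B : Type*} [Ring A] [Algebra ℂ A] (t : ℂ) {f : B → A} (a : B) :
    Commute (f a) (algebraMap ℂ A t) := (Algebra.commutes t _).symm

theorem polyRel_compat (t : ℂ) ⦃x y : (TensorSkew G V)[X]⦄ (h : κ.PolyRel x y) :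
    Polynomial.eval₂RingHom' (R.rep t : TensorSkew G V →+* Module.End ℂ (U → ℂ))
      (algebraMap ℂ _ t) (commute_algebraMap t) x
    = Polynomial.eval₂RingHom' (R.rep t : TensorSkew G V →+* Module.End ℂ (U → ℂ))
      (algebraMap ℂ _ t) (commute_algebraMap t) y := by
  cases h with | comm v w
  have hC : ∀ z : TensorSkew G V, Polynomial.eval₂RingHom'
      (R.rep t : TensorSkew G V →+* Module.End ℂ (U → ℂ))
      (algebraMap ℂ _ t) (commute_algebraMap t) (Polynomial.C z) = R.rep t z :=
    fun z => Polynomial.eval₂_C _ _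
  have hX : Polynomial.eval₂RingHom'
      (R.rep t : TensorSkew G V →+* Module.End ℂ (U → ℂ))
      (algebraMap ℂ _ t) (commute_algebraMap t) Polynomial.X
        = algebraMap ℂ _ t := Polynomial.eval₂_X _ _
  have hs : (Polynomial.C (vec v) * Polynomial.C (vec w) - Polynomial.C (vec w)
      * Polynomial.C (vec v) : (TensorSkew G V)[X])
      = Polynomial.C (vec v * vec w - vec w * vec v) := by
    rw [Polynomial.C_sub, Polynomial.C_mul, Polynomial.C_mul]
  rw [hs, hC, R.rel, map_add, map_mul, map_mul, map_pow, hC, hC, hX,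
    ← map_pow, ← Algebra.commutes, ← Algebra.commutes, Algebra.smul_def, Algebra.smul_def]

/-- The representation of `H_{κ,t}` given by a member of the family. -/
def polyRep (t : ℂ) : κ.PolyAlg →+* Module.End ℂ (U → ℂ) :=
  RingQuot.lift ⟨_, R.polyRel_compat t⟩

theorem polyRep_C (t : ℂ) (z : TensorSkew G V) :
    R.polyRep t (κ.polyProj (Polynomial.C z)) = R.rep t z := by
  have h : κ.polyProj (Polynomial.C z) = RingQuot.mkRingHom κ.PolyRel (Polynomial.C z) :=
    congrArg (fun f => f (Polynomial.C z)) (RingQuot.mkAlgHom_coe ℂ κ.PolyRel)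
  rw [h]
  refine (RingQuot.lift_mkRingHom_apply _ _ _).trans ?_
  exact Polynomial.eval₂_C _ _

theorem polyRep_t (t : ℂ) : R.polyRep t κ.t = algebraMap ℂ _ t := by
  have h : κ.t = RingQuot.mkRingHom κ.PolyRel Polynomial.X :=
    congrArg (fun f => f Polynomial.X) (RingQuot.mkAlgHom_coe ℂ κ.PolyRel)
  rw [h]
  refine (RingQuot.lift_mkRingHom_apply _ _ _).trans ?_
  exact Polynomial.eval₂_X _ _

end RepFamily

end Family

/-! ### Ordered words as a ℂ[t]-basis -/

section PolySection

set_option linter.unusedSectionVars false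

variable {G V : Type*} [Group G] [AddCommGroup V] [Module ℂ V] [DistribMulAction G V]
  [SMulCommClass G ℂ V] [Fintype G] {κ : ParameterMap G V}
  {A : Type*} [Ring A] [Algebra ℂ A] {Q : TensorSkew G V →ₐ[ℂ] A} {τ : A}
  {I : Type*} (b : Module.Basis I ℂ V)

variable (Q τ) in
/-- The map from `(S(V) # G)[t]` that sends `a t ^ n` to `Q (s a) τ ^ n`, where `s` is the section
`symSection` of `T(V) → S(V)`. -/
def polySection : (SymSkew G V)[X] →ₗ[ℂ] A :=
  Polynomial.lsum fun n => LinearMap.mulRight ℂ (τ ^ n) ∘ₗ Q.toLinearMap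
    ∘ₗ mapCoeff G (symSection b)

theorem polySection_monomial (n : ℕ) (a : SymSkew G V) :
    polySection Q τ b (Polynomial.monomial n a)
      = Q (mapCoeff G (symSection b) a) * τ ^ n := by
  rw [polySection, Polynomial.lsum_apply, Polynomial.sum_monomial_index]
  · rfl
  · exact map_zero _

theorem polySection_C (a : SymSkew G V) :
    polySection Q τ b (Polynomial.C a) = Q (mapCoeff G (symSection b) a) := by
  rw [← Polynomial.monomial_zero_left, polySection_monomial, pow_zero, mul_one]

theorem symProj_mapCoeff_symSection (a : SymSkew G V) :
    symProj G V (mapCoeff G (symSection b) a) = a := by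
  apply SkewMonoidAlgebra.coeff_injective
  ext g
  rw [symProj, mapCoeff_coeff, mapCoeff_coeff]
  exact algHom_symSection b _

theorem mem_iSup_tensorDegree (z : TensorSkew G V) : z ∈ ⨆ i, tensorDegree G V i := by
  rw [iSup_tensorDegree]; trivial

variable (hτ : ∀ a, a * τ = τ * a)
  (hQ : ∀ v w, Q (vec v * vec w - vec w * vec v)
    = Q (κ.linValue v w) * τ + Q (κ.constValue v w) * τ ^ 2)

include hτ in
theorem polySection_X_mul (p : (SymSkew G V)[X]) :
    polySection Q τ b (Polynomial.X * p) = τ * polySection Q τ b p := by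
  induction p using Polynomial.induction_on' with
  | add p q hp hq => rw [mul_add, map_add, map_add, hp, hq, mul_add]
  | monomial n a =>
    rw [Polynomial.X_mul_monomial, polySection_monomial, polySection_monomial, pow_succ,
      ← mul_assoc, hτ]

-- Strong induction on the degree: an element is its ordered form plus τ times something of lower
-- degree, and the range is stable under multiplication by τ.
include hτ hQ in
theorem lowSpan_le_range (i : ℕ) :
    lowSpan Q τ i ≤ LinearMap.range (polySection Q τ b) := by
  have ht : ∀ k x, x ∈ LinearMap.range (polySection Q τ b) →
      x * τ ^ k ∈ LinearMap.range (polySection Q τ b) := by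
    intro k
    induction k with
    | zero => intro x hx; simpa using hx
    | succ k ih =>
      intro x hx
      obtain ⟨p, hp⟩ := ih x hx
      refine ⟨Polynomial.X * p, ?_⟩
      rw [polySection_X_mul b hτ, hp, pow_succ', ← mul_assoc x, hτ, mul_assoc]
  induction i using Nat.strong_induction_on with
  | _ i ih =>
    rw [lowSpan, Submodule.span_le]
    rintro _ ⟨j, hj, k, z, hz, rfl⟩
    refine ht k _ ?_
    obtain ⟨y, hy, e⟩ := sub_symSection_mem κ hτ hQ b hz
    rw [sub_eq_iff_eq_add] at e
    rw [e]
    refine add_mem ?_ ⟨Polynomial.C (symProj G V z), polySection_C b _⟩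
    have := ht 1 y (ih j hj hy)
    rwa [pow_one] at this

include hτ hQ in
theorem polySection_surjective (hs : ∀ x : A, ∃ p : (TensorSkew G V)[X],
    x = p.sum fun n z => Q z * τ ^ n) : Function.Surjective (polySection Q τ b) := by
  intro x
  obtain ⟨p, rfl⟩ := hs x
  rw [← LinearMap.mem_range]
  refine sum_mem fun n _ => ?_
  have hle : (⨆ i, tensorDegree G V i) ≤ (LinearMap.range (polySection Q τ b)).comap
      (LinearMap.mulRight ℂ (τ ^ n) ∘ₗ Q.toLinearMap) :=
    iSup_le fun i z hz => lowSpan_le_range b hτ hQ (i + 1) (mem_lowSpan (Nat.lt_succ_self i) n hz)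
  exact hle (mem_iSup_tensorDegree _)

include hτ hQ in
theorem exists_eq_symSection_add (z : TensorSkew G V) : ∃ h,
    Q z = Q (mapCoeff G (symSection b) (symProj G V z)) + τ * h := by
  let D : TensorSkew G V →ₗ[ℂ] A := Q.toLinearMap
    - Q.toLinearMap ∘ₗ mapCoeff G (symSection b) ∘ₗ symProj G V
  have hle : (⨆ i, tensorDegree G V i)
      ≤ (LinearMap.range (LinearMap.mulLeft ℂ τ)).comap D := by
    refine iSup_le fun i z hz => ?_
    obtain ⟨y, -, e⟩ := sub_symSection_mem κ hτ hQ b hz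
    exact ⟨y, (hτ y).symm.trans e.symm⟩
  obtain ⟨h, e⟩ := hle (mem_iSup_tensorDegree z)
  exact ⟨h, (sub_eq_iff_eq_add'.1 e.symm)⟩

variable {U : Type*} (R : RepFamily κ U) {σ : ℂ → A →+* Module.End ℂ (U → ℂ)}
  (hσQ : ∀ t z, σ t (Q z) = R.rep t z) (hστ : ∀ t, σ t τ = algebraMap ℂ _ t)

include hσQ hστ in
theorem continuous_polySection (p : (SymSkew G V)[X]) (F : U → ℂ) (u : U) :
    Continuous fun t => σ t (polySection Q τ b p) F u := by
  induction p using Polynomial.induction_on' with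
  | add p q hp hq =>
    simp only [map_add, LinearMap.add_apply, Pi.add_apply]
    exact hp.add hq
  | monomial n a =>
    have : ∀ t, σ t (polySection Q τ b (Polynomial.monomial n a)) F u
        = t ^ n * R.rep t (mapCoeff G (symSection b) a) F u := by
      intro t
      rw [polySection_monomial, map_mul, map_pow, hστ, hσQ, ← map_pow, ← Algebra.commutes,
        ← Algebra.smul_def]
      rfl
    simp_rw [this]
    exact (continuous_pow n).mul (R.cont _ F u)

-- At t = 0 the element τ acts by zero, so only the constant coefficient acts, and it acts
-- faithfully.
include hτ hσQ hστ in
theorem coeff_zero_of_polySection (p : (SymSkew G V)[X])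
    (hp : σ 0 (polySection Q τ b p) = 0) : p.coeff 0 = 0 := by
  rw [← p.divX_mul_X_add, ← Polynomial.X_mul, map_add, polySection_X_mul b hτ, map_add, map_mul,
    hστ, map_zero, zero_mul, zero_add, polySection_C, hσQ] at hp
  have h1 := R.faithful _ hp
  rwa [symProj_mapCoeff_symSection] at h1

-- An element killed in every member of the family has zero constant coefficient, hence is divisible
-- by t. The quotient is again killed everywhere, so the degree can be lowered until nothing is
-- left.
include hτ hσQ hστ in
theorem polySection_injective : Function.Injective (polySection Q τ b) := by
  have main : ∀ (d : ℕ) (p : (SymSkew G V)[X]), p.natDegree < d →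
      (∀ t : ℂ, σ t (polySection Q τ b p) = 0) → p = 0 := by
    intro d
    induction d with
    | zero => intro p h; omega
    | succ d ih =>
      intro p hd hp
      have h0 := coeff_zero_of_polySection b hτ R hσQ hστ p (hp 0)
      have hq : p = Polynomial.X * p.divX := by
        conv_lhs => rw [← p.divX_mul_X_add, h0, map_zero, add_zero, ← Polynomial.X_mul]
      by_cases hz : p.natDegree = 0
      · rw [Polynomial.eq_C_of_natDegree_eq_zero hz, h0, map_zero]
      rw [hq, ih p.divX ?_ fun t => ?_, mul_zero]
      · rw [Polynomial.natDegree_divX_eq_natDegree_tsub_one]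
        omega
      -- For t ≠ 0 the factor t can be cancelled; the value at t = 0 then follows by continuity.
      · have hne : ∀ t : ℂ, t ≠ 0 → σ t (polySection Q τ b p.divX) = 0 := by
          intro t ht
          have := hp t
          rw [hq, polySection_X_mul b hτ, map_mul, hστ, ← Algebra.smul_def] at this
          exact (smul_eq_zero.1 this).resolve_left ht
        ext F u
        have h2 : (fun t => σ t (polySection Q τ b p.divX) F u) = fun _ => 0 := by
          refine Continuous.ext_on (dense_compl_singleton (0 : ℂ))
            (continuous_polySection b R hσQ hστ _ F u) continuous_const fun t ht => ?_
          rw [hne t ht]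
          rfl
        exact congrFun h2 t
  intro p q hpq
  have h0 : p + (-1 : ℂ) • q = 0 := main _ _ (Nat.lt_succ_self _) fun t => by
    rw [map_add, map_smul, hpq, neg_smul, one_smul, add_neg_cancel, map_zero]
  calc p = p + ((-1 : ℂ) + 1) • q := by rw [neg_add_cancel, zero_smul, add_zero]
    _ = q := by rw [add_smul, one_smul, ← add_assoc, h0, zero_add]

include hτ hQ hσQ hστ in
theorem exists_equiv_of_repFamily (hs : ∀ x : A, ∃ p : (TensorSkew G V)[X],
    x = p.sum fun n z => Q z * τ ^ n) :
    ∃ e : (SymSkew G V)[X] ≃ₗ[ℂ] A,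
      (∀ p, e (Polynomial.X * p) = τ * e p) ∧
      (∀ v : V, e (Polynomial.C (SkewMonoidAlgebra.single 1 (SymmetricAlgebra.ι ℂ V v)))
        = Q (vec v)) ∧
      (∀ g : G, e (Polynomial.C (SkewMonoidAlgebra.single g 1))
        = Q (SkewMonoidAlgebra.single g 1)) ∧
      ∀ x y : SymSkew G V, ∃ h : A,
        e (Polynomial.C x) * e (Polynomial.C y) = e (Polynomial.C (x * y)) + τ * h := by
  obtain ⟨⟨I, b⟩⟩ := Module.Free.exists_basis (R := ℂ) (M := V)
  refine ⟨LinearEquiv.ofBijective (polySection Q τ b)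
    ⟨polySection_injective b hτ R hσQ hστ, polySection_surjective b hτ hQ hs⟩,
    polySection_X_mul b hτ, fun v => ?_, fun g => ?_, fun x y => ?_⟩
  · refine (polySection_C b _).trans ?_
    rw [mapCoeff_single, symSection_ι]
    rfl
  · refine (polySection_C b _).trans ?_
    rw [mapCoeff_single, symSection_one]
  · obtain ⟨h, e⟩ := exists_eq_symSection_add b hτ hQ
      (mapCoeff G (symSection b) x * mapCoeff G (symSection b) y)
    refine ⟨h, ?_⟩
    change polySection Q τ b _ * polySection Q τ b _ = polySection Q τ b _ + _
    rw [polySection_C, polySection_C, polySection_C, ← map_mul, e, symProj_mul,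
      symProj_mapCoeff_symSection, symProj_mapCoeff_symSection]

end PolySection

/-! ### The deformation property of `H_{κ,t}` -/

section Deformation

variable {G V : Type*} [Group G] [AddCommGroup V] [Module ℂ V] [DistribMulAction G V]
  [SMulCommClass G ℂ V] [Fintype G] {κ : ParameterMap G V} {U : Type*} (R : RepFamily κ U)

theorem t_comm (x : κ.PolyAlg) : x * κ.t = κ.t * x := by
  obtain ⟨p, rfl⟩ := RingQuot.mkAlgHom_surjective ℂ κ.PolyRel x
  change κ.polyProj p * κ.polyProj Polynomial.X = κ.polyProj Polynomial.X * κ.polyProj p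
  rw [← map_mul, ← map_mul, Polynomial.X_mul]

variable (κ) in
/-- The homomorphism `T(V) # G → H_{κ,t}`. -/
def polyConst : TensorSkew G V →ₐ[ℂ] κ.PolyAlg := κ.polyProj.comp Polynomial.CAlgHom

theorem polyConst_rel (v w : V) : polyConst κ (vec v * vec w - vec w * vec v)
    = polyConst κ (κ.linValue v w) * κ.t + polyConst κ (κ.constValue v w) * κ.t ^ 2 := by
  have := RingQuot.mkAlgHom_rel ℂ (ParameterMap.PolyRel.comm (κ := κ) v w)
  have hs : (Polynomial.C (vec v) * Polynomial.C (vec w) - Polynomial.C (vec w)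
      * Polynomial.C (vec v) : (TensorSkew G V)[X])
      = Polynomial.C (vec v * vec w - vec w * vec v) := by
    rw [Polynomial.C_sub, Polynomial.C_mul, Polynomial.C_mul]
  rw [hs] at this
  refine Eq.trans this ?_
  change κ.polyProj _ = κ.polyProj _ * κ.polyProj Polynomial.X
    + κ.polyProj _ * κ.polyProj Polynomial.X ^ 2
  rw [map_add, map_mul, map_mul, map_pow]
  rfl

theorem exists_eq_sum_polyConst (x : κ.PolyAlg) : ∃ p : (TensorSkew G V)[X],
    x = p.sum fun n z => polyConst κ z * κ.t ^ n := by
  obtain ⟨p, rfl⟩ := RingQuot.mkAlgHom_surjective ℂ κ.PolyRel x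
  refine ⟨p, ?_⟩
  change κ.polyProj p = _
  conv_lhs => rw [← p.sum_C_mul_X_pow_eq, Polynomial.sum_def, map_sum]
  rw [Polynomial.sum_def]
  refine Finset.sum_congr rfl fun n _ => ?_
  rw [map_mul, map_pow]
  rfl

namespace RepFamily

theorem isDeformation (R : RepFamily κ U) : κ.IsDeformation :=
  exists_equiv_of_repFamily (Q := polyConst κ) (τ := κ.t) t_comm polyConst_rel R
    R.polyRep_C R.polyRep_t exists_eq_sum_polyConst

theorem isDrinfeldOrbifoldOverPoly (R : RepFamily κ U) : κ.IsDrinfeldOrbifoldOverPoly :=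
  ⟨R.leadingInjective.isDrinfeldOrbifold, R.isDeformation⟩

end RepFamily

end Deformation

/-! ### Consequences of PBW in degrees at most one, and the bracket computation -/

section Necessary

set_option linter.unusedSectionVars false

variable {G V : Type*} [Group G] [AddCommGroup V] [Module ℂ V] [DistribMulAction G V]
  [SMulCommClass G ℂ V] [Fintype G] {κ : ParameterMap G V}

/-- `∑ m_g ⊗ g`, for vectors `m_g`. -/
def linElt (m : G → V) : TensorSkew G V :=
  ∑ g, SkewMonoidAlgebra.single g (TensorAlgebra.ι ℂ (m g))

/-- `∑ c_g g`, for scalars `c_g`. -/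
def constElt (c : G → ℂ) : TensorSkew G V :=
  ∑ g, SkewMonoidAlgebra.single g (algebraMap ℂ (TensorAlgebra ℂ V) (c g))

theorem linElt_mem (m : G → V) : linElt m ∈ tensorDegree G V 1 :=
  sum_mem fun _ _ => single_ι_mem_tensorDegree _ _

theorem constElt_mem (c : G → ℂ) : (constElt c : TensorSkew G V) ∈ tensorDegree G V 0 :=
  sum_mem fun _ _ => single_algebraMap_mem_tensorDegree _ _

theorem linElt_add (m m' : G → V) : linElt (m + m') = linElt m + linElt m' := by
  simp only [linElt, Pi.add_apply, map_add, SkewMonoidAlgebra.single_add, Finset.sum_add_distrib]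

theorem linElt_sub (m m' : G → V) : linElt (m - m') = linElt m - linElt m' := by
  rw [eq_sub_iff_add_eq, ← linElt_add, sub_add_cancel]

theorem constElt_add (c c' : G → ℂ) :
    (constElt (c + c') : TensorSkew G V) = constElt c + constElt c' := by
  simp only [constElt, Pi.add_apply, map_add, SkewMonoidAlgebra.single_add, Finset.sum_add_distrib]

theorem constElt_sub (c c' : G → ℂ) :
    (constElt (c - c') : TensorSkew G V) = constElt c - constElt c' := by
  rw [eq_sub_iff_add_eq, ← constElt_add, sub_add_cancel]

theorem coeff_sum_single {A : Type*} [AddCommMonoid A] (f : G → A) (g : G) :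
    (∑ h, SkewMonoidAlgebra.single h (f h) : SkewMonoidAlgebra A G).coeff g = f g := by
  classical
  have : ∀ s : Finset G, (∑ h ∈ s, SkewMonoidAlgebra.single h (f h)
      : SkewMonoidAlgebra A G).coeff g = if g ∈ s then f g else 0 := by
    intro s
    induction s using Finset.induction_on with
    | empty => simp
    | insert a s ha ih =>
      rw [Finset.sum_insert ha, SkewMonoidAlgebra.coeff_add, Finsupp.add_apply, ih,
        SkewMonoidAlgebra.coeff_single, Finsupp.single_apply]
      by_cases hag : a = g
      · subst hag; simp [ha]
      · simp [hag, Ne.symm hag]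
  simp [this]

/-- Each linear form extends to a character of `S(V)`, and linear forms separate vectors. -/
theorem ι_symmetricAlgebra_injective :
    Function.Injective (SymmetricAlgebra.ι ℂ V) := by
  intro v w h
  rw [← sub_eq_zero, ← Module.forall_dual_apply_eq_zero_iff ℂ (v - w)]
  intro φ
  have := congrArg (SymmetricAlgebra.lift φ) h
  rw [SymmetricAlgebra.lift_ι_apply, SymmetricAlgebra.lift_ι_apply] at this
  rw [map_sub, this, sub_self]

theorem single_sub {A : Type*} [AddCommGroup A] (g : G) (x y : A) :
    SkewMonoidAlgebra.single g (x - y)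
      = SkewMonoidAlgebra.single g x - SkewMonoidAlgebra.single g y :=
  map_sub (SkewMonoidAlgebra.singleAddHom g) x y

namespace LeadingInjective

variable (h : LeadingInjective κ)

include h in
theorem symProj_eq_zero {i : ℕ} {z : TensorSkew G V} (hz : z ∈ tensorDegree G V i) {y : κ.Alg}
    (hy : y ∈ lowerPart κ i) (e : κ.proj z + y = 0) : symProj G V z = 0 :=
  h i z hz (by rw [eq_neg_of_add_eq_zero_left e]; exact neg_mem hy)

-- This is the embedding of V ⊗ ℂG ⊕ ℂG in `H_κ`: the degree-one part is a leading term and must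
-- vanish first, after which the constant part is the leading term. It allows coefficients to be
-- compared in all later identities.
include h in
theorem eq_zero_of_proj {m : G → V} {c : G → ℂ} (e : κ.proj (linElt m + constElt c) = 0) :
    m = 0 ∧ c = 0 := by
  have hm : m = 0 := by
    rw [map_add] at e
    have := h.symProj_eq_zero (linElt_mem m) (proj_mem_lowerPart one_pos (constElt_mem c)) e
    ext g
    have hg := congrArg (fun z : SymSkew G V => z.coeff g) this
    rw [linElt, map_sum] at hg
    simp only [symProj_single] at hg
    rw [coeff_sum_single (fun g => SymmetricAlgebra.algHom ℂ V (TensorAlgebra.ι ℂ (m g)))] at hg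
    exact ι_symmetricAlgebra_injective (hg.trans (map_zero _).symm)
  refine ⟨hm, ?_⟩
  subst hm
  have e0 : (linElt (0 : G → V)) = 0 := by simp [linElt]
  rw [e0, zero_add] at e
  have := h.symProj_eq_zero (constElt_mem c) (zero_mem (lowerPart κ 0)) (by rw [e, add_zero])
  ext g
  have hg := congrArg (fun z : SymSkew G V => z.coeff g) this
  rw [constElt, map_sum] at hg
  simp only [symProj_single] at hg
  rw [coeff_sum_single (fun g => SymmetricAlgebra.algHom ℂ V (algebraMap ℂ _ (c g))),
    AlgHom.commutes] at hg
  exact (SymmetricAlgebra.algebraMap_eq_zero_iff V (c g)).1 hg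

end LeadingInjective

theorem linValue_eq (v w : V) : κ.linValue v w = linElt fun g => κ.lin g ![v, w] := rfl

theorem constValue_eq (v w : V) : κ.constValue v w = constElt fun g => κ.const g ![v, w] := rfl

theorem conj_linElt (g : G) (m : G → V) :
    SkewMonoidAlgebra.single g 1 * linElt m * SkewMonoidAlgebra.single g⁻¹ 1
      = linElt fun k => g • m (g⁻¹ * k * g) := by
  rw [linElt, linElt, Finset.mul_sum, Finset.sum_mul]
  conv_rhs => rw [← Equiv.sum_comp (MulAut.conj g).toEquiv]
  refine Finset.sum_congr rfl fun k _ => ?_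
  simp [SkewMonoidAlgebra.single_mul_single, tensorAction_ι, mul_assoc]

theorem conj_constElt (g : G) (c : G → ℂ) :
    SkewMonoidAlgebra.single g 1 * constElt c * SkewMonoidAlgebra.single g⁻¹ 1
      = (constElt fun k => c (g⁻¹ * k * g) : TensorSkew G V) := by
  rw [constElt, constElt, Finset.mul_sum, Finset.sum_mul]
  conv_rhs => rw [← Equiv.sum_comp (MulAut.conj g).toEquiv]
  refine Finset.sum_congr rfl fun k _ => ?_
  simp [SkewMonoidAlgebra.single_mul_single, mul_assoc]

theorem conj_vec (g : G) (v : V) :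
    SkewMonoidAlgebra.single g 1 * vec v * SkewMonoidAlgebra.single g⁻¹ 1
      = (vec (g • v) : TensorSkew G V) := by
  simp [vec, SkewMonoidAlgebra.single_mul_single, tensorAction_ι]

/-- The commutator of g v and g w is the conjugate by g of the commutator of v and w. Both are
expressed through κ in degree at most one, where coefficients may be compared. -/
theorem LeadingInjective.invariant (h : LeadingInjective κ) (g k : G) (v w : V) :
    κ.lin (g * k * g⁻¹) ![g • v, g • w] = g • κ.lin k ![v, w] ∧
      κ.const (g * k * g⁻¹) ![g • v, g • w] = κ.const k ![v, w] := by
  have hg : (SkewMonoidAlgebra.single g⁻¹ 1 * SkewMonoidAlgebra.single g 1 : TensorSkew G V)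
      = 1 := by
    simp [SkewMonoidAlgebra.single_mul_single]
  have hc : ∀ x y : TensorSkew G V,
      SkewMonoidAlgebra.single g 1 * (x * y) * SkewMonoidAlgebra.single g⁻¹ 1
      = (SkewMonoidAlgebra.single g 1 * x * SkewMonoidAlgebra.single g⁻¹ 1)
        * (SkewMonoidAlgebra.single g 1 * y * SkewMonoidAlgebra.single g⁻¹ 1) := by
    intro x y
    calc _ = SkewMonoidAlgebra.single g 1 * x * 1 * y * SkewMonoidAlgebra.single g⁻¹ 1 := by
          simp only [mul_assoc, mul_one]
      _ = _ := by rw [← hg]; simp only [mul_assoc]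
  have e1 := proj_comm κ (g • v) (g • w)
  rw [← conj_vec g v, ← conj_vec g w, ← hc, ← hc, ← sub_mul, ← mul_sub, map_mul, map_mul,
    proj_comm, linValue_eq, constValue_eq, ← map_add, ← map_mul, ← map_mul, mul_add, add_mul,
    conj_linElt, conj_constElt, linValue_eq, constValue_eq, ← map_add, ← sub_eq_zero, ← map_sub,
    add_sub_add_comm, ← linElt_sub, ← constElt_sub] at e1
  obtain ⟨hm, hc⟩ := h.eq_zero_of_proj e1
  have hm := congrFun hm (g * k * g⁻¹)
  have hc := congrFun hc (g * k * g⁻¹)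
  have hk : g⁻¹ * (g * k * g⁻¹) * g = k := by group
  simp only [Pi.sub_apply, Pi.zero_apply, hk, sub_eq_zero] at hm hc
  exact ⟨hm.symm, hc.symm⟩

/-! ### The Jacobi identities -/

/-- The cyclic rotation of a triple. -/
def rot (v : Fin 3 → V) (r : Fin 3) : Fin 3 → V := fun i => v (i + r)

variable (κ) in
/-- The part of degree one of the Jacobi identity. -/
def jacLin (v : Fin 3 → V) (k : G) : V :=
  ∑ g, (1 / 2 : ℂ) • κ.lin (k * g⁻¹) ![κ.lin g ![v 0, v 1], g • v 2 + v 2]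
    + κ.const k ![v 0, v 1] • (k • v 2 - v 2)

variable (κ) in
/-- The part of degree zero of the Jacobi identity. -/
def jacConst (v : Fin 3 → V) (k : G) : ℂ :=
  ∑ g, (1 / 2 : ℂ) * κ.const (k * g⁻¹) ![κ.lin g ![v 0, v 1], g • v 2 + v 2]

/-- The symmetric tensor `(u w + w u) / 2`. -/
def symTensor (u w : V) : TensorAlgebra ℂ V :=
  (1 / 2 : ℂ) • (TensorAlgebra.ι ℂ u * TensorAlgebra.ι ℂ w
    + TensorAlgebra.ι ℂ w * TensorAlgebra.ι ℂ u)

variable (κ) in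
/-- The part of degree two of the Jacobi identity. -/
def jacQuad (v : Fin 3 → V) (g : G) : TensorAlgebra ℂ V :=
  symTensor (κ.lin g ![v 0, v 1]) (g • v 2 - v 2)

theorem linElt_mul_single (m : G → V) (g : G) :
    linElt m * SkewMonoidAlgebra.single g 1 = linElt fun k => m (k * g⁻¹) := by
  rw [linElt, linElt, Finset.sum_mul]
  conv_rhs => rw [← Equiv.sum_comp (Equiv.mulRight g)]
  refine Finset.sum_congr rfl fun k _ => ?_
  simp [SkewMonoidAlgebra.single_mul_single]

theorem constElt_mul_single (c : G → ℂ) (g : G) :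
    constElt c * SkewMonoidAlgebra.single g 1
      = (constElt fun k => c (k * g⁻¹) : TensorSkew G V) := by
  rw [constElt, constElt, Finset.sum_mul]
  conv_rhs => rw [← Equiv.sum_comp (Equiv.mulRight g)]
  refine Finset.sum_congr rfl fun k _ => ?_
  simp [SkewMonoidAlgebra.single_mul_single]

theorem linElt_sum {ι : Type*} (s : Finset ι) (m : ι → G → V) :
    linElt (∑ i ∈ s, m i) = ∑ i ∈ s, linElt (m i) := by
  simp only [linElt, Finset.sum_apply, map_sum]
  rw [Finset.sum_comm]
  refine Finset.sum_congr rfl fun g _ => ?_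
  exact map_sum (SkewMonoidAlgebra.singleAddHom g) _ _

theorem constElt_sum {ι : Type*} (s : Finset ι) (c : ι → G → ℂ) :
    (constElt (∑ i ∈ s, c i) : TensorSkew G V) = ∑ i ∈ s, constElt (c i) := by
  simp only [constElt, Finset.sum_apply, map_sum]
  rw [Finset.sum_comm]
  refine Finset.sum_congr rfl fun g _ => ?_
  exact map_sum (SkewMonoidAlgebra.singleAddHom g) _ _

theorem linElt_smul (c : ℂ) (m : G → V) : linElt (c • m) = c • linElt m := by
  simp only [linElt, Finset.smul_sum, SkewMonoidAlgebra.smul_single, Pi.smul_apply, map_smul]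

theorem constElt_smul (c : ℂ) (m : G → ℂ) :
    (constElt (c • m) : TensorSkew G V) = c • constElt m := by
  simp only [constElt, Finset.smul_sum, SkewMonoidAlgebra.smul_single, Pi.smul_apply,
    Algebra.algebraMap_eq_smul_one, smul_assoc]

theorem proj_comm_mul_single (u w : V) (g : G) :
    κ.proj (SkewMonoidAlgebra.single g (TensorAlgebra.ι ℂ u * TensorAlgebra.ι ℂ w
      - TensorAlgebra.ι ℂ w * TensorAlgebra.ι ℂ u))
    = κ.proj (linElt (fun k => κ.lin (k * g⁻¹) ![u, w])
      + constElt fun k => κ.const (k * g⁻¹) ![u, w]) := by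
  have : (SkewMonoidAlgebra.single g (TensorAlgebra.ι ℂ u * TensorAlgebra.ι ℂ w
      - TensorAlgebra.ι ℂ w * TensorAlgebra.ι ℂ u) : TensorSkew G V)
      = (vec u * vec w - vec w * vec u) * SkewMonoidAlgebra.single g 1 := by
    rw [vec, vec, SkewMonoidAlgebra.single_mul_single, SkewMonoidAlgebra.single_mul_single,
      sub_mul, SkewMonoidAlgebra.single_mul_single, SkewMonoidAlgebra.single_mul_single, one_smul,
      one_smul, single_sub]
    simp
  rw [this, map_mul, proj_comm, ← map_add, ← map_mul, add_mul, linValue_eq, constValue_eq,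
    linElt_mul_single, constElt_mul_single]

/-- For u = κ^L_g(v 0, v 1) and x = v 2, moving g to the right leaves u (g x) - x u, which is the
symmetric tensor of u and g x - x plus half the commutator of u and g x + x. The commutator is
replaced by κ once more. The symmetric choice makes the quadratic part vanish in `T(V)` as soon as
it vanishes in `S(V)`. -/
theorem proj_bracket (v : Fin 3 → V) :
    κ.proj ((κ.linValue (v 0) (v 1) + κ.constValue (v 0) (v 1)) * vec (v 2)
      - vec (v 2) * (κ.linValue (v 0) (v 1) + κ.constValue (v 0) (v 1)))
    = κ.proj (∑ g, SkewMonoidAlgebra.single g (jacQuad κ v g))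
      + κ.proj (linElt (jacLin κ v) + constElt (jacConst κ v)) := by
  have hlin : κ.linValue (v 0) (v 1) * vec (v 2) - vec (v 2) * κ.linValue (v 0) (v 1)
      = ∑ g, SkewMonoidAlgebra.single g (jacQuad κ v g)
        + ∑ g, (1 / 2 : ℂ) • SkewMonoidAlgebra.single g
          (TensorAlgebra.ι ℂ (κ.lin g ![v 0, v 1]) * TensorAlgebra.ι ℂ (g • v 2 + v 2)
            - TensorAlgebra.ι ℂ (g • v 2 + v 2) * TensorAlgebra.ι ℂ (κ.lin g ![v 0, v 1])) := by
    rw [ParameterMap.linValue, Finset.sum_mul, Finset.mul_sum, ← Finset.sum_sub_distrib,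
      ← Finset.sum_add_distrib]
    refine Finset.sum_congr rfl fun g _ => ?_
    rw [vec, SkewMonoidAlgebra.single_mul_single, SkewMonoidAlgebra.single_mul_single,
      SkewMonoidAlgebra.smul_single, ← SkewMonoidAlgebra.single_add, one_mul, mul_one, one_smul,
      tensorAction_ι, jacQuad, symTensor]
    rw [← single_sub]
    congr 1
    simp only [map_sub, map_add, mul_add, add_mul, mul_sub, sub_mul]
    module
  have hconst : κ.constValue (v 0) (v 1) * vec (v 2) - vec (v 2) * κ.constValue (v 0) (v 1)
      = linElt fun k => κ.const k ![v 0, v 1] • (k • v 2 - v 2) := by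
    rw [ParameterMap.constValue, Finset.sum_mul, Finset.mul_sum, ← Finset.sum_sub_distrib, linElt]
    refine Finset.sum_congr rfl fun g _ => ?_
    rw [vec, SkewMonoidAlgebra.single_mul_single, SkewMonoidAlgebra.single_mul_single, one_mul,
      mul_one, one_smul, tensorAction_ι, ← single_sub, ← Algebra.commutes, ← mul_sub, ← map_sub,
      ← Algebra.smul_def, ← map_smul]
  have hl : linElt (jacLin κ v) = ∑ g, (1 / 2 : ℂ) •
      linElt (fun k => κ.lin (k * g⁻¹) ![κ.lin g ![v 0, v 1], g • v 2 + v 2])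
      + linElt fun k => κ.const k ![v 0, v 1] • (k • v 2 - v 2) := by
    simp_rw [← linElt_smul]
    rw [← linElt_sum, ← linElt_add]
    congr 1
    ext k
    simp [jacLin]
  have hc : (constElt (jacConst κ v) : TensorSkew G V) = ∑ g, (1 / 2 : ℂ) •
      constElt (fun k => κ.const (k * g⁻¹) ![κ.lin g ![v 0, v 1], g • v 2 + v 2]) := by
    simp_rw [← constElt_smul]
    rw [← constElt_sum]
    congr 1
    ext k
    simp [jacConst]
  rw [add_mul, mul_add, add_sub_add_comm, hlin, hconst, hl, hc, map_add, map_add, map_add, map_add,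
    map_sum κ.proj (fun g => (1 / 2 : ℂ) • SkewMonoidAlgebra.single g _)]
  simp_rw [map_smul, proj_comm_mul_single, map_add, smul_add, Finset.sum_add_distrib, map_sum,
    map_smul]
  abel

end Necessary

/-! ### The Jacobi identity, degree by degree -/

section Jacobi

set_option linter.unusedSectionVars false

variable {G V : Type*} [Group G] [AddCommGroup V] [Module ℂ V] [DistribMulAction G V]
  [SMulCommClass G ℂ V] [Fintype G] {κ : ParameterMap G V}

/-- In `H_κ` the values of κ are commutators, so this is the Jacobi identity of an associative
algebra. -/
theorem sum_proj_bracket (v : Fin 3 → V) :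
    ∑ r, κ.proj ((κ.linValue (rot v r 0) (rot v r 1) + κ.constValue (rot v r 0) (rot v r 1))
        * vec (rot v r 2)
      - vec (rot v r 2)
        * (κ.linValue (rot v r 0) (rot v r 1) + κ.constValue (rot v r 0) (rot v r 1))) = 0 := by
  have h : ∀ u w : V, κ.proj (κ.linValue u w + κ.constValue u w)
      = κ.proj (vec u) * κ.proj (vec w) - κ.proj (vec w) * κ.proj (vec u) := fun u w => by
    rw [map_add, ← proj_comm, map_sub, map_mul, map_mul]
  simp only [map_sub, map_mul, h, Fin.sum_univ_three]
  simp only [rot, Fin.isValue, add_zero, zero_add, Fin.reduceAdd]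
  noncomm_ring

theorem jacQuad_mem (v : Fin 3 → V) :
    ∑ g, SkewMonoidAlgebra.single g (jacQuad κ v g) ∈ tensorDegree G V 2 := by
  refine sum_mem fun g _ => ?_
  rw [jacQuad, symTensor, ← SkewMonoidAlgebra.smul_single, SkewMonoidAlgebra.single_add]
  exact Submodule.smul_mem _ _
    (add_mem (single_ι_mul_ι_mem_tensorDegree _ _ _) (single_ι_mul_ι_mem_tensorDegree _ _ _))

/-- After expansion in a basis, the coefficient at a pair of basis vectors is half the hypothesis
for the two coordinate forms. -/
theorem sum_symTensor_eq_zero [FiniteDimensional ℂ V] {ι : Type*} (s : Finset ι) (u w : ι → V)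
    (h : ∀ φ ψ : Module.Dual ℂ V, ∑ i ∈ s, (φ (u i) * ψ (w i) + ψ (u i) * φ (w i)) = 0) :
    ∑ i ∈ s, symTensor (u i) (w i) = 0 := by
  let b := Module.finBasis ℂ V
  have hι : ∀ v : V, TensorAlgebra.ι ℂ v = ∑ j, b.coord j v • TensorAlgebra.ι ℂ (b j) := by
    intro v
    conv_lhs => rw [← b.sum_repr v]
    rw [map_sum]
    simp
  have hs : ∀ i, symTensor (u i) (w i) = ∑ j, ∑ k, ((1 / 2 : ℂ)
      * (b.coord j (u i) * b.coord k (w i) + b.coord k (u i) * b.coord j (w i)))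
        • (TensorAlgebra.ι ℂ (b j) * TensorAlgebra.ι ℂ (b k)) := by
    intro i
    rw [symTensor, hι (u i), hι (w i), Finset.sum_mul_sum, Finset.sum_mul_sum,
      ← Finset.sum_add_distrib, Finset.smul_sum]
    refine Finset.sum_congr rfl fun j _ => ?_
    rw [← Finset.sum_add_distrib, Finset.smul_sum]
    refine Finset.sum_congr rfl fun k _ => ?_
    rw [smul_mul_smul_comm, smul_mul_smul_comm, ← add_smul, smul_smul]
    congr 2
    ring
  simp_rw [hs]
  rw [Finset.sum_comm]
  refine Finset.sum_eq_zero fun j _ => ?_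
  rw [Finset.sum_comm]
  refine Finset.sum_eq_zero fun k _ => ?_
  rw [← Finset.sum_smul, ← Finset.mul_sum, h, mul_zero, zero_smul]

namespace LeadingInjective

/-- The degree-two part of the Jacobi identity is its leading term, so it vanishes in `S(V) # G`. -/
theorem jacobi_quadratic (h : LeadingInjective κ) (v : Fin 3 → V) (g : G)
    (φ ψ : Module.Dual ℂ V) :
    ∑ r, (φ (κ.lin g ![rot v r 0, rot v r 1]) * ψ (g • rot v r 2 - rot v r 2)
      + ψ (κ.lin g ![rot v r 0, rot v r 1]) * φ (g • rot v r 2 - rot v r 2)) = 0 := by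
  have e := sum_proj_bracket (κ := κ) v
  simp_rw [proj_bracket] at e
  rw [Finset.sum_add_distrib, ← map_sum, ← map_sum] at e
  have e2 := h.symProj_eq_zero (i := 2) (sum_mem fun r _ => jacQuad_mem (rot v r)) (by
    rw [map_sum]
    refine sum_mem fun r _ => ?_
    rw [map_add]
    exact add_mem (proj_mem_lowerPart one_lt_two (linElt_mem _))
      (proj_mem_lowerPart two_pos (constElt_mem _))) e
  have eg := congrArg (fun z : SymSkew G V => z.coeff g) e2
  rw [Finset.sum_comm, map_sum] at eg
  have hr : ∀ k : G, ∑ r, (SkewMonoidAlgebra.single k (jacQuad κ (rot v r) k) : TensorSkew G V)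
      = SkewMonoidAlgebra.single k (∑ r, jacQuad κ (rot v r) k) := fun k =>
    (map_sum (SkewMonoidAlgebra.singleAddHom k) _ _).symm
  simp_rw [hr, symProj_single] at eg
  rw [coeff_sum_single (fun k => SymmetricAlgebra.algHom ℂ V (∑ r, jacQuad κ (rot v r) k))] at eg
  -- The character of `S(V)` extending χ gives the diagonal case; polarization with χ = φ + ψ gives
  -- the rest.
  have hχ : ∀ χ : Module.Dual ℂ V,
      ∑ r, χ (κ.lin g ![rot v r 0, rot v r 1]) * χ (g • rot v r 2 - rot v r 2) = 0 := by
    intro χ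
    have := congrArg (SymmetricAlgebra.lift χ) eg
    rw [map_sum, map_sum] at this
    refine Eq.trans (Finset.sum_congr rfl fun r _ => ?_) (this.trans (map_zero _))
    rw [jacQuad, symTensor, map_smul, map_add, map_mul, map_mul, algHom_ι, algHom_ι, map_smul,
      map_add, map_mul, map_mul, SymmetricAlgebra.lift_ι_apply, SymmetricAlgebra.lift_ι_apply,
      smul_eq_mul]
    ring
  have h1 := hχ (φ + ψ)
  simp only [LinearMap.add_apply, add_mul, mul_add, Finset.sum_add_distrib] at h1
  rw [hχ φ, hχ ψ] at h1
  rw [Finset.sum_add_distrib]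
  linear_combination h1

/-- The quadratic part already vanishes in `T(V)`, being a sum of symmetric tensors. What remains
has degree at most one, and there coefficients may be compared. -/
theorem jacobi_lower [FiniteDimensional ℂ V] (h : LeadingInjective κ) (v : Fin 3 → V) :
    ∑ r, jacLin κ (rot v r) = 0 ∧ ∑ r, jacConst κ (rot v r) = 0 := by
  have e := sum_proj_bracket (κ := κ) v
  simp_rw [proj_bracket] at e
  have hr : ∀ k : G, ∑ r, (SkewMonoidAlgebra.single k (jacQuad κ (rot v r) k) : TensorSkew G V)
      = SkewMonoidAlgebra.single k (∑ r, jacQuad κ (rot v r) k) := fun k =>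
    (map_sum (SkewMonoidAlgebra.singleAddHom k) _ _).symm
  have h0 : ∀ k, ∑ r, jacQuad κ (rot v r) k = 0 := fun k =>
    sum_symTensor_eq_zero _ _ _ fun φ ψ => h.jacobi_quadratic v k φ ψ
  rw [Finset.sum_add_distrib, ← map_sum, Finset.sum_comm] at e
  simp_rw [hr, h0, SkewMonoidAlgebra.single_zero] at e
  rw [Finset.sum_const_zero, map_zero, zero_add, ← map_sum, Finset.sum_add_distrib, ← linElt_sum,
    ← constElt_sum] at e
  exact h.eq_zero_of_proj e

end LeadingInjective

end Jacobi

/-! ### Coordinates on 𝔥* ⊕ 𝔥 -/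

section Coordinates

open Equiv

variable {n : ℕ}

/-- The value of the covector part of an element of `𝔥* ⊕ 𝔥` on `ȳ_i`. -/
def xcoord (i : Fin n) : DoubledStd n →ₗ[ℂ] ℂ where
  toFun v := v.1 (yStd i)
  map_add' _ _ := rfl
  map_smul' _ _ := rfl

/-- The `i`-th coordinate of the vector part of an element of `𝔥* ⊕ 𝔥`. -/
def ycoord (i : Fin n) : DoubledStd n →ₗ[ℂ] ℂ where
  toFun v := (v.2 : Fin n → ℂ) i
  map_add' _ _ := rfl
  map_smul' _ _ := rfl

theorem yStd_apply (i j : Fin n) :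
    (yStd i : Fin n → ℂ) j = (if j = i then 1 else 0) - (n : ℂ)⁻¹ := by
  simp [yStd, Pi.single_apply]

theorem sum_std (w : Std n) : ∑ i, (w : Fin n → ℂ) i = 0 := by
  have h : (∑ i : Fin n, LinearMap.proj (R := ℂ) (φ := fun _ : Fin n => ℂ) i) (w : Fin n → ℂ) = 0 :=
    w.2
  rwa [LinearMap.sum_apply] at h

theorem xStd_apply (i : Fin n) (w : Std n) : xStd i w = (w : Fin n → ℂ) i := by
  change (w : Fin n → ℂ) i - (n : ℂ)⁻¹ •
    (∑ j : Fin n, LinearMap.proj (R := ℂ) (φ := fun _ : Fin n => ℂ) j) (w : Fin n → ℂ) = _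
  rw [w.2, smul_zero, sub_zero]

theorem sum_smul_yStd (w : Std n) : ∑ i, (w : Fin n → ℂ) i • yStd i = w := by
  ext j
  rw [Submodule.coe_sum, Finset.sum_apply]
  simp only [Submodule.coe_smul, Pi.smul_apply, yStd_apply, smul_eq_mul, mul_sub,
    Finset.sum_sub_distrib, ← Finset.sum_mul, sum_std]
  simp

theorem sum_yStd : ∑ i : Fin n, yStd i = 0 := by
  ext j
  have hn : (n : ℂ) ≠ 0 := by
    have := j.pos
    exact_mod_cast this.ne'
  rw [Submodule.coe_sum, Finset.sum_apply]
  simp [yStd_apply, hn]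

@[simp] theorem xcoord_xbar (i j : Fin n) :
    xcoord j (xbar i) = (if i = j then 1 else 0) - (n : ℂ)⁻¹ := by
  change xStd i (yStd j) = _
  rw [xStd_apply, yStd_apply]

@[simp] theorem xcoord_ybar (i j : Fin n) : xcoord j (ybar i) = 0 := rfl

@[simp] theorem ycoord_xbar (i j : Fin n) : ycoord j (xbar i) = 0 := rfl

@[simp] theorem ycoord_ybar (i j : Fin n) :
    ycoord j (ybar i) = (if i = j then 1 else 0) - (n : ℂ)⁻¹ := by
  change (yStd i : Fin n → ℂ) j = _
  rw [yStd_apply]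
  simp only [eq_comm]

theorem sum_xcoord (v : DoubledStd n) : ∑ i, xcoord i v = 0 := by
  change ∑ i, v.1 (yStd i) = 0
  rw [← map_sum, sum_yStd, map_zero]

theorem sum_ycoord (v : DoubledStd n) : ∑ i, ycoord i v = 0 := sum_std v.2

theorem doubledStd_ext {v w : DoubledStd n} (h1 : ∀ i, xcoord i v = xcoord i w)
    (h2 : ∀ i, ycoord i v = ycoord i w) : v = w := by
  refine Prod.ext ?_ (Subtype.ext (funext h2))
  refine LinearMap.ext fun y => ?_
  rw [← sum_smul_yStd y, map_sum, map_sum]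
  refine Finset.sum_congr rfl fun i _ => ?_
  rw [map_smul, map_smul]
  exact congrArg _ (h1 i)

/-- The x̄_i and the ȳ_i are linearly dependent, but since coordinates sum to zero the constants 1/n
cancel and the naive expansion is still valid. -/
theorem sum_coords (v : DoubledStd n) :
    ∑ i, (xcoord i v • xbar i + ycoord i v • ybar i) = v := by
  apply doubledStd_ext
  · intro j
    simp [map_sum, mul_sub, Finset.sum_sub_distrib, ← Finset.sum_mul, sum_xcoord]
  · intro j
    simp [map_sum, mul_sub, Finset.sum_sub_distrib, ← Finset.sum_mul, sum_ycoord]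

@[simp] theorem ycoord_smul (σ : Perm (Fin n)) (v : DoubledStd n) (i : Fin n) :
    ycoord i (σ • v) = ycoord (σ⁻¹ i) v := rfl

theorem stdRep_yStd (σ : Perm (Fin n)) (i : Fin n) : stdRep n σ (yStd i) = yStd (σ i) := by
  ext j
  change (yStd i : Fin n → ℂ) (σ⁻¹ j) = _
  rw [yStd_apply, yStd_apply]
  simp only [Perm.inv_eq_iff_eq]

@[simp] theorem xcoord_smul (σ : Perm (Fin n)) (v : DoubledStd n) (i : Fin n) :
    xcoord i (σ • v) = xcoord (σ⁻¹ i) v := by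
  change v.1 (stdRep n σ⁻¹ (yStd i)) = _
  rw [stdRep_yStd]
  rfl

@[simp] theorem smul_xbar (σ : Perm (Fin n)) (i : Fin n) : σ • xbar i = xbar (σ i) := by
  apply doubledStd_ext <;> intro j
  · simp [Equiv.eq_symm_apply]
  · simp

@[simp] theorem smul_ybar (σ : Perm (Fin n)) (i : Fin n) : σ • ybar i = ybar (σ i) := by
  apply doubledStd_ext <;> intro j
  · simp
  · simp [Equiv.eq_symm_apply]

/-- A transposition is a reflection in each of the two summands, so its displacements span a plane.
-/
theorem sub_swap_smul (i k : Fin n) (v : DoubledStd n) :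
    v - swap i k • v = (xcoord i v - xcoord k v) • (xbar i - xbar k)
      + (ycoord i v - ycoord k v) • (ybar i - ybar k) := by
  apply doubledStd_ext <;> intro j
  · simp only [map_sub, xcoord_smul, map_add, map_smul, xcoord_xbar, xcoord_ybar, swap_inv,
      smul_eq_mul, sub_self, mul_zero, add_zero, sub_sub_sub_cancel_right]
    rcases eq_or_ne j i with rfl | hi
    · rcases eq_or_ne k j with rfl | hk <;> simp [*]
    · rcases eq_or_ne j k with rfl | hk
      · simp [hi.symm]
      · simp [swap_apply_of_ne_of_ne hi hk, hi.symm, hk.symm]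
  · simp only [map_sub, ycoord_smul, map_add, map_smul, ycoord_xbar, ycoord_ybar, swap_inv,
      smul_eq_mul, sub_self, mul_zero, zero_add, sub_sub_sub_cancel_right]
    rcases eq_or_ne j i with rfl | hi
    · rcases eq_or_ne k j with rfl | hk <;> simp [*]
    · rcases eq_or_ne j k with rfl | hk
      · simp [hi.symm]
      · simp [swap_apply_of_ne_of_ne hi hk, hi.symm, hk.symm]

instance : FiniteDimensional ℂ (DoubledStd n) :=
  inferInstanceAs (FiniteDimensional ℂ (Module.Dual ℂ (Std n) × Std n))

/-! ### Alternating forms in two variables -/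

/-- The alternating form `(v, w) ↦ α(v) β(w) - β(v) α(w)`. -/
def wedge {V : Type*} [AddCommGroup V] [Module ℂ V] (α β : V →ₗ[ℂ] ℂ) : V [⋀^Fin 2]→ₗ[ℂ] ℂ where
  toFun v := α (v 0) * β (v 1) - β (v 0) * α (v 1)
  map_update_add' {_} v i x y := by
    fin_cases i <;> simp <;> ring
  map_update_smul' {_} v i c x := by
    fin_cases i <;> simp <;> ring
  map_eq_zero_of_eq' v i j h hij := by
    have : v 0 = v 1 := by
      fin_cases i <;> fin_cases j <;> simp_all
    rw [this]
    ring

theorem wedge_apply {V : Type*} [AddCommGroup V] [Module ℂ V] (α β : V →ₗ[ℂ] ℂ) (v : Fin 2 → V) :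
    wedge α β v = α (v 0) * β (v 1) - β (v 0) * α (v 1) := rfl

/-- An alternating map in two variables, as a bilinear map. -/
def toBilin {V M : Type*} [AddCommGroup V] [Module ℂ V] [AddCommGroup M] [Module ℂ M]
    (F : V [⋀^Fin 2]→ₗ[ℂ] M) : V →ₗ[ℂ] V →ₗ[ℂ] M :=
  LinearMap.mk₂ ℂ (fun v w => F ![v, w])
    (fun v v' w => congrArg (fun f => f ![w]) (F.curryLeft.map_add v v'))
    (fun c v w => congrArg (fun f => f ![w]) (F.curryLeft.map_smul c v))
    (fun v w w' => congrArg (fun f => f ![]) ((F.curryLeft v).curryLeft.map_add w w'))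
    (fun c v w => congrArg (fun f => f ![]) ((F.curryLeft v).curryLeft.map_smul c w))

theorem toBilin_apply {V M : Type*} [AddCommGroup V] [Module ℂ V] [AddCommGroup M] [Module ℂ M]
    (F : V [⋀^Fin 2]→ₗ[ℂ] M) (v w : V) : toBilin F v w = F ![v, w] := rfl

theorem alternating_swap {V M : Type*} [AddCommGroup V] [Module ℂ V] [AddCommGroup M] [Module ℂ M]
    (F : V [⋀^Fin 2]→ₗ[ℂ] M) (v w : V) : F ![w, v] = - F ![v, w] := by
  have := F.map_swap ![v, w] (i := 0) (j := 1) (by decide)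
  rw [← this]
  congr 1
  ext i
  fin_cases i <;> rfl

theorem alternating_self {V M : Type*} [AddCommGroup V] [Module ℂ V] [AddCommGroup M] [Module ℂ M]
    (F : V [⋀^Fin 2]→ₗ[ℂ] M) (v : V) : F ![v, v] = 0 :=
  F.map_eq_zero_of_eq ![v, v] (i := 0) (j := 1) rfl (by decide)

theorem span_bars : Submodule.span ℂ (Set.range (Sum.elim xbar ybar : Fin n ⊕ Fin n → DoubledStd n))
    = ⊤ := by
  rw [eq_top_iff]
  rintro v -
  rw [← sum_coords v]
  exact sum_mem fun i _ => add_mem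
    (Submodule.smul_mem _ _ (Submodule.subset_span ⟨Sum.inl i, rfl⟩))
    (Submodule.smul_mem _ _ (Submodule.subset_span ⟨Sum.inr i, rfl⟩))

theorem alternating_eq_of_bars {M : Type*} [AddCommGroup M] [Module ℂ M]
    {F F' : DoubledStd n [⋀^Fin 2]→ₗ[ℂ] M}
    (hxx : ∀ i j, i ≠ j → F ![xbar i, xbar j] = F' ![xbar i, xbar j])
    (hyy : ∀ i j, i ≠ j → F ![ybar i, ybar j] = F' ![ybar i, ybar j])
    (hxy : ∀ i j, F ![xbar i, ybar j] = F' ![xbar i, ybar j]) : F = F' := by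
  have h : toBilin F = toBilin F' := by
    refine LinearMap.ext_on_range span_bars fun i => ?_
    refine LinearMap.ext_on_range span_bars fun j => ?_
    rw [toBilin_apply, toBilin_apply]
    rcases i with i | i <;> rcases j with j | j
    · rcases eq_or_ne i j with rfl | h
      · rw [alternating_self, alternating_self]
      · exact hxx i j h
    · exact hxy i j
    · rw [alternating_swap, alternating_swap F']
      exact congrArg _ (hxy j i)
    · rcases eq_or_ne i j with rfl | h
      · rw [alternating_self, alternating_self]
      · exact hyy i j h
  ext v
  have hv : v = ![v 0, v 1] := by ext i; fin_cases i <;> rfl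
  rw [hv]
  exact congrArg (fun f => f (v 0) (v 1)) h

theorem HasValues.unique {a b c : ℂ} {κ κ' : ParameterMap (Perm (Fin n)) (DoubledStd n)}
    (h : HasValues a b c κ) (h' : HasValues a b c κ') : κ = κ' := by
  refine ParameterMap.ext (funext fun g => alternating_eq_of_bars (fun i j hij => ?_)
    (fun i j hij => ?_) fun i j => ?_) (funext fun g => alternating_eq_of_bars (fun i j hij => ?_)
    (fun i j hij => ?_) fun i j => ?_)
  · exact congrFun ((h.lin_xx i j hij).trans (h'.lin_xx i j hij).symm) g
  · exact congrFun ((h.lin_yy i j hij).trans (h'.lin_yy i j hij).symm) g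
  · rcases eq_or_ne i j with rfl | hij
    · exact congrFun ((h.lin_xy_same i).trans (h'.lin_xy_same i).symm) g
    · exact congrFun ((h.lin_xy i j hij).trans (h'.lin_xy i j hij).symm) g
  · exact congrFun ((h.const_xx i j hij).trans (h'.const_xx i j hij).symm) g
  · exact congrFun ((h.const_yy i j hij).trans (h'.const_yy i j hij).symm) g
  · rcases eq_or_ne i j with rfl | hij
    · exact congrFun ((h.const_xy_same i).trans (h'.const_xy_same i).symm) g
    · exact congrFun ((h.const_xy i j hij).trans (h'.const_xy i j hij).symm) g

end Coordinates

/-! ### The explicit form of κ_{a,b,c} -/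

section Explicit

open Equiv

set_option linter.unusedSectionVars false

variable {n : ℕ}

/-- The covector `a ζ_i - b ξ_i`, where `ξ_i`, `ζ_i` are the coordinates on `𝔥*` and `𝔥`. -/
def theta (a b : ℂ) (i : Fin n) : DoubledStd n →ₗ[ℂ] ℂ := a • ycoord i - b • xcoord i

/-- The vector `a (x̄_i + x̄_k) + b (ȳ_i + ȳ_k)`. -/
def pairVec (a b : ℂ) (i k : Fin n) : DoubledStd n :=
  a • (xbar i + xbar k) + b • (ybar i + ybar k)

/-- The alternating form of rank two attached to the transposition `(i k)`. -/
def swapForm (i k : Fin n) : DoubledStd n [⋀^Fin 2]→ₗ[ℂ] ℂ :=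
  wedge (xcoord i - xcoord k) (ycoord i - ycoord k)

/-- The alternating form of rank two attached to the cycle `(i j k)`. -/
def cycleForm (a b : ℂ) (i j k : Fin n) : DoubledStd n [⋀^Fin 2]→ₗ[ℂ] ℂ :=
  wedge (theta a b i - theta a b k) (theta a b j - theta a b k)

/-- The parameter map `κ_{a,b,c}`. -/
def kappa (n : ℕ) (a b c : ℂ) : ParameterMap (Perm (Fin n)) (DoubledStd n) where
  -- The sums run over ordered indices: each transposition occurs twice and each three-cycle three
  -- times, so n/2, c and n²/4 become n/4, c/2 and n²/12. Terms with repeated indices have zero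
  -- form.
  lin g := ∑ i, ∑ k, if g = swap i k then
    (LinearMap.toSpanSingleton ℂ (DoubledStd n)
      ((-((n : ℂ) / 4)) • pairVec a b i k)).compAlternatingMap (swapForm i k) else 0
  const g := (∑ i, ∑ k, if g = swap i k then (c / 2) • swapForm i k else 0)
    + ∑ i, ∑ j, ∑ k, if g = cycle3 i j k then ((n : ℂ) ^ 2 / 12) • cycleForm a b i j k else 0

theorem alternating_sum_apply {ι V M : Type*} [AddCommGroup V] [Module ℂ V] [AddCommGroup M]
    [Module ℂ M] (s : Finset ι) (F : ι → V [⋀^Fin 2]→ₗ[ℂ] M) (v : Fin 2 → V) :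
    (∑ i ∈ s, F i) v = ∑ i ∈ s, F i v := by
  classical
  induction s using Finset.induction_on with
  | empty => simp
  | insert i s hi ih => rw [Finset.sum_insert hi, Finset.sum_insert hi, AlternatingMap.add_apply, ih]

theorem kappa_lin (a b c : ℂ) (v : Fin 2 → DoubledStd n) :
    (fun g => (kappa n a b c).lin g v) = ∑ i, ∑ k, swapForm i k v •
      atElt (swap i k) ((-((n : ℂ) / 4)) • pairVec a b i k) := by
  ext1 g
  simp only [kappa, alternating_sum_apply, Finset.sum_apply]
  refine Finset.sum_congr rfl fun i _ => Finset.sum_congr rfl fun k _ => ?_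
  rw [Pi.smul_apply, atElt, Pi.single_apply]
  split_ifs <;> simp

theorem kappa_const (a b c : ℂ) (v : Fin 2 → DoubledStd n) :
    (fun g => (kappa n a b c).const g v) = (∑ i, ∑ k, swapForm i k v • atElt (swap i k) (c / 2))
      + ∑ i, ∑ j, ∑ k, cycleForm a b i j k v • atElt (cycle3 i j k) ((n : ℂ) ^ 2 / 12) := by
  ext1 g
  have e : (kappa n a b c).const g = (∑ i, ∑ k, if g = swap i k then (c / 2) • swapForm i k else 0)
    + ∑ i, ∑ j, ∑ k, if g = cycle3 i j k then ((n : ℂ) ^ 2 / 12) • cycleForm a b i j k else 0 := rfl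
  rw [e, AlternatingMap.add_apply, Pi.add_apply]
  refine congrArg₂ (· + ·) ?_ ?_
  · rw [alternating_sum_apply, Finset.sum_apply]
    refine Finset.sum_congr rfl fun i _ => ?_
    rw [alternating_sum_apply, Finset.sum_apply]
    refine Finset.sum_congr rfl fun k _ => ?_
    rw [Pi.smul_apply, atElt, Pi.single_apply]
    split_ifs <;> simp [mul_comm]
  · rw [alternating_sum_apply, Finset.sum_apply]
    refine Finset.sum_congr rfl fun i _ => ?_
    rw [alternating_sum_apply, Finset.sum_apply]
    refine Finset.sum_congr rfl fun j _ => ?_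
    rw [alternating_sum_apply, Finset.sum_apply]
    refine Finset.sum_congr rfl fun k _ => ?_
    rw [Pi.smul_apply, atElt, Pi.single_apply]
    split_ifs <;> simp [mul_comm]

variable {M : Type*} [AddCommGroup M] [Module ℂ M]

theorem sum_ite_left (h : Fin n → Fin n → M) (i : Fin n) :
    ∑ k, ∑ l, (if i = k then h k l else 0) = ∑ l, h i l := by
  rw [Finset.sum_comm]; simp

theorem sum_ite_right (h : Fin n → Fin n → M) (i : Fin n) :
    ∑ k, ∑ l, (if i = l then h k l else 0) = ∑ k, h k i := by simp

theorem sum_ite_both (h : Fin n → Fin n → M) (i j : Fin n) :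
    ∑ k, ∑ l, (if i = k then if j = l then h k l else 0 else 0) = h i j := by
  have : ∀ k, ∑ l, (if i = k then if j = l then h k l else 0 else 0)
      = if i = k then h k j else 0 := by
    intro k
    split_ifs <;> simp
  simp [this]

/-- The weight is one exactly on ordered pairs k ≠ l that contain i, and each unordered pair occurs
twice. With `h` a symmetric family, this evaluates the sum of the transposition forms at x̄_i, ȳ_i.
-/
theorem sum_pair_same (h : Fin n → Fin n → M) (hs : ∀ i k, h i k = h k i) (i : Fin n) :
    ∑ k, ∑ l, (((if i = k then (1 : ℂ) else 0) - (if i = l then 1 else 0))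
      * ((if i = k then 1 else 0) - (if i = l then 1 else 0))) • h k l
      = (2 : ℂ) • ∑ k ∈ Finset.univ.filter (fun k => k ≠ i), h i k := by
  -- The last term removes the pair k = l = i, which both indicators count although its weight is
  -- zero.
  have e : ∀ k l, (((if i = k then (1 : ℂ) else 0) - (if i = l then 1 else 0))
      * ((if i = k then 1 else 0) - (if i = l then 1 else 0))) • h k l
      = (if i = k then h k l else 0) + (if i = l then h k l else 0)
        - (2 : ℂ) • (if i = k then if i = l then h k l else 0 else 0) := by
    intro k l
    split_ifs <;> (simp; try module)
  simp only [e, Finset.sum_add_distrib, Finset.sum_sub_distrib, ← Finset.smul_sum]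
  rw [sum_ite_left, sum_ite_right, sum_ite_both, Finset.filter_ne',
    ← Finset.add_sum_erase _ _ (Finset.mem_univ i),
    ← Finset.add_sum_erase _ (fun k => h k i) (Finset.mem_univ i)]
  simp only [hs _ i]
  module

theorem sum_pair_ne (h : Fin n → Fin n → M) (hs : ∀ i k, h i k = h k i) {i j : Fin n}
    (hij : i ≠ j) :
    ∑ k, ∑ l, (((if i = k then (1 : ℂ) else 0) - (if i = l then 1 else 0))
      * ((if j = k then 1 else 0) - (if j = l then 1 else 0))) • h k l
      = (-2 : ℂ) • h i j := by
  have e : ∀ k l, (((if i = k then (1 : ℂ) else 0) - (if i = l then 1 else 0))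
      * ((if j = k then 1 else 0) - (if j = l then 1 else 0))) • h k l
      = - (if i = k then if j = l then h k l else 0 else 0)
        - (if j = k then if i = l then h k l else 0 else 0) := by
    intro k l
    split_ifs <;> simp_all
  simp only [e, Finset.sum_sub_distrib, Finset.sum_neg_distrib]
  rw [sum_ite_both, sum_ite_both, hs j i]
  module

/-- The sum over all triples of the determinants of `(1, η, η')`, weighted by `C`. -/
theorem sum_det_smul (C : Fin n → Fin n → Fin n → M)
    (hC : ∀ i j k, i ≠ j → j ≠ k → i ≠ k → C i j k = C j k i) (η η' : Fin n → ℂ) :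
    ∑ i, ∑ j, ∑ k, ((η i - η k) * (η' j - η' k) - (η j - η k) * (η' i - η' k)) • C i j k
      = (3 : ℂ) • ∑ i, ∑ j ∈ Finset.univ.filter (fun j => i ≠ j), (η i * η' j) •
        ∑ k ∈ Finset.univ.filter (fun k => k ≠ i ∧ k ≠ j), (C i j k - C k j i) := by
  have e : ∀ i j k, ((η i - η k) * (η' j - η' k) - (η j - η k) * (η' i - η' k)) • C i j k
      = (η i * η' j) • C i j k - (η i * η' k) • C i j k - (η k * η' j) • C i j k
        - (η j * η' i) • C i j k + (η j * η' k) • C i j k + (η k * η' i) • C i j k := by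
    intro i j k
    module
  -- Each monomial is relabelled so that η carries i and η' carries j. By cyclic invariance the six
  -- coefficients then become three copies of C i j k and three of -C k j i; for repeated indices
  -- they cancel outright.
  have r2 : ∑ i, ∑ j, ∑ k, (η i * η' k) • C i j k = ∑ i, ∑ j, ∑ k, (η i * η' j) • C i k j :=
    Finset.sum_congr rfl fun i _ => Finset.sum_comm
  have r4 : ∑ i, ∑ j, ∑ k, (η j * η' i) • C i j k = ∑ i, ∑ j, ∑ k, (η i * η' j) • C j i k :=
    Finset.sum_comm
  have r3 : ∑ i, ∑ j, ∑ k, (η k * η' j) • C i j k = ∑ i, ∑ j, ∑ k, (η i * η' j) • C k j i := by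
    calc _ = ∑ j, ∑ i, ∑ k, (η k * η' j) • C i j k := Finset.sum_comm
      _ = ∑ j, ∑ k, ∑ i, (η k * η' j) • C i j k :=
          Finset.sum_congr rfl fun j _ => Finset.sum_comm
      _ = _ := Finset.sum_comm
  have r5 : ∑ i, ∑ j, ∑ k, (η j * η' k) • C i j k = ∑ i, ∑ j, ∑ k, (η i * η' j) • C k i j := by
    calc _ = ∑ j, ∑ i, ∑ k, (η j * η' k) • C i j k := Finset.sum_comm
      _ = _ := Finset.sum_congr rfl fun j _ => Finset.sum_comm
  have r6 : ∑ i, ∑ j, ∑ k, (η k * η' i) • C i j k = ∑ i, ∑ j, ∑ k, (η i * η' j) • C j k i := by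
    calc _ = ∑ i, ∑ k, ∑ j, (η k * η' i) • C i j k :=
          Finset.sum_congr rfl fun i _ => Finset.sum_comm
      _ = _ := Finset.sum_comm
  simp only [e, Finset.sum_add_distrib, Finset.sum_sub_distrib]
  rw [r2, r3, r4, r5, r6]
  simp only [← Finset.sum_sub_distrib, ← Finset.sum_add_distrib]
  rw [Finset.smul_sum]
  refine Finset.sum_congr rfl fun i _ => ?_
  rw [Finset.sum_filter, Finset.smul_sum]
  refine Finset.sum_congr rfl fun j _ => ?_
  split_ifs with hij
  · rw [Finset.sum_filter, Finset.smul_sum, Finset.smul_sum]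
    refine Finset.sum_congr rfl fun k _ => ?_
    rcases eq_or_ne k i with rfl | hki
    · rw [if_neg (by simp)]; module
    rcases eq_or_ne k j with rfl | hkj
    · rw [if_neg (by simp)]; module
    have h1 : C k i j = C i j k := hC k i j hki hij hkj
    have h2 : C j k i = C i j k := (hC i j k hij hkj.symm hki.symm).symm
    have h3 : C i k j = C j i k := (hC j i k hij.symm hki.symm hkj.symm).symm
    have h4 : C k j i = C j i k := hC k j i hkj hij.symm hki
    rw [if_pos ⟨hki, hkj⟩, h1, h2, h3, h4]
    module
  · rw [not_not] at hij
    subst hij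
    rw [smul_zero]
    refine Finset.sum_eq_zero fun k _ => ?_
    module

theorem cycle3_rotate {i j k : Fin n} (hij : i ≠ j) (hjk : j ≠ k) (hik : i ≠ k) :
    cycle3 i j k = cycle3 j k i := by
  rw [cycle3, cycle3]
  ext l
  congr 1
  simp only [Perm.mul_apply, swap_apply_def]
  split_ifs <;> simp_all

theorem triSum_eq_smul (z : ℂ) (i j : Fin n) :
    triSum z i j = ∑ k ∈ Finset.univ.filter (fun k => k ≠ i ∧ k ≠ j),
      (atElt (cycle3 i j k) z - atElt (cycle3 k j i) z) := rfl

theorem smul_triSum (s z : ℂ) (i j : Fin n) : s • triSum z i j = triSum (s * z) i j := by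
  rw [triSum, triSum, Finset.smul_sum]
  refine Finset.sum_congr rfl fun k _ => ?_
  rw [smul_sub, atElt, atElt, ← Pi.single_smul, ← Pi.single_smul]
  rfl

/-- The part of `κ^C` on three-cycles, in terms of the coordinates `θ_i`. -/
theorem sum_cycleForm (a b z : ℂ) (v : Fin 2 → DoubledStd n) (η η' : Fin n → ℂ) (r r' : ℂ)
    (hη : ∀ i, theta a b i (v 0) = η i + r) (hη' : ∀ i, theta a b i (v 1) = η' i + r') :
    ∑ i, ∑ j, ∑ k, cycleForm a b i j k v • atElt (cycle3 i j k) z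
      = ∑ i, ∑ j ∈ Finset.univ.filter (fun j => i ≠ j), triSum (3 * (η i * η' j) * z) i j := by
  have h := sum_det_smul (fun i j k => atElt (cycle3 i j k) z)
    (fun i j k hij hjk hik => by rw [cycle3_rotate hij hjk hik]) η η'
  refine Eq.trans ?_ (h.trans ?_)
  · refine Finset.sum_congr rfl fun i _ => Finset.sum_congr rfl fun j _ =>
      Finset.sum_congr rfl fun k _ => ?_
    rw [cycleForm, wedge_apply]
    simp only [LinearMap.sub_apply, hη, hη', add_sub_add_right_eq_sub]
  · rw [Finset.smul_sum]
    refine Finset.sum_congr rfl fun i _ => ?_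
    rw [Finset.smul_sum]
    refine Finset.sum_congr rfl fun j _ => ?_
    rw [← triSum_eq_smul, smul_smul, smul_triSum]

theorem triSum_zero (i j : Fin n) : triSum 0 i j = 0 := by
  have := smul_triSum 0 0 i j
  rw [zero_smul, zero_mul] at this
  exact this.symm

/-- On a basic vector the θ_k form a multiple of an indicator up to a constant. Only differences of
the θ_k enter the forms, so the constants drop out and a single pair of indices survives. -/
theorem sum_cycleForm_basis (a b z r r' s s' : ℂ) (v : Fin 2 → DoubledStd n) (i j : Fin n)
    (hη : ∀ k, theta a b k (v 0) = (if i = k then s else 0) + r)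
    (hη' : ∀ k, theta a b k (v 1) = (if j = k then s' else 0) + r') :
    ∑ i, ∑ j, ∑ k, cycleForm a b i j k v • atElt (cycle3 i j k) z
      = if i = j then 0 else triSum (3 * (s * s') * z) i j := by
  rw [sum_cycleForm a b z v _ _ r r' hη hη', Finset.sum_eq_single i]
  · rw [Finset.sum_filter, Finset.sum_eq_single j]
    · by_cases h : i = j <;> simp [h]
    · intro k _ hk
      simp [hk.symm, triSum_zero]
    · simp
  · intro k _ hk
    simp [hk.symm, triSum_zero]
  · simp

theorem theta_xbar (a b : ℂ) (i k : Fin n) :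
    theta a b k (xbar i) = (if i = k then -b else 0) + b * (n : ℂ)⁻¹ := by
  simp only [theta, LinearMap.sub_apply, LinearMap.smul_apply, ycoord_xbar, xcoord_xbar,
    smul_eq_mul]
  split_ifs <;> ring

theorem theta_ybar (a b : ℂ) (i k : Fin n) :
    theta a b k (ybar i) = (if i = k then a else 0) + -a * (n : ℂ)⁻¹ := by
  simp only [theta, LinearMap.sub_apply, LinearMap.smul_apply, ycoord_ybar, xcoord_ybar,
    smul_eq_mul]
  split_ifs <;> ring

theorem swapForm_xbar_ybar (i j k l : Fin n) : swapForm k l ![xbar i, ybar j]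
    = ((if i = k then (1 : ℂ) else 0) - (if i = l then 1 else 0))
      * ((if j = k then 1 else 0) - (if j = l then 1 else 0)) := by
  simp [swapForm, wedge_apply]

theorem swapForm_xbar_xbar (i j k l : Fin n) : swapForm k l ![xbar i, xbar j] = 0 := by
  simp [swapForm, wedge_apply]

theorem swapForm_ybar_ybar (i j k l : Fin n) : swapForm k l ![ybar i, ybar j] = 0 := by
  simp [swapForm, wedge_apply]

theorem pairVec_comm (a b : ℂ) (i k : Fin n) : pairVec a b i k = pairVec a b k i := by
  rw [pairVec, pairVec, add_comm (xbar i), add_comm (ybar i)]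

theorem hasValues_kappa (a b c : ℂ) : HasValues a b c (kappa n a b c) where
  lin_xx i j _ := by
    rw [kappa_lin]
    simp only [swapForm_xbar_xbar, zero_smul, Finset.sum_const_zero]
  lin_yy i j _ := by
    rw [kappa_lin]
    simp only [swapForm_ybar_ybar, zero_smul, Finset.sum_const_zero]
  lin_xy_same i := by
    rw [kappa_lin]
    simp only [swapForm_xbar_ybar]
    rw [sum_pair_same (fun k l => atElt (swap k l) ((-((n : ℂ) / 4)) • pairVec a b k l))
      (fun k l => by rw [swap_comm, pairVec_comm]), Finset.smul_sum]
    refine Finset.sum_congr rfl fun k _ => ?_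
    rw [← Pi.single_smul, smul_smul]
    congr 2
    ring
  lin_xy i j hij := by
    rw [kappa_lin]
    simp only [swapForm_xbar_ybar]
    rw [sum_pair_ne (fun k l => atElt (swap k l) ((-((n : ℂ) / 4)) • pairVec a b k l))
      (fun k l => by rw [swap_comm, pairVec_comm]) hij, ← Pi.single_smul, smul_smul]
    congr 2
    ring
  const_xx i j hij := by
    rw [kappa_const]
    simp only [swapForm_xbar_xbar, zero_smul, Finset.sum_const_zero]
    rw [sum_cycleForm_basis a b _ _ _ _ _ ![xbar i, xbar j] i j (theta_xbar a b i)
      (theta_xbar a b j), if_neg hij, zero_add]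
    congr 1
    ring
  const_yy i j hij := by
    rw [kappa_const]
    simp only [swapForm_ybar_ybar, zero_smul, Finset.sum_const_zero]
    rw [sum_cycleForm_basis a b _ _ _ _ _ ![ybar i, ybar j] i j (theta_ybar a b i)
      (theta_ybar a b j), if_neg hij, zero_add]
    congr 1
    ring
  const_xy_same i := by
    rw [kappa_const]
    simp only [swapForm_xbar_ybar]
    rw [sum_pair_same (fun k l => atElt (swap k l) (c / 2)) (fun k l => by rw [swap_comm]),
      sum_cycleForm_basis a b _ _ _ _ _ ![xbar i, ybar i] i i (theta_xbar a b i)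
      (theta_ybar a b i), if_pos rfl, add_zero, Finset.smul_sum]
    refine Finset.sum_congr rfl fun k _ => ?_
    rw [← Pi.single_smul, smul_eq_mul]
    congr 1
    ring
  const_xy i j hij := by
    rw [kappa_const]
    simp only [swapForm_xbar_ybar]
    rw [sum_pair_ne (fun k l => atElt (swap k l) (c / 2)) (fun k l => by rw [swap_comm]) hij,
      sum_cycleForm_basis a b _ _ _ _ _ ![xbar i, ybar j] i j (theta_xbar a b i)
      (theta_ybar a b j), if_neg hij, sub_eq_add_neg, ← neg_one_smul ℂ (triSum _ i j),
      smul_triSum, ← neg_one_smul ℂ (atElt (swap i j) c), ← Pi.single_smul, ← Pi.single_smul,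
      smul_eq_mul, smul_eq_mul]
    congr 2 <;> ring

theorem HasValues.eq_kappa {a b c : ℂ} {κ : ParameterMap (Perm (Fin n)) (DoubledStd n)}
    (h : HasValues a b c κ) : κ = kappa n a b c :=
  h.unique (hasValues_kappa a b c)

end Explicit

/-! ### Dunkl operators -/

section Dunkl

open Equiv

set_option linter.unusedSectionVars false

theorem symmetricAlgebra_eq_zero_of_eval {V : Type*} [AddCommGroup V] [Module ℂ V]
    (p : SymmetricAlgebra ℂ V) (h : ∀ φ : Module.Dual ℂ V, SymmetricAlgebra.lift φ p = 0) :
    p = 0 := by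
  let b := Module.Basis.ofVectorSpace ℂ V
  apply (SymmetricAlgebra.equivMvPolynomial b).injective
  rw [map_zero]
  refine MvPolynomial.funext_set (fun _ => Set.univ) (fun _ => Set.infinite_univ) fun x _ => ?_
  rw [map_zero, ← h (b.constr ℂ x)]
  have e : ((MvPolynomial.aeval x).comp
      (SymmetricAlgebra.equivMvPolynomial b).toAlgHom : SymmetricAlgebra ℂ V →ₐ[ℂ] ℂ)
      = SymmetricAlgebra.lift (b.constr ℂ x) := by
    apply SymmetricAlgebra.algHom_ext
    refine b.ext fun i => ?_
    simp [SymmetricAlgebra.equivMvPolynomial_ι_apply]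
  rw [← e]
  simp

/-- A polynomial that vanishes off finitely many hyperplanes is zero. -/
theorem symmetricAlgebra_eq_zero_of_eval_off {ι V : Type*} [AddCommGroup V] [Module ℂ V]
    (s : Finset ι) (u : ι → V) (hu : ∀ i ∈ s, u i ≠ 0) (p : SymmetricAlgebra ℂ V)
    (h : ∀ φ : Module.Dual ℂ V, (∀ i ∈ s, φ (u i) ≠ 0) → SymmetricAlgebra.lift φ p = 0) :
    p = 0 := by
  -- The product with the equations of the hyperplanes vanishes everywhere, and `S(V)` is a domain.
  have hq : p * ∏ i ∈ s, SymmetricAlgebra.ι ℂ V (u i) = 0 := by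
    refine symmetricAlgebra_eq_zero_of_eval _ fun φ => ?_
    rw [map_mul, map_prod]
    by_cases hφ : ∀ i ∈ s, φ (u i) ≠ 0
    · rw [h φ hφ, zero_mul]
    · push Not at hφ
      obtain ⟨i, hi, h0⟩ := hφ
      rw [Finset.prod_eq_zero hi (by simp [h0]), mul_zero]
  rcases mul_eq_zero.1 hq with h0 | h0
  · exact h0
  · obtain ⟨i, hi, h0⟩ := Finset.prod_eq_zero_iff.1 h0
    exact absurd (ι_symmetricAlgebra_injective (h0.trans (map_zero _).symm)) (hu i hi)

variable {n : ℕ}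

/-- The commutator of two Dunkl operators, as an identity between their coefficients. -/
theorem dunkl_commutator (f : Fin n → Fin n → ℂ) (hd : ∀ i, f i i = 0)
    (hs : ∀ i j, f j i = - f i j) (μ : ℂ)
    (hf : ∀ i j k, i ≠ j → j ≠ k → i ≠ k → f i j * f i k + f i k * f j k - f j k * f i j = μ)
    (P : Perm (Fin n) → ℂ) {i j : Fin n} (hij : i ≠ j) :
    ∑ k, ∑ l, (f i k * f (swap i k j) (swap i k l) * P (swap i k * swap j l)
        - f j l * f (swap j l i) (swap j l k) * P (swap j l * swap i k))
      = μ * ∑ k ∈ Finset.univ.filter (fun k => k ≠ i ∧ k ≠ j),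
        (P (cycle3 i j k) - P (cycle3 k j i)) := by
  -- Disjoint transpositions commute and cancel, equal ones cancel by antisymmetry, and k = i or l =
  -- j contributes nothing. There remain k = j, l = i and k = l, each producing three-cycles;
  -- together they form the left side of `hf`.
  have key : ∀ k l, f i k * f (swap i k j) (swap i k l) * P (swap i k * swap j l)
        - f j l * f (swap j l i) (swap j l k) * P (swap j l * swap i k)
      = (if k = j then if l ≠ i ∧ l ≠ j then
          f i j * f i l * P (cycle3 i j l) - f j l * f i l * P (cycle3 l j i) else 0 else 0)
        + (if l = i then if k ≠ i ∧ k ≠ j then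
          f i k * f j k * P (cycle3 i j k) + f i j * f j k * P (cycle3 k j i) else 0 else 0)
        + (if k = l then if l ≠ i ∧ l ≠ j then
          - (f i l * f i j * P (cycle3 l j i)) - f j l * f i j * P (cycle3 i j l) else 0 else 0) := by
    intro k l
    have c1 : ∀ m, m ≠ i → m ≠ j → swap i m * swap i j = cycle3 i j m := by
      intro m h1 h2
      rw [cycle3_rotate hij h2.symm h1.symm, mul_swap_eq_swap_mul, swap_apply_left,
        swap_apply_of_ne_of_ne hij.symm h2.symm, cycle3, swap_comm m j, swap_comm i m]
    have c4 : ∀ m, m ≠ i → m ≠ j → swap j m * swap i m = cycle3 i j m := by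
      intro m h1 h2
      rw [cycle3_rotate hij h2.symm h1.symm, cycle3, swap_comm m i]
    have c3 : ∀ m, m ≠ i → m ≠ j → swap i m * swap j m = cycle3 m j i := by
      intro m h1 h2
      rw [cycle3_rotate h2 hij.symm h1, cycle3_rotate hij.symm h1.symm h2.symm, cycle3,
        swap_comm m j]
    have c2 : ∀ m, m ≠ i → m ≠ j → swap i j * swap i m = cycle3 m j i := by
      intro m h1 h2
      rw [mul_swap_eq_swap_mul, swap_apply_left, swap_apply_of_ne_of_ne h1 h2, cycle3,
        swap_comm j m, swap_comm i j]
    rcases eq_or_ne k i with rfl | hki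
    · simp [hd, hij]
      exact fun h1 h2 => absurd h1.symm h2
    rcases eq_or_ne l j with rfl | hlj
    · simp [hd, hij.symm]
    rcases eq_or_ne k j with rfl | hkj
    · rcases eq_or_ne l i with rfl | hli
      · simp [hij, hij.symm, swap_comm k l, hs l k]
      · simp only [if_true, if_neg hli, if_neg hlj.symm, if_pos (And.intro hli hlj), add_zero]
        rw [swap_apply_right, swap_apply_of_ne_of_ne hli hlj, swap_apply_left,
          swap_apply_of_ne_of_ne hij hli.symm, cycle3, cycle3, swap_comm l k, swap_comm k i]
    rcases eq_or_ne l i with rfl | hli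
    · simp only [if_neg hkj, if_true, if_neg hki, if_pos (And.intro hki hkj), add_zero, zero_add]
      rw [swap_apply_left, swap_apply_of_ne_of_ne hij.symm hkj.symm, swap_apply_right,
        swap_apply_of_ne_of_ne hkj hki, swap_comm j l, c1 k hki hkj, c2 k hki hkj, hs l j]
      ring
    rcases eq_or_ne k l with rfl | hkl
    · simp only [if_neg hkj, if_true, if_neg hki, if_pos (And.intro hki hkj), zero_add]
      rw [swap_apply_right, swap_apply_of_ne_of_ne hij.symm hkj.symm, swap_apply_right,
        swap_apply_of_ne_of_ne hij hki.symm, c3 k hki hkj, c4 k hki hkj, hs i j]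
      ring
    · simp only [if_neg hkj, if_neg hli, if_neg hkl, zero_add]
      rw [swap_apply_of_ne_of_ne hij.symm hkj.symm, swap_apply_of_ne_of_ne hli hkl.symm,
        swap_apply_of_ne_of_ne hij hli.symm, swap_apply_of_ne_of_ne hkj hkl, mul_swap_eq_swap_mul,
        swap_apply_of_ne_of_ne hij.symm hkj.symm, swap_apply_of_ne_of_ne hli hkl.symm]
      ring
  simp only [key, Finset.sum_add_distrib]
  have e1 : ∀ h : Fin n → ℂ, ∑ k, ∑ l, (if k = j then h l else 0) = ∑ l, h l := by
    intro h
    rw [Finset.sum_comm]; simp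
  have e2 : ∀ h : Fin n → ℂ, ∑ k, ∑ l, (if l = i then h k else 0) = ∑ l, h l := by
    intro h
    simp
  have e3 : ∀ h : Fin n → ℂ, ∑ k, ∑ l, (if k = l then h l else 0) = ∑ l, h l := by
    intro h
    simp
  rw [e1, e2, e3, Finset.sum_filter, Finset.mul_sum, ← Finset.sum_add_distrib,
    ← Finset.sum_add_distrib]
  refine Finset.sum_congr rfl fun k _ => ?_
  split_ifs with hk
  · have h := hf i j k hij hk.2.symm hk.1.symm
    linear_combination (P (cycle3 i j k) - P (cycle3 k j i)) * h
  · simp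

/-- The vector `δ x̄_i - β ȳ_i`. -/
def chiVec (δ β : ℂ) (i : Fin n) : DoubledStd n := δ • xbar i - β • ybar i

/-- The covector `δ ζ_i + β ξ_i`. -/
def etaForm (δ β : ℂ) (i : Fin n) : DoubledStd n →ₗ[ℂ] ℂ := δ • ycoord i + β • xcoord i

theorem smul_chiVec (δ β : ℂ) (g : Perm (Fin n)) (i : Fin n) :
    g • chiVec δ β i = chiVec δ β (g i) := by
  rw [chiVec, smul_sub, smul_comm g, smul_comm g, smul_xbar, smul_ybar, chiVec]

theorem etaForm_smul (δ β : ℂ) (g : Perm (Fin n)) (i : Fin n) (v : DoubledStd n) :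
    etaForm δ β (g i) (g • v) = etaForm δ β i v := by
  simp [etaForm]

/-- The contributions of the two summands cancel. Hence these vectors act by multiplication alone,
and so does the vector part of every value of κ^L, since `pairVec` is proportional to a sum of two
of them. -/
theorem etaForm_chiVec (δ β : ℂ) (i j : Fin n) : etaForm δ β i (chiVec δ β j) = 0 := by
  simp only [etaForm, chiVec, LinearMap.add_apply, LinearMap.smul_apply, map_sub, map_smul,
    xcoord_xbar, xcoord_ybar, ycoord_xbar, ycoord_ybar, smul_eq_mul]
  ring

theorem pairVec_eq (δ β A : ℂ) (i k : Fin n) :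
    pairVec (δ * A) (-β * A) i k = A • (chiVec δ β i + chiVec δ β k) := by
  rw [pairVec, chiVec, chiVec]
  module

theorem theta_eq (δ β A : ℂ) (i : Fin n) (v : DoubledStd n) :
    theta (δ * A) (-β * A) i v = A * etaForm δ β i v := by
  simp only [theta, etaForm, LinearMap.sub_apply, LinearMap.add_apply, LinearMap.smul_apply,
    smul_eq_mul]
  ring

theorem chiVec_ne {δ β : ℂ} (h : δ ≠ 0 ∨ β ≠ 0) {i j : Fin n} (hij : i ≠ j) :
    chiVec δ β i - chiVec δ β j ≠ 0 := by
  intro e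
  have e1 := congrArg (xcoord i) e
  have e2 := congrArg (ycoord i) e
  simp [chiVec, hij.symm] at e1 e2
  rcases h with h | h
  · exact h (by linear_combination e1)
  · exact h (by linear_combination -e2)

/-- The linear forms on `𝔥* ⊕ 𝔥` that take distinct values on the vectors `δ x̄_i - β ȳ_i`. -/
def RegularForm (n : ℕ) (δ β : ℂ) : Type :=
  {φ : Module.Dual ℂ (DoubledStd n) // ∀ i j, i ≠ j → φ (chiVec δ β i) ≠ φ (chiVec δ β j)}

namespace RegularForm

variable {δ β : ℂ}

/-- The value at `δ x̄_i - β ȳ_i`. -/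
def chi (φ : RegularForm n δ β) (i : Fin n) : ℂ := φ.1 (chiVec δ β i)

/-- The form `φ ∘ g`. -/
def act (φ : RegularForm n δ β) (g : Perm (Fin n)) : RegularForm n δ β :=
  ⟨φ.1 ∘ₗ DistribSMul.toLinearMap ℂ (DoubledStd n) g, fun i j hij => by
    simp only [LinearMap.comp_apply, DistribSMul.toLinearMap_apply, smul_chiVec]
    exact φ.2 _ _ (g.injective.ne hij)⟩

theorem act_apply (φ : RegularForm n δ β) (g : Perm (Fin n)) (v : DoubledStd n) :
    (φ.act g).1 v = φ.1 (g • v) := rfl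

theorem act_one (φ : RegularForm n δ β) : φ.act 1 = φ := by
  apply Subtype.ext; ext v
  rw [act_apply, one_smul]

theorem act_act (φ : RegularForm n δ β) (g h : Perm (Fin n)) : (φ.act g).act h = φ.act (g * h) := by
  apply Subtype.ext; ext v
  rw [act_apply, act_apply, act_apply, mul_smul]

theorem chi_act (φ : RegularForm n δ β) (g : Perm (Fin n)) (i : Fin n) :
    (φ.act g).chi i = φ.chi (g i) := by
  rw [chi, act_apply, smul_chiVec, chi]

theorem chi_injective (φ : RegularForm n δ β) : Function.Injective φ.chi := by
  intro i j h
  by_contra hij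
  exact φ.2 i j hij h

/-- The values χ_i are distinct, so a regular form has trivial stabilizer. This separates group
elements in the representation at t = 0. -/
theorem act_injective (φ : RegularForm n δ β) : Function.Injective φ.act := by
  intro g h e
  ext i
  have := congrArg (fun ψ : RegularForm n δ β => ψ.chi i) e
  simp only [chi_act] at this
  rw [φ.chi_injective this]

/-- The coefficient `(p (χ_i + χ_k) + q) / (χ_i - χ_k)`. -/
def coef (p q : ℂ) (φ : RegularForm n δ β) (i k : Fin n) : ℂ :=
  (p * (φ.chi i + φ.chi k) + q) / (φ.chi i - φ.chi k)

theorem coef_self (p q : ℂ) (φ : RegularForm n δ β) (i : Fin n) : φ.coef p q i i = 0 := by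
  simp [coef]

theorem coef_swap (p q : ℂ) (φ : RegularForm n δ β) (i k : Fin n) :
    φ.coef p q k i = - φ.coef p q i k := by
  rw [coef, coef, ← div_neg, neg_sub, add_comm (φ.chi k)]

theorem coef_act (p q : ℂ) (φ : RegularForm n δ β) (g : Perm (Fin n)) (i k : Fin n) :
    (φ.act g).coef p q i k = φ.coef p q (g i) (g k) := by
  simp only [coef, chi_act]

theorem coef_mul (p q : ℂ) (φ : RegularForm n δ β) {i k : Fin n} (h : i ≠ k) :
    φ.coef p q i k * (φ.chi i - φ.chi k) = p * (φ.chi i + φ.chi k) + q :=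
  div_mul_cancel₀ _ (sub_ne_zero.2 (φ.chi_injective.ne h))

/-- For p = 1, q = 0 this is the addition formula of the hyperbolic cotangent in the variables (log
χ_i)/2; for p = 0 it is the identity behind commuting rational Dunkl operators. The mixed terms in
pq cancel. -/
theorem coef_identity (p q : ℂ) (φ : RegularForm n δ β) {i j k : Fin n} (hij : i ≠ j)
    (hjk : j ≠ k) (hik : i ≠ k) :
    φ.coef p q i j * φ.coef p q i k + φ.coef p q i k * φ.coef p q j k
      - φ.coef p q j k * φ.coef p q i j = p ^ 2 := by
  have h1 := sub_ne_zero.2 (φ.chi_injective.ne hij)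
  have h2 := sub_ne_zero.2 (φ.chi_injective.ne hjk)
  have h3 := sub_ne_zero.2 (φ.chi_injective.ne hik)
  simp only [coef]
  field_simp
  ring

/-- The action of `S_n` on functions of regular forms. -/
def permute : Perm (Fin n) →* Module.End ℂ (RegularForm n δ β → ℂ) where
  toFun g := { toFun := fun F φ => F (φ.act g), map_add' := fun _ _ => rfl,
               map_smul' := fun _ _ => rfl }
  map_one' := by
    ext F φ
    change F (φ.act 1) = F φ
    rw [act_one]
  map_mul' g h := by
    ext F φ
    change F (φ.act (g * h)) = F ((φ.act g).act h)
    rw [act_act]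

theorem permute_apply (g : Perm (Fin n)) (F : RegularForm n δ β → ℂ) (φ : RegularForm n δ β) :
    permute g F φ = F (φ.act g) := rfl

/-- Multiplication by a linear function, plus a Dunkl operator. -/
def dunkl (p q : ℂ) : DoubledStd n →ₗ[ℂ] Module.End ℂ (RegularForm n δ β → ℂ) :=
  LinearMap.mk₂ ℂ (fun v F φ => φ.1 v * F φ + ∑ i, etaForm δ β i v *
      ∑ k, φ.coef p q i k * F (φ.act (swap i k)))
    (fun v w F => by
      ext φ
      simp only [map_add, add_mul, Finset.sum_add_distrib, Pi.add_apply]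
      ring)
    (fun c v F => by
      ext φ
      simp only [map_smul, smul_eq_mul, Pi.smul_apply, mul_add, Finset.mul_sum, mul_assoc])
    (fun v F F' => by
      ext φ
      simp only [Pi.add_apply, mul_add, Finset.sum_add_distrib]
      ring)
    (fun c v F => by
      ext φ
      simp only [smul_eq_mul, Pi.smul_apply, mul_add, Finset.mul_sum, mul_left_comm _ c])

theorem dunkl_apply (p q : ℂ) (v : DoubledStd n) (F : RegularForm n δ β → ℂ)
    (φ : RegularForm n δ β) : dunkl p q v F φ = φ.1 v * F φ + ∑ i, etaForm δ β i v *
      ∑ k, φ.coef p q i k * F (φ.act (swap i k)) := rfl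

theorem dunkl_smul (p q : ℂ) (g : Perm (Fin n)) (v : DoubledStd n) :
    dunkl p q (g • v) * permute g = permute g * (dunkl p q v :
      Module.End ℂ (RegularForm n δ β → ℂ)) := by
  ext F φ
  change dunkl p q (g • v) (permute g F) φ = dunkl p q v F (φ.act g)
  rw [dunkl_apply, dunkl_apply, act_apply, permute_apply, ← Equiv.sum_comp g]
  refine congrArg _ (Finset.sum_congr rfl fun i _ => ?_)
  rw [etaForm_smul, ← Equiv.sum_comp g]
  refine congrArg _ (Finset.sum_congr rfl fun k _ => ?_)
  rw [permute_apply, act_act, act_act, coef_act, mul_swap_eq_swap_mul]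

theorem dunkl_chiVec (p q : ℂ) (i k : Fin n) (A : ℂ) (F : RegularForm n δ β → ℂ)
    (φ : RegularForm n δ β) : dunkl p q (A • (chiVec δ β i + chiVec δ β k)) F φ
      = A * (φ.chi i + φ.chi k) * F φ := by
  rw [dunkl_apply]
  simp only [map_smul, map_add, etaForm_chiVec, chi]
  simp

/-- Adding the terms of (i, k) and (k, i), antisymmetry of the coefficient replaces η_i by η_i -
η_k. As v - (i k) v lies in a plane, the bracket becomes the form of (i k) times χ_i - χ_k, which
cancels the denominator. -/
theorem dunkl_cross (p q : ℂ) (v w : DoubledStd n) (F : RegularForm n δ β → ℂ)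
    (φ : RegularForm n δ β) :
    ∑ i, ∑ k, φ.coef p q i k * F (φ.act (swap i k)) *
        (etaForm δ β i w * φ.1 (v - swap i k • v) - etaForm δ β i v * φ.1 (w - swap i k • w))
      = ∑ i, ∑ k, swapForm i k ![v, w] * ((p * (φ.chi i + φ.chi k) + q) / 2)
        * F (φ.act (swap i k)) := by
  have h : ∀ i k, φ.coef p q i k * F (φ.act (swap i k)) *
        (etaForm δ β i w * φ.1 (v - swap i k • v) - etaForm δ β i v * φ.1 (w - swap i k • w))
      + φ.coef p q k i * F (φ.act (swap k i)) *
        (etaForm δ β k w * φ.1 (v - swap k i • v) - etaForm δ β k v * φ.1 (w - swap k i • w))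
      = 2 * (swapForm i k ![v, w] * ((p * (φ.chi i + φ.chi k) + q) / 2)
        * F (φ.act (swap i k))) := by
    intro i k
    rcases eq_or_ne i k with rfl | hik
    · simp [coef_self, swapForm, wedge_apply]
    · have e := φ.coef_mul p q hik
      rw [← e, φ.coef_swap p q i k, swap_comm k i, sub_swap_smul, sub_swap_smul]
      simp only [chi, chiVec, etaForm, swapForm, wedge_apply, map_add, map_sub, map_smul,
        LinearMap.add_apply, LinearMap.sub_apply, LinearMap.smul_apply, smul_eq_mul,
        Matrix.cons_val_zero, Matrix.cons_val_one]
      ring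
  have h2 := Finset.sum_congr (rfl : (Finset.univ : Finset (Fin n)) = Finset.univ) fun i _ =>
    Finset.sum_congr (rfl : (Finset.univ : Finset (Fin n)) = Finset.univ) fun k _ => h i k
  simp only [Finset.sum_add_distrib, ← Finset.mul_sum] at h2
  rw [Finset.sum_comm (f := fun i k => φ.coef p q k i * F (φ.act (swap k i)) *
        (etaForm δ β k w * φ.1 (v - swap k i • v) - etaForm δ β k v * φ.1 (w - swap k i • w))),
    ← two_mul] at h2
  exact mul_left_cancel₀ two_ne_zero h2

/-- For i = j the summand is antisymmetric under exchange of k and l and vanishes. For i ≠ j the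
commutator of the two Dunkl operators is p² times a difference of three-cycles, and these combine
into determinants. -/
theorem dunkl_quadratic (p q : ℂ) (η η' : Fin n → ℂ) (F : RegularForm n δ β → ℂ)
    (φ : RegularForm n δ β) :
    ∑ i, ∑ j, η i * η' j * ∑ k, ∑ l,
      (φ.coef p q i k * φ.coef p q (swap i k j) (swap i k l) * F (φ.act (swap i k * swap j l))
        - φ.coef p q j l * φ.coef p q (swap j l i) (swap j l k)
          * F (φ.act (swap j l * swap i k)))
      = p ^ 2 / 3 * ∑ i, ∑ j, ∑ k,
        ((η i - η k) * (η' j - η' k) - (η j - η k) * (η' i - η' k)) * F (φ.act (cycle3 i j k)) := by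
  have h := sum_det_smul (fun i j k => F (φ.act (cycle3 i j k)))
    (fun i j k hij hjk hik => by rw [cycle3_rotate hij hjk hik]) η η'
  simp only [smul_eq_mul] at h
  rw [h, ← mul_assoc, div_mul_cancel₀ _ (by norm_num : (3 : ℂ) ≠ 0), Finset.mul_sum]
  refine Finset.sum_congr rfl fun i _ => ?_
  rw [Finset.sum_filter, Finset.mul_sum]
  refine Finset.sum_congr rfl fun j _ => ?_
  split_ifs with hij
  · rw [dunkl_commutator (φ.coef p q) (φ.coef_self p q) (φ.coef_swap p q) (p ^ 2)
      (fun i j k => φ.coef_identity p q) (fun g => F (φ.act g)) hij]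
    ring
  · rw [not_not] at hij
    subst hij
    simp only [Finset.sum_sub_distrib]
    rw [Finset.sum_comm, sub_self, mul_zero, mul_zero]

/-- The multiplications commute with each other. The mixed products give the transpositions, and the
products of two Dunkl parts give the three-cycles. -/
theorem dunkl_commutator_apply (p q : ℂ) (v w : DoubledStd n) (F : RegularForm n δ β → ℂ)
    (φ : RegularForm n δ β) :
    dunkl p q v (dunkl p q w F) φ - dunkl p q w (dunkl p q v F) φ
      = (∑ i, ∑ k, swapForm i k ![v, w] * ((p * (φ.chi i + φ.chi k) + q) / 2)
          * F (φ.act (swap i k)))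
        + p ^ 2 / 3 * ∑ i, ∑ j, ∑ k, wedge (etaForm δ β i - etaForm δ β k)
          (etaForm δ β j - etaForm δ β k) ![v, w] * F (φ.act (cycle3 i j k)) := by
  rw [← dunkl_cross]
  have hq := dunkl_quadratic p q (fun i => etaForm δ β i v) (fun i => etaForm δ β i w) F φ
  have he : ∀ i j k, wedge (etaForm δ β i - etaForm δ β k) (etaForm δ β j - etaForm δ β k) ![v, w]
    = (etaForm δ β i v - etaForm δ β k v) * (etaForm δ β j w - etaForm δ β k w)
      - (etaForm δ β j v - etaForm δ β k v) * (etaForm δ β i w - etaForm δ β k w) := fun _ _ _ => rfl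
  simp only [he]
  rw [← hq]
  have hA : ∀ v w, dunkl p q v (dunkl p q w F) φ = φ.1 v * (φ.1 w * F φ)
      + ∑ i, ∑ k, φ.coef p q i k * F (φ.act (swap i k)) *
        (etaForm δ β i w * φ.1 v + etaForm δ β i v * φ.1 (swap i k • w))
      + ∑ i, ∑ j, etaForm δ β i v * etaForm δ β j w * ∑ k, ∑ l,
        φ.coef p q i k * φ.coef p q (swap i k j) (swap i k l)
          * F (φ.act (swap i k * swap j l)) := by
    intro v w
    simp only [dunkl_apply, act_apply, coef_act, act_act, mul_add, Finset.sum_add_distrib,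
      Finset.mul_sum]
    rw [add_assoc, add_assoc, add_assoc]
    refine congrArg₂ (· + ·) rfl (congrArg₂ (· + ·) ?_ (congrArg₂ (· + ·) ?_ ?_))
    · refine Finset.sum_congr rfl fun i _ => Finset.sum_congr rfl fun k _ => ?_
      ring
    · refine Finset.sum_congr rfl fun i _ => Finset.sum_congr rfl fun k _ => ?_
      ring
    · refine Finset.sum_congr rfl fun i _ => ?_
      rw [Finset.sum_comm]
      refine Finset.sum_congr rfl fun j _ => Finset.sum_congr rfl fun k _ =>
        Finset.sum_congr rfl fun l _ => ?_
      ring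
  rw [hA v w, hA w v]
  rw [Finset.sum_comm (f := fun i j => etaForm δ β i w * etaForm δ β j v * ∑ k, ∑ l,
        φ.coef p q i k * φ.coef p q (swap i k j) (swap i k l)
          * F (φ.act (swap i k * swap j l)))]
  have e2 : ∀ a b c a' b' c' B C : ℂ, a = a' → b - b' = B → c - c' = C →
      (a + b + c) - (a' + b' + c') = B + C := by
    rintro a b c a' b' c' B C rfl rfl rfl; ring
  refine e2 _ _ _ _ _ _ _ _ (by ring) ?_ ?_
  · rw [← Finset.sum_sub_distrib]
    refine Finset.sum_congr rfl fun i _ => ?_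
    rw [← Finset.sum_sub_distrib]
    refine Finset.sum_congr rfl fun k _ => ?_
    rw [map_sub, map_sub]
    ring
  · rw [← Finset.sum_sub_distrib]
    refine Finset.sum_congr rfl fun i _ => ?_
    rw [← Finset.sum_sub_distrib]
    refine Finset.sum_congr rfl fun j _ => ?_
    simp only [Finset.sum_sub_distrib, mul_sub]
    rw [mul_comm (etaForm δ β j w)]
    refine congrArg₂ (· - ·) rfl (congrArg _ ?_)
    exact Finset.sum_comm

end RegularForm

end Dunkl

/-! ### The Dunkl representations as a family in t -/

section DunklFamily

open Equiv RegularForm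

set_option linter.unusedSectionVars false

variable {n : ℕ} {δ β : ℂ}

namespace RegularForm

/-- The representation of `T(V) # S_n` by Dunkl operators. -/
def dunklRep (δ β p q : ℂ) : TensorSkew (Perm (Fin n)) (DoubledStd n) →ₐ[ℂ]
    Module.End ℂ (RegularForm n δ β → ℂ) :=
  skewLift (dunkl p q) permute (dunkl_smul p q)

theorem dunklRep_linElt (p q A : ℂ) (v : Fin 2 → DoubledStd n) (F : RegularForm n δ β → ℂ)
    (φ : RegularForm n δ β) (s : ℂ) :
    dunklRep δ β p q (linElt (∑ i, ∑ k, swapForm i k v •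
      atElt (swap i k) (s • pairVec (δ * A) (-β * A) i k))) F φ
      = ∑ i, ∑ k, swapForm i k v * (s * A * (φ.chi i + φ.chi k)) * F (φ.act (swap i k)) := by
  have h : ∀ (g : Perm (Fin n)) (u : DoubledStd n),
      linElt (atElt g u) = SkewMonoidAlgebra.single g (TensorAlgebra.ι ℂ u) := by
    intro g u
    rw [linElt, Finset.sum_eq_single g]
    · rw [atElt, Pi.single_eq_same]
    · intro k _ hk
      rw [atElt, Pi.single_eq_of_ne hk, map_zero, SkewMonoidAlgebra.single_zero]
    · simp
  simp only [linElt_sum, linElt_smul, h, map_sum, map_smul, LinearMap.sum_apply, Finset.sum_apply,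
    LinearMap.smul_apply, Pi.smul_apply, smul_eq_mul]
  refine Finset.sum_congr rfl fun i _ => Finset.sum_congr rfl fun k _ => ?_
  rw [dunklRep, skewLift_single, ← map_smul, TensorAlgebra.lift_ι_apply, Module.End.mul_apply,
    pairVec_eq,
    smul_smul, dunkl_chiVec, permute_apply]
  ring

theorem constElt_atElt (g : Perm (Fin n)) (z : ℂ) :
    (constElt (atElt g z) : TensorSkew (Perm (Fin n)) (DoubledStd n))
      = z • SkewMonoidAlgebra.single g 1 := by
  rw [constElt, Finset.sum_eq_single g]
  · rw [atElt, Pi.single_eq_same, SkewMonoidAlgebra.smul_single, Algebra.algebraMap_eq_smul_one]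
  · intro k _ hk
    rw [atElt, Pi.single_eq_of_ne hk, map_zero, SkewMonoidAlgebra.single_zero]
  · simp

theorem dunklRep_atElt (p q z : ℂ) (g : Perm (Fin n)) (F : RegularForm n δ β → ℂ)
    (φ : RegularForm n δ β) :
    dunklRep δ β p q (constElt (atElt g z)) F φ = z * F (φ.act g) := by
  rw [constElt_atElt, map_smul, dunklRep, skewLift_single, map_one, one_mul]
  rfl

theorem dunklRep_continuous {p q : ℂ → ℂ} (hp : Continuous p) (hq : Continuous q)
    (z : TensorSkew (Perm (Fin n)) (DoubledStd n)) (F : RegularForm n δ β → ℂ)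
    (φ : RegularForm n δ β) : Continuous fun t => dunklRep δ β (p t) (q t) z F φ := by
  -- The argument F may itself vary with t: in a product, the left factor is applied to the output
  -- of the right factor.
  have key : ∀ (a : TensorAlgebra ℂ (DoubledStd n)) (F : ℂ → RegularForm n δ β → ℂ),
      (∀ φ, Continuous fun t => F t φ) →
        ∀ φ, Continuous fun t => TensorAlgebra.lift ℂ (dunkl (p t) (q t)) a (F t) φ := by
    intro a
    induction a using TensorAlgebra.induction with
    | algebraMap r =>
      intro F hF φ
      simp only [AlgHom.commutes, Module.algebraMap_end_apply, Pi.smul_apply]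
      exact (hF φ).const_smul r
    | ι v =>
      intro F hF φ
      simp only [TensorAlgebra.lift_ι_apply, dunkl_apply, coef]
      refine ((hF φ).const_mul _).add (continuous_finsetSum _ fun i _ => Continuous.const_mul
        (continuous_finsetSum _ fun k _ => Continuous.mul ?_ (hF _)) _)
      exact ((hp.mul_const _).add hq).div_const _
    | mul a b ha hb =>
      intro F hF φ
      simp only [map_mul, Module.End.mul_apply]
      exact ha _ (hb F hF) φ
    | add a b ha hb =>
      intro F hF φ
      simp only [map_add, LinearMap.add_apply, Pi.add_apply]
      exact (ha F hF φ).add (hb F hF φ)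
  induction z using SkewMonoidAlgebra.induction_on with
  | zero => simpa using continuous_const
  | add x y hx hy =>
    simp only [map_add, LinearMap.add_apply, Pi.add_apply]
    exact hx.add hy
  | single g a =>
    simp only [dunklRep, skewLift_single, Module.End.mul_apply]
    exact key a (fun _ => permute g F) (fun _ => continuous_const) φ

theorem lift_dunkl_zero (a : TensorAlgebra ℂ (DoubledStd n)) (F : RegularForm n δ β → ℂ)
    (φ : RegularForm n δ β) : TensorAlgebra.lift ℂ (dunkl 0 0) a F φ
      = SymmetricAlgebra.lift φ.1 (SymmetricAlgebra.algHom ℂ _ a) * F φ := by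
  induction a using TensorAlgebra.induction generalizing F with
  | algebraMap r => simp [Module.algebraMap_end_apply]
  | ι v =>
    rw [algHom_ι, SymmetricAlgebra.lift_ι_apply]
    simp [dunkl_apply, coef]
  | mul a b ha hb => rw [map_mul, Module.End.mul_apply, ha, hb, map_mul, map_mul, mul_assoc]
  | add a b ha hb =>
    rw [map_add, LinearMap.add_apply, Pi.add_apply, ha, hb, map_add, map_add, add_mul]

theorem dunklRep_zero (z : TensorSkew (Perm (Fin n)) (DoubledStd n)) (F : RegularForm n δ β → ℂ)
    (φ : RegularForm n δ β) : dunklRep δ β 0 0 z F φ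
      = ∑ g, SymmetricAlgebra.lift φ.1 ((symProj _ _ z).coeff g) * F (φ.act g) := by
  induction z using SkewMonoidAlgebra.induction_on with
  | zero => simp
  | add x y hx hy =>
    rw [map_add, LinearMap.add_apply, Pi.add_apply, hx, hy, map_add, ← Finset.sum_add_distrib]
    refine Finset.sum_congr rfl fun g _ => ?_
    rw [SkewMonoidAlgebra.coeff_add, Finsupp.add_apply, map_add, add_mul]
  | single g a =>
    rw [dunklRep, skewLift_single, Module.End.mul_apply, lift_dunkl_zero, permute_apply,
      symProj_single, Finset.sum_eq_single g]
    · simp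
    · intro h _ hh
      simp [hh.symm]
    · simp

/-- Applied to the indicator of the form ψ ∘ g and evaluated at ψ, the operator returns the
coefficient of g at ψ, because the orbit of ψ is free. So every coefficient is a polynomial
vanishing off finitely many hyperplanes. -/
theorem dunklRep_faithful (h : δ ≠ 0 ∨ β ≠ 0) (z : TensorSkew (Perm (Fin n)) (DoubledStd n))
    (hz : dunklRep δ β 0 0 z = 0) : symProj _ _ z = 0 := by
  classical
  apply SkewMonoidAlgebra.coeff_injective
  ext g
  rw [SkewMonoidAlgebra.coeff_zero, Finsupp.zero_apply]
  refine symmetricAlgebra_eq_zero_of_eval_off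
    (Finset.univ.filter fun p : Fin n × Fin n => p.1 ≠ p.2)
    (fun p => chiVec δ β p.1 - chiVec δ β p.2) (fun p hp => chiVec_ne h (Finset.mem_filter.1 hp).2)
    _ fun φ hφ => ?_
  let ψ : RegularForm n δ β := ⟨φ, fun i j hij e => hφ (i, j) (Finset.mem_filter.2
    ⟨Finset.mem_univ _, hij⟩) (by rw [map_sub, e, sub_self])⟩
  have h0 := dunklRep_zero z (fun χ => if χ = ψ.act g then 1 else 0) ψ
  rw [hz, Finset.sum_eq_single g] at h0
  · simpa using h0.symm
  · intro k _ hk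
    rw [if_neg (fun e => hk (ψ.act_injective e)), mul_zero]
  · simp

/-- The family of Dunkl representations that belongs to `κ_{a,b,c}`. -/
def dunklFamily (h : δ ≠ 0 ∨ β ≠ 0) (A c : ℂ) :
    RepFamily (kappa n (δ * A) (-β * A) c) (RegularForm n δ β) where
  -- With p = -tnA/2 and q = t²c, p/2 and q/2 are the factors -tnA/4 and t²c/2 of the
  -- transpositions, and p²/3 = t²n²A²/12 is that of the three-cycles.
  rep t := dunklRep δ β (t * (-((n : ℂ) * A / 2))) (t ^ 2 * c)
  rel t v w := by
    ext F φ
    rw [map_sub, map_mul, map_mul, linValue_eq, constValue_eq, kappa_lin, kappa_const, constElt_add]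
    simp only [LinearMap.sub_apply, LinearMap.add_apply, LinearMap.smul_apply, Pi.sub_apply,
      Pi.add_apply, Pi.smul_apply, map_add]
    rw [dunklRep_linElt]
    simp only [constElt_sum, constElt_smul, map_sum, map_smul, LinearMap.sum_apply,
      Finset.sum_apply, LinearMap.smul_apply, Pi.smul_apply, dunklRep_atElt, smul_eq_mul]
    have hv : ∀ v : DoubledStd n, dunklRep δ β (t * (-((n : ℂ) * A / 2))) (t ^ 2 * c) (vec v)
      = dunkl (δ := δ) (β := β) (t * (-((n : ℂ) * A / 2))) (t ^ 2 * c) v := fun v => skewLift_vec _ _ _ v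
    rw [hv, hv, Module.End.mul_apply, Module.End.mul_apply, dunkl_commutator_apply, mul_add,
      ← add_assoc]
    refine congrArg₂ (· + ·) ?_ ?_
    · simp only [Finset.mul_sum]
      rw [← Finset.sum_add_distrib]
      refine Finset.sum_congr rfl fun i _ => ?_
      rw [← Finset.sum_add_distrib]
      refine Finset.sum_congr rfl fun k _ => ?_
      ring
    · simp only [Finset.mul_sum]
      refine Finset.sum_congr rfl fun i _ => Finset.sum_congr rfl fun j _ =>
        Finset.sum_congr rfl fun k _ => ?_
      rw [cycleForm, wedge_apply, wedge_apply]
      simp only [LinearMap.sub_apply, theta_eq]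
      ring
  cont z F φ := dunklRep_continuous (by fun_prop) (by fun_prop) z F φ
  faithful z hz := by
    refine dunklRep_faithful h z ?_
    rw [← hz]
    simp

end RegularForm

/-- The direction (δ, β) must be nonzero for the representation at t = 0 to be faithful. At a = b =
0 any nonzero direction will do, with A = 0. -/
theorem isDrinfeldOrbifoldOverPoly_kappa (n : ℕ) (a b c : ℂ) :
    (kappa n a b c).IsDrinfeldOrbifoldOverPoly := by
  by_cases h : a ≠ 0 ∨ b ≠ 0
  · have := (dunklFamily (n := n) (δ := a) (β := -b) (by simpa using h) 1
      c).isDrinfeldOrbifoldOverPoly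
    rwa [mul_one, mul_one, neg_neg] at this
  · push Not at h
    have := (dunklFamily (n := n) (δ := 1) (β := 0) (Or.inl one_ne_zero) 0
      c).isDrinfeldOrbifoldOverPoly
    rw [h.1, h.2]
    simpa using this

end DunklFamily

/-! ### The parameter maps with linear part in the fixed spaces -/

section WedgeMoved

set_option linter.unusedSectionVars false

variable {G V : Type*} [Group G] [AddCommGroup V] [Module ℂ V] [DistribMulAction G V]
  [SMulCommClass G ℂ V]

/-- The cyclic sum of `F(u, v) (g w - w)` vanishes. -/
def WedgeMoved (g : G) (F : V [⋀^Fin 2]→ₗ[ℂ] ℂ) : Prop :=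
  ∀ u v w, F ![u, v] • (g • w - w) + F ![v, w] • (g • u - u) + F ![w, u] • (g • v - v) = 0

/-- The average of φ over the cyclic group generated by g: displacements are killed by telescoping,
and fixed vectors are not affected. -/
theorem exists_invariant_dual [Finite G] (g : G) (φ : Module.Dual ℂ V) :
    ∃ ψ : Module.Dual ℂ V, (∀ w, ψ (g • w - w) = 0) ∧ ∀ w, g • w = w → ψ w = φ w := by
  have hN : (orderOf g : ℂ) ≠ 0 := by exact_mod_cast (orderOf_pos g).ne'
  refine ⟨(orderOf g : ℂ)⁻¹ • ∑ m ∈ Finset.range (orderOf g),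
    φ ∘ₗ DistribSMul.toLinearMap ℂ V (g ^ m), fun w => ?_, fun w hw => ?_⟩
  · have h : ∀ m, φ (g ^ m • (g • w - w)) = φ (g ^ (m + 1) • w) - φ (g ^ m • w) := by
      intro m
      rw [smul_sub, map_sub, smul_smul, pow_succ]
    simp only [LinearMap.smul_apply, LinearMap.sum_apply, LinearMap.comp_apply,
      DistribSMul.toLinearMap_apply, h]
    rw [Finset.sum_range_sub (fun m => φ (g ^ m • w)), pow_orderOf_eq_one, pow_zero, sub_self, smul_zero]
  · have h : ∀ m, g ^ m • w = w := by
      intro m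
      induction m with
      | zero => simp
      | succ m ih => rw [pow_succ, mul_smul, hw, ih]
    simp only [LinearMap.smul_apply, LinearMap.sum_apply, LinearMap.comp_apply,
      DistribSMul.toLinearMap_apply, h]
    simp [hN]

variable [Fintype G] {κ : ParameterMap G V}

/-- The polarized quadratic identity mixes values and displacements. Since κ^L_g takes values in
V^g, φ may be averaged over g; it then kills the displacements, and only one half of the identity
survives. -/
theorem LeadingInjective.wedgeMoved_lin (h : LeadingInjective κ)
    (hfix : ∀ (g : G) (v : Fin 2 → V), g • κ.lin g v = κ.lin g v) (g : G) (φ : Module.Dual ℂ V) :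
    WedgeMoved g (φ.compAlternatingMap (κ.lin g)) := by
  intro u v w
  obtain ⟨φ', h1, h2⟩ := exists_invariant_dual g φ
  refine (Module.forall_dual_apply_eq_zero_iff ℂ _).1 fun ψ => ?_
  have e := h.jacobi_quadratic ![u, v, w] g φ' ψ
  rw [Fin.sum_univ_three] at e
  simp only [h1, mul_zero, add_zero, h2 _ (hfix g _)] at e
  simp only [map_add, map_smul, LinearMap.compAlternatingMap_apply, smul_eq_mul]
  exact e

/-- If two such algebras have the same linear part, the difference of the constant parts satisfies
the homogeneous equations. -/
theorem LeadingInjective.wedgeMoved_const [FiniteDimensional ℂ V] {κ' : ParameterMap G V}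
    (h : LeadingInjective κ) (h' : LeadingInjective κ') (e : κ.lin = κ'.lin) (g : G) :
    WedgeMoved g (κ.const g - κ'.const g) := by
  intro u v w
  have e1 := congrFun (h.jacobi_lower ![u, v, w]).1 g
  have e2 := congrFun (h'.jacobi_lower ![u, v, w]).1 g
  rw [Finset.sum_apply, Fin.sum_univ_three, Pi.zero_apply] at e1 e2
  simp only [jacLin, e] at e1 e2
  have e3 := e1.trans e2.symm
  rw [← sub_eq_zero] at e3
  refine Eq.trans ?_ e3
  change (κ.const g ![u, v] - κ'.const g ![u, v]) • (g • w - w)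
    + (κ.const g ![v, w] - κ'.const g ![v, w]) • (g • u - u)
    + (κ.const g ![w, u] - κ'.const g ![w, u]) • (g • v - v) = _
  simp only [sub_smul]
  change _ = (_ + κ.const g ![u, v] • (g • w - w)) + (_ + κ.const g ![v, w] • (g • u - u))
    + (_ + κ.const g ![w, u] • (g • v - v)) - ((_ + κ'.const g ![u, v] • (g • w - w))
    + (_ + κ'.const g ![v, w] • (g • u - u)) + (_ + κ'.const g ![w, u] • (g • v - v)))
  abel

/-- If, in addition, the constant parts differ only at the identity. -/
theorem LeadingInjective.const_lin [FiniteDimensional ℂ V] {κ' : ParameterMap G V}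
    (h : LeadingInjective κ) (h' : LeadingInjective κ') (e : κ.lin = κ'.lin)
    (hfix : ∀ (g : G) (v : Fin 2 → V), g • κ.lin g v = κ.lin g v)
    (hne : ∀ g, g ≠ 1 → κ.const g = κ'.const g) (g : G) (u v w : V) :
    (κ.const 1 - κ'.const 1) ![κ.lin g ![u, v], w] + (κ.const 1 - κ'.const 1) ![κ.lin g ![v, w], u]
      + (κ.const 1 - κ'.const 1) ![κ.lin g ![w, u], v] = 0 := by
  classical
  have hinv : ∀ x y : V, (κ.const 1 - κ'.const 1) ![g • x, g • y]
      = (κ.const 1 - κ'.const 1) ![x, y] := by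
    intro x y
    have a1 := (h.invariant g 1 x y).2
    have a2 := (h'.invariant g 1 x y).2
    rw [mul_one, mul_inv_cancel] at a1 a2
    rw [AlternatingMap.sub_apply, AlternatingMap.sub_apply, a1, a2]
  -- The constant parts differ only at the identity, so the sum over k reduces to k = g. There the
  -- form is g-invariant and its first argument is g-fixed, so g z + z counts as 2 z and absorbs the
  -- factor 1/2.
  have hD : ∀ x y z : V, jacConst κ ![x, y, z] g - jacConst κ' ![x, y, z] g
      = (κ.const 1 - κ'.const 1) ![κ.lin g ![x, y], z] := by
    intro x y z
    rw [jacConst, jacConst, ← Finset.sum_sub_distrib, Finset.sum_eq_single g]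
    · rw [mul_inv_cancel, ← e, ← mul_sub, ← AlternatingMap.sub_apply, ← toBilin_apply, map_add,
        toBilin_apply, toBilin_apply]
      have := hinv (κ.lin g ![x, y]) z
      rw [hfix] at this
      change (1 / 2 : ℂ) * ((κ.const 1 - κ'.const 1) ![κ.lin g ![x, y], g • z]
        + (κ.const 1 - κ'.const 1) ![κ.lin g ![x, y], z]) = _
      rw [this]
      ring
    · intro k _ hk
      rw [← e, hne _ (fun h1 => hk (mul_inv_eq_one.1 h1).symm), sub_self]
    · simp
  have e1 := congrFun (h.jacobi_lower ![u, v, w]).2 g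
  have e2 := congrFun (h'.jacobi_lower ![u, v, w]).2 g
  rw [Finset.sum_apply, Fin.sum_univ_three, Pi.zero_apply] at e1 e2
  have r0 : rot ![u, v, w] 0 = ![u, v, w] := by ext i; fin_cases i <;> rfl
  have r1 : rot ![u, v, w] 1 = ![v, w, u] := by ext i; fin_cases i <;> rfl
  have r2 : rot ![u, v, w] 2 = ![w, u, v] := by ext i; fin_cases i <;> rfl
  rw [r0, r1, r2] at e1 e2
  rw [← hD, ← hD, ← hD]
  linear_combination e1 - e2

end WedgeMoved

/-! ### Classification for S_n -/

section Classification

open Equiv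

set_option linter.unusedSectionVars false

variable {n : ℕ}

theorem xcoord_xbar_sub (i j k : Fin n) : xcoord k (xbar i - xbar j)
    = (if i = k then 1 else 0) - (if j = k then 1 else 0) := by
  simp

theorem ycoord_ybar_sub (i j k : Fin n) : ycoord k (ybar i - ybar j)
    = (if i = k then 1 else 0) - (if j = k then 1 else 0) := by
  simp

/-- The space of displacements of an element that is neither the identity nor a transposition has
dimension at least three. -/
theorem exists_linearIndependent_moved {g : Perm (Fin n)} (h1 : g ≠ 1)
    (h2 : ∀ i j, i ≠ j → g ≠ swap i j) :
    ∃ u : Fin 3 → DoubledStd n, LinearIndependent ℂ fun m => g • u m - u m := by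
  obtain ⟨i, hi⟩ : ∃ i, g i ≠ i := by
    by_contra h
    push Not at h
    exact h1 (Equiv.ext h)
  -- Since g is not the transposition of i and g i, it differs from it at some k. The displacements
  -- of x̄_i and x̄_k are then independent in 𝔥*, and that of ȳ_i lies in the other summand.
  obtain ⟨k, hk⟩ : ∃ k, g k ≠ swap i (g i) k := by
    by_contra h
    push Not at h
    exact h2 i (g i) hi.symm (Equiv.ext h)
  have hki : k ≠ i := by
    rintro rfl
    exact hk (swap_apply_left _ _).symm
  have hgki : g k ≠ g i := g.injective.ne hki
  refine ⟨![xbar i, xbar k, ybar i], ?_⟩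
  rw [Fintype.linearIndependent_iff]
  intro c hc
  rw [Fin.sum_univ_three] at hc
  simp only [Matrix.cons_val_zero, Matrix.cons_val_one, Matrix.cons_val, smul_xbar, smul_ybar] at hc
  have hx : ∀ j, c 0 * ((if g i = j then 1 else 0) - (if i = j then 1 else 0))
      + c 1 * ((if g k = j then 1 else 0) - (if k = j then 1 else 0)) = 0 := by
    intro j
    have := congrArg (xcoord j) hc
    simpa only [map_add, map_smul, xcoord_xbar_sub, map_sub (xcoord j) (ybar _), xcoord_ybar,
      sub_self, smul_eq_mul, mul_zero, add_zero, map_zero] using this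
  have hy : c 2 = 0 := by
    have := congrArg (ycoord i) hc
    simpa only [map_add, map_smul, ycoord_ybar_sub, map_sub (ycoord i) (xbar _), ycoord_xbar,
      sub_self, smul_eq_mul, mul_zero, zero_add, map_zero, if_neg hi, if_true, zero_sub, mul_neg,
      mul_one, neg_eq_zero] using this
  have h01 : c 0 = 0 ∧ c 1 = 0 := by
    by_cases hkg : k = g i
    · subst hkg
      have e1 := hx i
      have hgg : g (g i) ≠ i := by
        intro e; exact hk (by rw [e, swap_apply_right])
      have e2 := hx (g (g i))
      simp [hi, hgg, hgki.symm, hgg.symm] at e1 e2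
      exact ⟨e1, e2⟩
    · rw [swap_apply_of_ne_of_ne hki hkg] at hk
      have e1 := hx (g i)
      have e2 := hx k
      simp [hi.symm, hgki, hkg, hk, Ne.symm hkg, hki.symm] at e1 e2
      exact ⟨e1, e2⟩
  intro m
  fin_cases m
  · exact h01.1
  · exact h01.2
  · exact hy

/-- If F(v 0, v 1) ≠ 0, the cyclic identity can be solved for g x - x, so that all displacements lie
in the span of two; but three independent ones exist. -/
theorem WedgeMoved.eq_zero {g : Perm (Fin n)} {F : DoubledStd n [⋀^Fin 2]→ₗ[ℂ] ℂ}
    (hF : WedgeMoved g F) (h1 : g ≠ 1) (h2 : ∀ i j, i ≠ j → g ≠ swap i j) : F = 0 := by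
  obtain ⟨x, hx⟩ := exists_linearIndependent_moved h1 h2
  ext v
  have hv : v = ![v 0, v 1] := by ext i; fin_cases i <;> rfl
  rw [hv]
  by_contra h0
  have hs : Submodule.span ℂ (Set.range fun m => g • x m - x m)
      ≤ Submodule.span ℂ (Set.range ![g • v 0 - v 0, g • v 1 - v 1]) := by
    rw [Submodule.span_le]
    rintro _ ⟨m, rfl⟩
    have e := hF (v 0) (v 1) (x m)
    have : g • x m - x m = (F ![v 0, v 1])⁻¹ • (-(F ![v 1, x m] • (g • v 0 - v 0))
        - F ![x m, v 0] • (g • v 1 - v 1)) := by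
      rw [eq_inv_smul_iff₀ h0]
      generalize g • x m - x m = d at e ⊢
      generalize g • v 0 - v 0 = d₀ at e ⊢
      generalize g • v 1 - v 1 = d₁ at e ⊢
      rw [← sub_eq_zero, ← e]
      module
    dsimp only
    rw [this]
    refine Submodule.smul_mem _ _ (sub_mem (neg_mem (Submodule.smul_mem _ _ ?_))
      (Submodule.smul_mem _ _ ?_))
    · exact Submodule.subset_span ⟨0, rfl⟩
    · exact Submodule.subset_span ⟨1, rfl⟩
  have hc := (Submodule.finrank_mono hs).trans (finrank_range_le_card _)
  rw [finrank_span_eq_card hx] at hc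
  simp at hc

theorem swap_smul_sub (i j : Fin n) (v : DoubledStd n) : swap i j • v - v
    = -((xcoord i v - xcoord j v) • (xbar i - xbar j)
      + (ycoord i v - ycoord j v) • (ybar i - ybar j)) := by
  rw [← sub_swap_smul, neg_sub]

/-- Taking coordinates, the cyclic identity says that the wedge of F with each of the two factors of
`swapForm i j` vanishes, so F is a multiple of it. The factor is read off at x̄_i, ȳ_j, where
`swapForm i j` equals -1. -/
theorem WedgeMoved.eq_swapForm {i j : Fin n} (hij : i ≠ j)
    {F : DoubledStd n [⋀^Fin 2]→ₗ[ℂ] ℂ} (hF : WedgeMoved (swap i j) F) :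
    F = -F ![xbar i, ybar j] • swapForm i j := by
  have hα : ∀ u v w, F ![u, v] * (xcoord i w - xcoord j w) + F ![v, w] * (xcoord i u - xcoord j u)
      + F ![w, u] * (xcoord i v - xcoord j v) = 0 := by
    intro u v w
    have := congrArg (xcoord i) (hF u v w)
    simp [swap_smul_sub, hij.symm] at this
    linear_combination -this
  have hβ : ∀ u v w, F ![u, v] * (ycoord i w - ycoord j w) + F ![v, w] * (ycoord i u - ycoord j u)
      + F ![w, u] * (ycoord i v - ycoord j v) = 0 := by
    intro u v w
    have := congrArg (ycoord i) (hF u v w)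
    simp [swap_smul_sub, hij.symm] at this
    linear_combination -this
  ext v
  have hv : v = ![v 0, v 1] := by ext i; fin_cases i <;> rfl
  rw [hv]
  have e0 := hα (v 0) (v 1) (xbar i)
  have e1 := hβ (xbar i) (v 0) (ybar j)
  have e2 := hβ (xbar i) (v 1) (ybar j)
  rw [alternating_swap F (xbar i) (ybar j)] at e1 e2
  rw [alternating_swap F (xbar i) (v 1)] at e0
  simp [hij, hij.symm] at e0 e1 e2
  simp [swapForm, wedge_apply]
  linear_combination e0 - (xcoord i (v 0) - xcoord j (v 0)) * e2
    + (xcoord i (v 1) - xcoord j (v 1)) * e1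

/-! ### The linear part -/

theorem exists_perm_pair {i j i' j' : Fin n} (h : i ≠ j) (h' : i' ≠ j') :
    ∃ g : Perm (Fin n), g i = i' ∧ g j = j' := by
  refine ⟨swap (swap i i' j) j' * swap i i', ?_, ?_⟩
  · rw [Perm.mul_apply, swap_apply_left]
    refine swap_apply_of_ne_of_ne (fun e => h ?_) h'
    apply (swap i i').injective
    rw [swap_apply_left, ← e]
  · rw [Perm.mul_apply, swap_apply_left]

theorem swap_conj (g : Perm (Fin n)) (i j : Fin n) : g * swap i j * g⁻¹ = swap (g i) (g j) := by
  rw [mul_swap_eq_swap_mul, mul_inv_cancel_right]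

theorem smul_pairVec (a b : ℂ) (g : Perm (Fin n)) (i j : Fin n) :
    g • pairVec a b i j = pairVec a b (g i) (g j) := by
  rw [pairVec, smul_add, smul_comm g a, smul_comm g b, smul_add g (xbar i),
    smul_add g (ybar i), smul_xbar, smul_xbar, smul_ybar, smul_ybar, pairVec]

/-- A vector of sum zero in `ℂⁿ` that is constant off `i`, `j` and has equal entries at `i`, `j`. -/
theorem eq_of_sum_zero {f : Fin n → ℂ} {i j k : Fin n} (hij : i ≠ j) (hs : ∑ m, f m = 0)
    (h1 : f i = f j) (h2 : ∀ m, m ≠ i → m ≠ j → f m = f k) (m : Fin n) :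
    f m = (n : ℂ) / 2 * (-f k * (((if i = m then 1 else 0) - (n : ℂ)⁻¹)
      + ((if j = m then 1 else 0) - (n : ℂ)⁻¹))) := by
  have hn : (n : ℂ) ≠ 0 := by
    have := i.pos
    exact_mod_cast this.ne'
  have hs2 : ∑ m, (f m - f k) = 2 * (f i - f k) := by
    rw [← Finset.sum_subset (Finset.subset_univ {i, j}), Finset.sum_pair hij, ← h1, two_mul]
    intro m _ hm
    simp only [Finset.mem_insert, Finset.mem_singleton, not_or] at hm
    rw [h2 m hm.1 hm.2, sub_self]
  rw [Finset.sum_sub_distrib, hs, Finset.sum_const, Finset.card_univ, Fintype.card_fin,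
    nsmul_eq_mul] at hs2
  rcases eq_or_ne i m with rfl | hi
  · rw [if_pos rfl, if_neg hij.symm]
    field_simp
    linear_combination -hs2
  · rcases eq_or_ne j m with rfl | hj
    · rw [if_pos rfl, if_neg hij, ← h1]
      field_simp
      linear_combination -hs2
    · rw [if_neg hi, if_neg hj, h2 m hi.symm hj.symm]
      field_simp
      ring

/-- A vector fixed by the transposition of `i`, `j` and by the permutations that fix `i` and `j`. -/
theorem eq_pairVec {M : DoubledStd n} {i j k : Fin n} (hij : i ≠ j)
    (h1 : swap i j • M = M) (h2 : ∀ l, l ≠ i → l ≠ j → swap l k • M = M) :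
    M = ((n : ℂ) / 2) • pairVec (-xcoord k M) (-ycoord k M) i j := by
  apply doubledStd_ext
  · intro m
    rw [eq_of_sum_zero (f := fun m => xcoord m M) (k := k) hij (sum_xcoord M) (by
      have := xcoord_smul (swap i j) M i
      rwa [h1, swap_inv, swap_apply_left] at this) (fun l hi hj => by
      have := xcoord_smul (swap l k) M l
      rwa [h2 l hi hj, swap_inv, swap_apply_left] at this) m]
    simp [pairVec]
    ring
  · intro m
    rw [eq_of_sum_zero (f := fun m => ycoord m M) (k := k) hij (sum_ycoord M) (by
      have := ycoord_smul (swap i j) M i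
      rwa [h1, swap_inv, swap_apply_left] at this) (fun l hi hj => by
      have := ycoord_smul (swap l k) M l
      rwa [h2 l hi hj, swap_inv, swap_apply_left] at this) m]
    simp [pairVec]
    ring

variable {κ κ' : ParameterMap (Perm (Fin n)) (DoubledStd n)}

theorem LeadingInjective.lin_eq_zero (h : LeadingInjective κ)
    (hfix : ∀ (g : Perm (Fin n)) (v : Fin 2 → DoubledStd n), g • κ.lin g v = κ.lin g v)
    {g : Perm (Fin n)} (h1 : g ≠ 1) (h2 : ∀ i j, i ≠ j → g ≠ swap i j) : κ.lin g = 0 := by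
  ext1 v
  refine (Module.forall_dual_apply_eq_zero_iff ℂ _).1 fun φ => ?_
  exact congrArg (fun F => F v) ((h.wedgeMoved_lin hfix g φ).eq_zero h1 h2)

theorem LeadingInjective.lin_swap (h : LeadingInjective κ)
    (hfix : ∀ (g : Perm (Fin n)) (v : Fin 2 → DoubledStd n), g • κ.lin g v = κ.lin g v)
    {i j : Fin n} (hij : i ≠ j) (v : Fin 2 → DoubledStd n) :
    κ.lin (swap i j) v = -(swapForm i j v • κ.lin (swap i j) ![xbar i, ybar j]) := by
  rw [← sub_eq_zero]
  refine (Module.forall_dual_apply_eq_zero_iff ℂ _).1 fun φ => ?_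
  have e := congrArg (fun F => F v) ((h.wedgeMoved_lin hfix (swap i j) φ).eq_swapForm hij)
  simp only [LinearMap.compAlternatingMap_apply, AlternatingMap.smul_apply, smul_eq_mul] at e
  rw [map_sub, e, map_neg, map_smul, smul_eq_mul]
  ring

theorem LeadingInjective.lin_swap_smul (h : LeadingInjective κ) (g : Perm (Fin n)) (i j : Fin n) :
    κ.lin (swap (g i) (g j)) ![xbar (g i), ybar (g j)]
      = g • κ.lin (swap i j) ![xbar i, ybar j] := by
  rw [← (h.invariant g (swap i j) (xbar i) (ybar j)).1, swap_conj, smul_xbar, smul_ybar]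

/-- Ordered pairs of distinct indices form one orbit, so equivariance leaves a single vector. It is
fixed by (p q), by assumption, and by all permutations fixing p and q, by equivariance. -/
theorem LeadingInjective.lin_swap_eq_pairVec (hn : 4 ≤ n) (h : LeadingInjective κ)
    (hfix : ∀ (g : Perm (Fin n)) (v : Fin 2 → DoubledStd n), g • κ.lin g v = κ.lin g v) :
    ∃ a b : ℂ, ∀ i j, i ≠ j →
      κ.lin (swap i j) ![xbar i, ybar j] = ((n : ℂ) / 2) • pairVec a b i j := by
  let p : Fin n := ⟨0, by omega⟩
  let q : Fin n := ⟨1, by omega⟩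
  let r : Fin n := ⟨2, by omega⟩
  have hpq : p ≠ q := by simp [p, q]
  have hrp : r ≠ p := by simp [p, r]
  have hrq : r ≠ q := by simp [q, r]
  -- Off p and q, the vector (n/2) `pairVec a b p q` has coordinates -a and -b, so the parameters
  -- are read off at a third index r.
  refine ⟨-xcoord r (κ.lin (swap p q) ![xbar p, ybar q]),
    -ycoord r (κ.lin (swap p q) ![xbar p, ybar q]), fun i j hij => ?_⟩
  obtain ⟨g, rfl, rfl⟩ := exists_perm_pair hpq hij
  rw [h.lin_swap_smul, ← smul_pairVec, ← smul_comm g]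
  refine congrArg _ (eq_pairVec hpq (hfix _ _) fun l hl hl' => ?_)
  have e := h.lin_swap_smul (swap l r) p q
  rw [swap_apply_of_ne_of_ne hl.symm hrp.symm, swap_apply_of_ne_of_ne hl'.symm hrq.symm] at e
  exact e.symm

/-- The linear part is determined by its values on the pairs `x̄_i`, `ȳ_j`. -/
theorem LeadingInjective.lin_eq (h : LeadingInjective κ) (h' : LeadingInjective κ')
    (hfix : ∀ (g : Perm (Fin n)) (v : Fin 2 → DoubledStd n), g • κ.lin g v = κ.lin g v)
    (hfix' : ∀ (g : Perm (Fin n)) (v : Fin 2 → DoubledStd n), g • κ'.lin g v = κ'.lin g v)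
    (h1 : κ.lin 1 = κ'.lin 1)
    (he : ∀ i j, i ≠ j → κ.lin (swap i j) ![xbar i, ybar j]
      = κ'.lin (swap i j) ![xbar i, ybar j]) : κ.lin = κ'.lin := by
  funext g
  by_cases hg : g = 1
  · rw [hg, h1]
  by_cases hs : ∃ i j, i ≠ j ∧ g = swap i j
  · obtain ⟨i, j, hij, rfl⟩ := hs
    ext1 v
    rw [h.lin_swap hfix hij, h'.lin_swap hfix' hij, he i j hij]
  · push Not at hs
    rw [h.lin_eq_zero hfix hg hs, h'.lin_eq_zero hfix' hg hs]

/-! ### The constant part -/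

/-- Off the identity, the constant part is determined by the linear part and its value at one pair
`x̄_i`, `ȳ_j`. -/
theorem LeadingInjective.const_eq (h : LeadingInjective κ) (h' : LeadingInjective κ')
    (e : κ.lin = κ'.lin) {p q : Fin n} (hpq : p ≠ q)
    (he : κ.const (swap p q) ![xbar p, ybar q] = κ'.const (swap p q) ![xbar p, ybar q])
    {g : Perm (Fin n)} (hg : g ≠ 1) : κ.const g = κ'.const g := by
  rw [← sub_eq_zero]
  have hw := h.wedgeMoved_const h' e g
  by_cases hs : ∃ i j, i ≠ j ∧ g = swap i j
  · obtain ⟨i, j, hij, rfl⟩ := hs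
    rw [hw.eq_swapForm hij]
    obtain ⟨σ, rfl, rfl⟩ := exists_perm_pair hpq hij
    have e1 := (h.invariant σ (swap p q) (xbar p) (ybar q)).2
    have e2 := (h'.invariant σ (swap p q) (xbar p) (ybar q)).2
    rw [swap_conj, smul_xbar, smul_ybar] at e1 e2
    rw [AlternatingMap.sub_apply, e1, e2, he, sub_self, neg_zero, zero_smul]
  · push Not at hs
    exact hw.eq_zero hg hs

/-- An invariant alternating form that satisfies the Jacobi identity with a nonzero linear part. -/
theorem invariant_form_eq_zero (hn : 4 ≤ n) {F : DoubledStd n [⋀^Fin 2]→ₗ[ℂ] ℂ} {a b : ℂ}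
    (hab : a ≠ 0 ∨ b ≠ 0) (hinv : ∀ (g : Perm (Fin n)) v w, F ![g • v, g • w] = F ![v, w])
    (hF : ∀ i j, i ≠ j → ∀ v, swapForm i j ![xbar i, ybar j] * F ![pairVec a b i j, v]
      + swapForm i j ![ybar j, v] * F ![pairVec a b i j, xbar i]
      + swapForm i j ![v, xbar i] * F ![pairVec a b i j, ybar j] = 0) : F = 0 := by
  have hxx : ∀ i j, F ![xbar i, xbar j] = 0 := by
    intro i j
    have e := hinv (swap i j) (xbar i) (xbar j)
    rw [smul_xbar, smul_xbar, swap_apply_left, swap_apply_right, alternating_swap] at e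
    linear_combination -e / 2
  have hyy : ∀ i j, F ![ybar i, ybar j] = 0 := by
    intro i j
    have e := hinv (swap i j) (ybar i) (ybar j)
    rw [smul_ybar, smul_ybar, swap_apply_left, swap_apply_right, alternating_swap] at e
    linear_combination -e / 2
  have hP : ∀ i j v, F ![pairVec a b i j, v] = a * (F ![xbar i, v] + F ![xbar j, v])
      + b * (F ![ybar i, v] + F ![ybar j, v]) := by
    intro i j v
    simp only [← toBilin_apply, pairVec, map_add, map_smul, LinearMap.add_apply,
      LinearMap.smul_apply, smul_eq_mul]
  -- With j a third index, invariance identifies the values of F involved. The Jacobi identity for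
  -- (i j) with third argument x̄_k or ȳ_k then reduces to 2bF = 0 or 2aF = 0.
  have hne : ∀ i k, i ≠ k → F ![xbar k, ybar i] = 0 := by
    intro i k hik
    obtain ⟨j, hj⟩ : ∃ j, j ∉ ({i, k} : Finset (Fin n)) := by
      by_contra hc
      push Not at hc
      have := Finset.card_le_card (fun x _ => hc x : (Finset.univ : Finset (Fin n)) ⊆ {i, k})
      have h2 := Finset.card_le_two (a := i) (b := k)
      rw [Finset.card_univ, Fintype.card_fin] at this
      omega
    simp only [Finset.mem_insert, Finset.mem_singleton, not_or] at hj
    have hij : i ≠ j := Ne.symm hj.1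
    have hjk : j ≠ k := hj.2
    have s1 : F ![xbar k, ybar j] = F ![xbar k, ybar i] := by
      have := hinv (swap i j) (xbar k) (ybar i)
      rwa [smul_xbar, smul_ybar, swap_apply_left, swap_apply_of_ne_of_ne hik.symm hjk.symm] at this
    have s2 : F ![xbar j, ybar k] = F ![xbar i, ybar k] := by
      have := hinv (swap i j) (xbar i) (ybar k)
      rwa [smul_xbar, smul_ybar, swap_apply_left, swap_apply_of_ne_of_ne hik.symm hjk.symm] at this
    have s3 : F ![xbar i, ybar k] = F ![xbar k, ybar i] := by
      have := hinv (swap i k) (xbar k) (ybar i)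
      rwa [smul_xbar, smul_ybar, swap_apply_left, swap_apply_right] at this
    have e1 := hF i j hij (xbar k)
    have e2 := hF i j hij (ybar k)
    rw [hP, hP, hP] at e1 e2
    have w1 : swapForm i j ![xbar i, ybar j] = -1 := by
      rw [swapForm_xbar_ybar]; simp [hij, hij.symm]
    have w2 : swapForm i j ![ybar j, xbar k] = 0 := by
      rw [alternating_swap, swapForm_xbar_ybar]; simp [hik.symm, hjk.symm]
    have w3 : swapForm i j ![ybar k, xbar i] = 0 := by
      rw [alternating_swap, swapForm_xbar_ybar]; simp [hik.symm, hjk.symm]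
    rw [w1, w2, swapForm_xbar_xbar, hxx, hxx, alternating_swap F (xbar k) (ybar i),
      alternating_swap F (xbar k) (ybar j), s1] at e1
    rw [w1, w3, swapForm_ybar_ybar, hyy, hyy, s2, s3] at e2
    rcases hab with ha | hb
    · refine mul_left_cancel₀ ha ?_
      linear_combination -e2 / 2
    · refine mul_left_cancel₀ hb ?_
      linear_combination e1 / 2
  -- The ȳ_j sum to zero, so this value is minus the sum of the off-diagonal ones.
  have hsame : ∀ i, F ![xbar i, ybar i] = 0 := by
    intro i
    have hs : ∑ j : Fin n, (ybar j : DoubledStd n) = 0 := by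
      apply doubledStd_ext <;> intro m
      · simp
      · have hn : (n : ℂ) ≠ 0 := by
          have := i.pos
          exact_mod_cast this.ne'
        simp [hn]
    have e : ∑ j, F ![xbar i, ybar j] = 0 := by
      simp only [← toBilin_apply, ← map_sum]
      rw [hs, map_zero]
    rwa [Finset.sum_eq_single i (fun j _ hj => hne j i hj) (by simp)] at e
  refine alternating_eq_of_bars (fun i j _ => hxx i j) (fun i j _ => hyy i j) fun i j => ?_
  rcases eq_or_ne i j with rfl | hij
  · exact hsame i
  · exact hne j i hij.symm

/-! ### The classification -/

theorem kappa_lin_smul (a b c : ℂ) (g : Perm (Fin n)) (v : Fin 2 → DoubledStd n) :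
    g • (kappa n a b c).lin g v = (kappa n a b c).lin g v := by
  have e := congrFun (kappa_lin (n := n) a b c v) g
  simp only [Finset.sum_apply, Pi.smul_apply] at e
  rw [e, Finset.smul_sum]
  refine Finset.sum_congr rfl fun i _ => ?_
  rw [Finset.smul_sum]
  refine Finset.sum_congr rfl fun k _ => ?_
  rw [atElt, Pi.single_apply]
  split_ifs with h
  · rw [smul_comm g, smul_comm g (-((n : ℂ) / 4)), smul_pairVec, h, swap_apply_left,
      swap_apply_right, pairVec_comm]
  · rw [smul_zero, smul_zero]

theorem swapForm_self (i : Fin n) (v : Fin 2 → DoubledStd n) : swapForm i i v = 0 := by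
  simp [swapForm, wedge_apply]

theorem swap_ne_one {i j : Fin n} (h : i ≠ j) : swap i j ≠ 1 := by
  rwa [Ne, Perm.one_def, swap_eq_refl_iff]

theorem kappa_lin_one (a b c : ℂ) : (kappa n a b c).lin 1 = 0 := by
  ext1 v
  have e := congrFun (kappa_lin (n := n) a b c v) 1
  simp only [Finset.sum_apply, Pi.smul_apply] at e
  rw [e]
  refine Finset.sum_eq_zero fun i _ => Finset.sum_eq_zero fun k _ => ?_
  rcases eq_or_ne i k with rfl | hik
  · rw [swapForm_self, zero_smul]
  · rw [atElt, Pi.single_eq_of_ne (swap_ne_one hik).symm, smul_zero]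

theorem kappa_const_one (a b c : ℂ) : (kappa n a b c).const 1 = 0 := by
  ext1 v
  have e := congrFun (kappa_const (n := n) a b c v) 1
  simp only [Finset.sum_apply, Pi.add_apply, Pi.smul_apply] at e
  rw [e]
  refine (congrArg₂ (· + ·) ?_ ?_).trans (add_zero 0)
  · refine Finset.sum_eq_zero fun i _ => Finset.sum_eq_zero fun k _ => ?_
    rcases eq_or_ne i k with rfl | hik
    · rw [swapForm_self, zero_smul]
    · rw [atElt, Pi.single_eq_of_ne (swap_ne_one hik).symm, smul_zero]
  · refine Finset.sum_eq_zero fun i _ => Finset.sum_eq_zero fun j _ =>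
      Finset.sum_eq_zero fun k _ => ?_
    -- The product of the two transpositions is trivial only for i = k, and then a factor of the
    -- form vanishes.
    by_cases h : cycle3 i j k = 1
    · have hik : i = k := by
        rw [cycle3, mul_eq_one_iff_eq_inv, swap_inv] at h
        have := congrArg (fun σ : Perm (Fin n) => σ j) h
        simpa using this
      subst hik
      rw [cycleForm, wedge_apply]
      simp
    · rw [atElt, Pi.single_eq_of_ne (Ne.symm h), smul_zero]

theorem leadingInjective_kappa (n : ℕ) (a b c : ℂ) : LeadingInjective (kappa n a b c) :=
  leadingInjective_of_isDrinfeldOrbifold (isDrinfeldOrbifoldOverPoly_kappa n a b c).pbw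

theorem kappa_lin_zero (c : ℂ) : (kappa n 0 0 c).lin = 0 := by
  funext g
  ext1 v
  have e := congrFun (kappa_lin (n := n) 0 0 c v) g
  simp only [Finset.sum_apply, Pi.smul_apply] at e
  rw [e]
  refine Finset.sum_eq_zero fun i _ => Finset.sum_eq_zero fun k _ => ?_
  simp [pairVec]

/-- The target κ_{a,b,c} is itself PBW, so the uniqueness statements apply to the pair: a and b are
chosen to match the linear parts, c to match one value on a transposition, and only the component at
the identity is left. -/
theorem LeadingInjective.eq_kappa (hn : 4 ≤ n) (h : LeadingInjective κ)
    (hfix : ∀ (g : Perm (Fin n)) (v : Fin 2 → DoubledStd n), g • κ.lin g v = κ.lin g v)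
    (h1 : κ.lin 1 = 0) (h2 : κ.lin ≠ 0 ∨ κ.const 1 = 0) : ∃ a b c : ℂ, κ = kappa n a b c := by
  obtain ⟨a, b, hab⟩ := h.lin_swap_eq_pairVec hn hfix
  have hlin : ∀ c, κ.lin = (kappa n a b c).lin := fun c =>
    h.lin_eq (leadingInjective_kappa n a b c) hfix (kappa_lin_smul a b c)
      (h1.trans (kappa_lin_one a b c).symm) fun i j hij => by
        rw [hab i j hij, congrFun ((hasValues_kappa a b c).lin_xy i j hij) (swap i j), atElt,
          Pi.single_eq_same]
        rfl
  let p : Fin n := ⟨0, by omega⟩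
  let q : Fin n := ⟨1, by omega⟩
  have hpq : p ≠ q := by simp [p, q]
  obtain ⟨c, hc⟩ : ∃ c, κ.const (swap p q) ![xbar p, ybar q]
      = (kappa n a b c).const (swap p q) ![xbar p, ybar q] := by
    -- The parameter c enters this value as -c, and the remaining terms do not depend on it.
    refine ⟨(kappa n a b 0).const (swap p q) ![xbar p, ybar q]
      - κ.const (swap p q) ![xbar p, ybar q], ?_⟩
    rw [congrFun ((hasValues_kappa a b _).const_xy p q hpq) (swap p q)]
    rw [congrFun ((hasValues_kappa a b 0).const_xy p q hpq) (swap p q)]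
    simp
  refine ⟨a, b, c, ?_⟩
  have hk := leadingInjective_kappa n a b c
  have hne : ∀ g, g ≠ 1 → κ.const g = (kappa n a b c).const g := fun g hg =>
    h.const_eq hk (hlin c) hpq hc hg
  refine ParameterMap.ext (hlin c) (funext fun g => ?_)
  rcases eq_or_ne g 1 with rfl | hg
  swap
  · exact hne g hg
  by_cases h0 : a ≠ 0 ∨ b ≠ 0
  · rw [← sub_eq_zero]
    refine invariant_form_eq_zero hn h0 (fun g v w => ?_) fun i j hij v => ?_
    · have e1 := (h.invariant g 1 v w).2
      have e2 := (hk.invariant g 1 v w).2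
      rw [mul_one, mul_inv_cancel] at e1 e2
      rw [AlternatingMap.sub_apply, AlternatingMap.sub_apply, e1, e2]
    · have e := h.const_lin hk (hlin c) hfix hne (swap i j) (xbar i) (ybar j) v
      rw [h.lin_swap hfix hij, h.lin_swap hfix hij ![ybar j, v],
        h.lin_swap hfix hij ![v, xbar i], hab i j hij] at e
      simp only [← toBilin_apply (κ.const 1 - (kappa n a b c).const 1), map_neg, map_smul,
        LinearMap.neg_apply, LinearMap.smul_apply, smul_eq_mul] at e ⊢
      have hn0 : (n : ℂ) / 2 ≠ 0 := by
        have : (n : ℂ) ≠ 0 := by exact_mod_cast (by omega : n ≠ 0)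
        simpa using this
      refine mul_left_cancel₀ hn0 ?_
      linear_combination -e
  -- For a = b = 0 the linear part is zero, so the last hypothesis must hold through its second
  -- alternative.
  · push Not at h0
    rw [kappa_const_one]
    refine h2.resolve_left fun hl => hl ?_
    rw [hlin c, h0.1, h0.2, kappa_lin_zero]

theorem classification (hn : 4 ≤ n) (κ : ParameterMap (Perm (Fin n)) (DoubledStd n)) :
    (κ.IsDrinfeldOrbifold ∧
        (∀ (g : Perm (Fin n)) (v : Fin 2 → DoubledStd n), g • κ.lin g v = κ.lin g v) ∧
        κ.lin 1 = 0 ∧ (κ.lin ≠ 0 ∨ κ.const 1 = 0)) ↔ ∃ a b c : ℂ, HasValues a b c κ := by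
  constructor
  · rintro ⟨h, hfix, h1, h2⟩
    obtain ⟨a, b, c, rfl⟩ :=
      (leadingInjective_of_isDrinfeldOrbifold h).eq_kappa hn hfix h1 h2
    exact ⟨a, b, c, hasValues_kappa a b c⟩
  · rintro ⟨a, b, c, h⟩
    rw [h.eq_kappa]
    exact ⟨(isDrinfeldOrbifoldOverPoly_kappa n a b c).pbw, kappa_lin_smul a b c,
      kappa_lin_one a b c, Or.inr (kappa_const_one a b c)⟩

end Classification

/-! ### The rational Cherednik algebra -/

section RationalCherednik

open Equiv RegularForm

set_option linter.unusedSectionVars false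

variable {n : ℕ}

theorem sum_sum_eq_two_smul_sum_lt {M : Type*} [AddCommGroup M] [Module ℂ M]
    (h : Fin n → Fin n → M) (hd : ∀ i, h i i = 0) (hs : ∀ i k, h k i = h i k) :
    ∑ i, ∑ k, h i k
      = (2 : ℂ) • ∑ p ∈ Finset.univ.filter (fun p : Fin n × Fin n => p.1 < p.2), h p.1 p.2 := by
  have e : ∀ i k, h i k = (if i < k then h i k else 0) + (if k < i then h i k else 0) := by
    intro i k
    rcases lt_trichotomy i k with hik | rfl | hik
    · simp [hik, hik.not_gt]
    · simp [hd]
    · simp [hik, hik.not_gt]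
  have e2 : ∑ i, ∑ k, (if k < i then h i k else 0) = ∑ i, ∑ k, (if i < k then h i k else 0) := by
    rw [Finset.sum_comm]
    simp only [hs]
  rw [Finset.sum_congr rfl fun i _ => Finset.sum_congr rfl fun k _ => e i k]
  simp only [Finset.sum_add_distrib]
  rw [e2, two_smul, Finset.sum_filter, ← Finset.univ_product_univ, Finset.sum_product]

/-- The sum of the transpositions, weighted by the forms that belong to them. -/
def swapSum (c : ℂ) (v w : DoubledStd n) : TensorSkew (Perm (Fin n)) (DoubledStd n) :=
  ∑ p ∈ Finset.univ.filter (fun p : Fin n × Fin n => p.1 < p.2),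
    (c * swapForm p.1 p.2 ![v, w]) • SkewMonoidAlgebra.single (swap p.1 p.2) 1

/-- At a = b = 0 the linear part and the three-cycle forms vanish. Passing from ordered to unordered
pairs turns c/2 into c. -/
theorem kappa_zero_value (c : ℂ) (v w : DoubledStd n) :
    (kappa n 0 0 c).linValue v w + (kappa n 0 0 c).constValue v w = swapSum c v w := by
  have h0 : (fun g => (kappa n 0 0 c).lin g ![v, w]) = 0 := by
    rw [kappa_lin_zero]
    rfl
  have hz : (linElt (0 : Perm (Fin n) → DoubledStd n)) = 0 := by simp [linElt]
  have hc : ∀ i j k : Fin n, cycleForm 0 0 i j k ![v, w] = 0 := by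
    intro i j k
    simp [cycleForm, wedge_apply, theta]
  rw [linValue_eq, constValue_eq, h0, hz, zero_add, kappa_const]
  simp only [hc, zero_smul, Finset.sum_const_zero, add_zero, constElt_sum, constElt_smul,
    constElt_atElt]
  rw [sum_sum_eq_two_smul_sum_lt _ (fun i => by rw [swapForm_self, zero_smul])
    (fun i k => by
      rw [swap_comm k i]
      congr 1
      simp only [swapForm, wedge_apply, LinearMap.sub_apply]
      ring), swapSum, Finset.smul_sum]
  refine Finset.sum_congr rfl fun p _ => ?_
  rw [smul_smul, smul_smul]
  congr 1
  ring

theorem swapForm_inStd_inDual (i k : Fin n) (y : Std n) (x : Module.Dual ℂ (Std n)) :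
    swapForm i k ![inStd y, inDual x] = -((xStd i - xStd k) y * x (yStd i - yStd k)) := by
  have h1 : ∀ i, xcoord i (inDual x) = x (yStd i) := fun _ => rfl
  have h2 : ∀ i, ycoord i (inStd y) = xStd i y := fun i => (xStd_apply i y).symm
  have h3 : ∀ i, xcoord i (inStd y) = 0 := fun _ => rfl
  simp [swapForm, wedge_apply, h1, h2, h3]

theorem swapForm_inDual_inDual (i k : Fin n) (x x' : Module.Dual ℂ (Std n)) :
    swapForm i k ![inDual x, inDual x'] = 0 := by
  have h : ∀ i (x : Module.Dual ℂ (Std n)), ycoord i (inDual x) = 0 := fun _ _ => rfl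
  simp [swapForm, wedge_apply, h]

theorem swapForm_inStd_inStd (i k : Fin n) (y y' : Std n) :
    swapForm i k ![inStd y, inStd y'] = 0 := by
  have h : ∀ i (y : Std n), xcoord i (inStd y) = 0 := fun _ _ => rfl
  simp [swapForm, wedge_apply, h]

theorem inDual_add_inStd (v : DoubledStd n) : inDual v.1 + inStd v.2 = v :=
  Prod.ext (add_zero v.1) (zero_add v.2)

theorem swapSum_inStd_inDual (c : ℂ) (y : Std n) (x : Module.Dual ℂ (Std n)) :
    swapSum c (inStd y) (inDual x) = algebraMap ℂ _ (0 * x y) -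
      ∑ p ∈ Finset.univ.filter (fun p : Fin n × Fin n => p.1 < p.2),
        (c * (xStd p.1 - xStd p.2) y * x (yStd p.1 - yStd p.2)) •
          SkewMonoidAlgebra.single (swap p.1 p.2) 1 := by
  rw [zero_mul, map_zero, zero_sub, swapSum, ← Finset.sum_neg_distrib]
  refine Finset.sum_congr rfl fun p _ => ?_
  rw [swapForm_inStd_inDual, ← neg_smul]
  congr 1
  ring

theorem swapSum_eq (c : ℂ) (x x' : Module.Dual ℂ (Std n)) (y y' : Std n) :
    swapSum c (inDual x + inStd y) (inDual x' + inStd y')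
      = swapSum c (inStd y) (inDual x') - swapSum c (inStd y') (inDual x) := by
  simp only [swapSum]
  rw [← Finset.sum_sub_distrib]
  refine Finset.sum_congr rfl fun p _ => ?_
  rw [← sub_smul, ← mul_sub]
  congr 2
  simp only [← toBilin_apply, map_add, LinearMap.add_apply]
  simp only [toBilin_apply, swapForm_inDual_inDual, swapForm_inStd_inStd, add_zero, zero_add]
  rw [alternating_swap _ (inStd y') (inDual x)]
  ring

theorem vec_add (v w : DoubledStd n) :
    (vec (v + w) : TensorSkew (Perm (Fin n)) (DoubledStd n)) = vec v + vec w := by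
  rw [vec, map_add, SkewMonoidAlgebra.single_add]
  rfl

theorem commutator_add {A : Type*} [Ring A] {x x' y y' : A} (hx : x * x' - x' * x = 0)
    (hy : y * y' - y' * y = 0) : (x + y) * (x' + y') - (x' + y') * (x + y)
      = (y * x' - x' * y) - (y' * x - x * y') := by
  calc _ = (x * x' - x' * x) + (y * y' - y' * y) + ((y * x' - x' * y) - (y' * x - x * y')) := by
        noncomm_ring
    _ = _ := by rw [hx, hy, zero_add, zero_add]

/-- The Cherednik relations are imposed only on pairs from single summands. Bilinearity extends them
to arbitrary pairs in 𝔥* ⊕ 𝔥. -/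
theorem cherednikProj_rel (c : ℂ) ⦃x y : TensorSkew (Perm (Fin n)) (DoubledStd n)⦄
    (h : (kappa n 0 0 c).Rel x y) : cherednikProj n 0 c x = cherednikProj n 0 c y := by
  cases h with | comm v w
  rw [kappa_zero_value]
  have hr : ∀ {x y}, CherednikRel n 0 c x y → cherednikProj n 0 c x = cherednikProj n 0 c y :=
    fun h => RingQuot.mkAlgHom_rel ℂ h
  obtain ⟨x, y, rfl⟩ : ∃ x y, v = inDual x + inStd y := ⟨_, _, (inDual_add_inStd v).symm⟩
  obtain ⟨x', y', rfl⟩ : ∃ x y, w = inDual x + inStd y := ⟨_, _, (inDual_add_inStd w).symm⟩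
  have e1 := hr (CherednikRel.xx x x')
  have e2 := hr (CherednikRel.yy y y')
  have e3 := hr (CherednikRel.yx y x')
  have e4 := hr (CherednikRel.yx y' x)
  rw [← swapSum_inStd_inDual] at e3 e4
  rw [swapSum_eq, map_sub (cherednikProj n 0 c) (swapSum c _ _), ← e3, ← e4, vec_add, vec_add]
  simp only [map_sub, map_mul, map_add, map_zero] at e1 e2 ⊢
  exact commutator_add e1 e2

theorem proj_cherednikRel (c : ℂ) ⦃x y : TensorSkew (Perm (Fin n)) (DoubledStd n)⦄
    (h : CherednikRel n 0 c x y) : (kappa n 0 0 c).proj x = (kappa n 0 0 c).proj y := by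
  have hr : ∀ v w, (kappa n 0 0 c).proj (vec v * vec w - vec w * vec v)
      = (kappa n 0 0 c).proj (swapSum c v w) := fun v w => by
    rw [← kappa_zero_value]
    exact RingQuot.mkAlgHom_rel ℂ (ParameterMap.Rel.comm v w)
  cases h with
  | xx x x' =>
    rw [hr, swapSum]
    simp only [swapForm_inDual_inDual, mul_zero, zero_smul, Finset.sum_const_zero]
  | yy y y' =>
    rw [hr, swapSum]
    simp only [swapForm_inStd_inStd, mul_zero, zero_smul, Finset.sum_const_zero]
  | yx y x => rw [hr, swapSum_inStd_inDual]

/-- The homomorphism from `H_κ` at `a = b = 0` to the rational Cherednik algebra. -/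
def toCherednik (n : ℕ) (c : ℂ) : (kappa n 0 0 c).Alg →ₐ[ℂ] Cherednik n 0 c :=
  RingQuot.liftAlgHom ℂ ⟨cherednikProj n 0 c, cherednikProj_rel c⟩

/-- The homomorphism from the rational Cherednik algebra to `H_κ` at `a = b = 0`. -/
def ofCherednik (n : ℕ) (c : ℂ) : Cherednik n 0 c →ₐ[ℂ] (kappa n 0 0 c).Alg :=
  RingQuot.liftAlgHom ℂ ⟨(kappa n 0 0 c).proj, proj_cherednikRel c⟩

theorem toCherednik_proj (c : ℂ) (z : TensorSkew (Perm (Fin n)) (DoubledStd n)) :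
    toCherednik n c ((kappa n 0 0 c).proj z) = cherednikProj n 0 c z :=
  RingQuot.liftAlgHom_mkAlgHom_apply ℂ _ _ z

theorem ofCherednik_proj (c : ℂ) (z : TensorSkew (Perm (Fin n)) (DoubledStd n)) :
    ofCherednik n c (cherednikProj n 0 c z) = (kappa n 0 0 c).proj z :=
  RingQuot.liftAlgHom_mkAlgHom_apply ℂ _ _ z

/-- At `a = b = 0` the algebra is a rational Cherednik algebra. -/
def cherednikEquiv (n : ℕ) (c : ℂ) : (kappa n 0 0 c).Alg ≃ₐ[ℂ] Cherednik n 0 c :=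
  AlgEquiv.ofAlgHom (toCherednik n c) (ofCherednik n c)
    (RingQuot.ringQuot_ext' ℂ _ _ (AlgHom.ext fun z =>
      (congrArg (toCherednik n c) (ofCherednik_proj c z)).trans (toCherednik_proj c z)))
    (RingQuot.ringQuot_ext' ℂ _ _ (AlgHom.ext fun z =>
      (congrArg (ofCherednik n c) (toCherednik_proj c z)).trans (ofCherednik_proj c z)))

end RationalCherednik

end DrinfeldOrbifold

end

open DrinfeldOrbifold in
theorem mainTheorem4 (n : ℕ) (hn : 4 ≤ n) :
    (∀ a b c : ℂ, ∃! κ : ParameterMap (Equiv.Perm (Fin n)) (DoubledStd n), HasValues a b c κ) ∧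
    (∀ (a b c : ℂ) (κ : ParameterMap (Equiv.Perm (Fin n)) (DoubledStd n)),
      HasValues a b c κ → κ.IsDrinfeldOrbifoldOverPoly) ∧
    (∀ κ : ParameterMap (Equiv.Perm (Fin n)) (DoubledStd n),
      (κ.IsDrinfeldOrbifold ∧
        (∀ (g : Equiv.Perm (Fin n)) (v : Fin 2 → DoubledStd n), g • κ.lin g v = κ.lin g v) ∧
        κ.lin 1 = 0 ∧ (κ.lin ≠ 0 ∨ κ.const 1 = 0)) ↔
      ∃ a b c : ℂ, HasValues a b c κ) ∧
    (∀ (c : ℂ) (κ : ParameterMap (Equiv.Perm (Fin n)) (DoubledStd n)), HasValues 0 0 c κ →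
      ∃ e : κ.Alg ≃ₐ[ℂ] Cherednik n 0 c,
        ∀ z : TensorSkew (Equiv.Perm (Fin n)) (DoubledStd n),
          e (κ.proj z) = cherednikProj n 0 c z) := by
  refine ⟨fun a b c => ⟨kappa n a b c, hasValues_kappa a b c, fun κ h => h.eq_kappa⟩,
    fun a b c κ h => h.eq_kappa ▸ isDrinfeldOrbifoldOverPoly_kappa n a b c, classification hn, fun c κ h => ?_⟩
  obtain rfl := h.eq_kappa
  exact ⟨cherednikEquiv n c, toCherednik_proj c⟩
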